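/- Let $K$ be an algebraically closed field of characteristic $0$, and let $m\ge n$ and $0\le k\le n-1$ be integers. Let $\mathbb{P}^{mn-1}$ be the projective space of nonzero $m\times n$ matrices over $K$ up to scalar, let $$\tau_{m,n,k}=\{\varphi\in\mathbb{P}^{mn-1} : \dim\ker\varphi\ge k\},$$ and let $G(k,n)$ be the Grassmannian of $k$-dimensional linear subspaces of $K^n$. Let $$\hat\tau_{m,n,k}=\{(\Lambda,\varphi)\in G(k,n)\times\mathbb{P}^{mn-1} : \varphi\in\tau_{m,n,k},\ \Lambda\subseteq\ker\varphi\},$$ and let $\nu\colon\hat\tau_{m,n,k}\to\tau_{m,n,k}$, $\nu(\Lambda,\varphi)=\varphi$ (the Tjurina transform). Both sets carry the reduced variety structure induced from the ambient varieties. Then $\nu$ is a small resolution of $\tau_{m,n,k}$. That is, $\tau_{m,n,k}$ and $\hat\tau_{m,n,k}$ are irreducible algebraic varieties, $\hat\tau_{m,n,k}$ is nonsingular, $\nu$ is a proper birational morphism, and for every integer $i>0$ $$\operatorname{codim}_{\tau_{m,n,k}}\{x\in\tau_{m,n,k} : \dim\nu^{-1}(x)\ge i\}>2i,$$ where the empty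 set has codimension $\infty$. -/

import Mathlib

open TopologicalSpace

universe u

/-- A space with functions over `K`: a topological space with a sheaf of `K`-valued functions.
`reg U` is the algebra of functions regular on the open set `U`; elements are total functions
of which only the values on `U` matter, by `mem_of_local`, which is the sheaf axiom. -/
structure SpaceWithFunctions (K : Type u) [Field K] where
  /-- the underlying set of points -/
  carrier : Type u
  /-- the (Zariski) topology -/
  [top : TopologicalSpace carrier]
  /-- the functions regular on an open set -/
  reg : Opens carrier → Subalgebra K (carrier → K)
  mem_of_local : ∀ (U : Opens carrier) (f : carrier → K),
    (∀ x ∈ U, ∃ V : Opens carrier, x ∈ V ∧ ∃ g ∈ reg V, Set.EqOn f g V) → f ∈ reg U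
  isOpen_ne : ∀ (U : Opens carrier), ∀ f ∈ reg U, IsOpen {x | x ∈ U ∧ f x ≠ 0}
  inv_mem : ∀ (U : Opens carrier), ∀ f ∈ reg U, (∀ x ∈ U, f x ≠ 0) → f⁻¹ ∈ reg U

namespace SpaceWithFunctions

variable {K : Type u} [Field K]

instance : CoeSort (SpaceWithFunctions K) (Type u) := ⟨carrier⟩

instance (X : SpaceWithFunctions K) : TopologicalSpace X.carrier := X.top

theorem reg_mono (X : SpaceWithFunctions K) {U V : Opens X} (h : V ≤ U) : X.reg U ≤ X.reg V :=
  fun f hf => X.mem_of_local V f fun _ hx => ⟨U, h hx, f, hf, fun _ _ => rfl⟩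

/-! ### Constructions -/

section Fractions

variable {T ι : Type u} (W : ι → Set T) (A : ι → Subalgebra K (T → K))

/-- The topology generated by the sets `{x ∈ W i | a x ≠ 0}`, `a ∈ A i`. -/
abbrev fracTopology : TopologicalSpace T :=
  generateFrom {S | ∃ i, ∃ a ∈ A i, S = {x | x ∈ W i ∧ a x ≠ 0}}

theorem fracTopology_basis (hcover : ∀ x, ∃ i, x ∈ W i)
    (hdir : ∀ i j, ∃ k, W k = W i ∩ W j ∧ A i ≤ A k ∧ A j ≤ A k) :
    @IsTopologicalBasis T (fracTopology W A)
      {S | ∃ i, ∃ a ∈ A i, S = {x | x ∈ W i ∧ a x ≠ 0}} := by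
  let _ := fracTopology W A
  refine ⟨?_, ?_, rfl⟩
  · rintro _ ⟨i, a, ha, rfl⟩ _ ⟨j, b, hb, rfl⟩ x ⟨⟨hxi, hax⟩, ⟨hxj, hbx⟩⟩
    obtain ⟨k, hk, hik, hjk⟩ := hdir i j
    refine ⟨_, ⟨k, a * b, mul_mem (hik ha) (hjk hb), rfl⟩, ⟨hk ▸ ⟨hxi, hxj⟩, mul_ne_zero hax hbx⟩, ?_⟩
    rintro y ⟨hy, hab⟩
    rw [hk] at hy
    exact ⟨⟨hy.1, left_ne_zero_of_mul hab⟩, ⟨hy.2, right_ne_zero_of_mul hab⟩⟩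
  · refine Set.eq_univ_of_forall fun x => ?_
    obtain ⟨i, hi⟩ := hcover x
    exact ⟨_, ⟨i, 1, one_mem _, rfl⟩, hi, one_ne_zero⟩

/-- The space with functions on `T` whose topology has the basis `{x ∈ W i | a x ≠ 0}`, `a ∈ A i`,
and whose regular functions are those which near every point are a fraction `a / b` with
`a, b ∈ A i` and `b` nowhere zero near that point. -/
def ofFractions (hcover : ∀ x, ∃ i, x ∈ W i)
    (hdir : ∀ i j, ∃ k, W k = W i ∩ W j ∧ A i ≤ A k ∧ A j ≤ A k) : SpaceWithFunctions K where
  carrier := T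
  top := fracTopology W A
  reg := fun (U : @Opens T (fracTopology W A)) =>
    { carrier := {f | ∀ x ∈ (@Opens.carrier T (fracTopology W A) U), ∃ i, x ∈ W i ∧ ∃ a ∈ A i, ∃ b ∈ A i, b x ≠ 0 ∧
        ∀ y ∈ (@Opens.carrier T (fracTopology W A) U), y ∈ W i → b y ≠ 0 → f y = a y / b y}
      mul_mem' := by
        intro f g hf hg x hx
        obtain ⟨i, hi, a, ha, b, hb, hbx, h⟩ := hf x hx
        obtain ⟨j, hj, a', ha', b', hb', hbx', h'⟩ := hg x hx
        obtain ⟨k, hk, hik, hjk⟩ := hdir i j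
        refine ⟨k, hk ▸ ⟨hi, hj⟩, a * a', mul_mem (hik ha) (hjk ha'), b * b',
          mul_mem (hik hb) (hjk hb'), mul_ne_zero hbx hbx', fun y hy hyk hyb => ?_⟩
        rw [hk] at hyk
        have h1 : b y ≠ 0 := left_ne_zero_of_mul hyb
        have h2 : b' y ≠ 0 := right_ne_zero_of_mul hyb
        simp only [Pi.mul_apply, h y hy hyk.1 h1, h' y hy hyk.2 h2]
        field_simp
      add_mem' := by
        intro f g hf hg x hx
        obtain ⟨i, hi, a, ha, b, hb, hbx, h⟩ := hf x hx
        obtain ⟨j, hj, a', ha', b', hb', hbx', h'⟩ := hg x hx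
        obtain ⟨k, hk, hik, hjk⟩ := hdir i j
        refine ⟨k, hk ▸ ⟨hi, hj⟩, a * b' + a' * b,
          add_mem (mul_mem (hik ha) (hjk hb')) (mul_mem (hjk ha') (hik hb)), b * b',
          mul_mem (hik hb) (hjk hb'), mul_ne_zero hbx hbx', fun y hy hyk hyb => ?_⟩
        rw [hk] at hyk
        have h1 : b y ≠ 0 := left_ne_zero_of_mul hyb
        have h2 : b' y ≠ 0 := right_ne_zero_of_mul hyb
        simp only [Pi.mul_apply, Pi.add_apply, h y hy hyk.1 h1, h' y hy hyk.2 h2]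
        field_simp
      algebraMap_mem' := by
        intro c x hx
        obtain ⟨i, hi⟩ := hcover x
        exact ⟨i, hi, algebraMap K _ c, Subalgebra.algebraMap_mem _ c, 1, one_mem _, one_ne_zero,
          fun y _ _ _ => by simp⟩ }
  mem_of_local := by
    let _ := fracTopology W A
    intro U f hf x hx
    obtain ⟨V, hxV, g, hg, hfg⟩ := hf x hx
    obtain ⟨i, hi, a, ha, b, hb, hbx, h⟩ := hg x hxV
    obtain ⟨_, ⟨j, c, hc, rfl⟩, ⟨hxj, hcx⟩, hsub⟩ :=
      (fracTopology_basis W A hcover hdir).exists_subset_of_mem_open hxV V.isOpen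
    obtain ⟨k, hk, hik, hjk⟩ := hdir i j
    refine ⟨k, hk ▸ ⟨hi, hxj⟩, a * c, mul_mem (hik ha) (hjk hc), b * c,
      mul_mem (hik hb) (hjk hc), mul_ne_zero hbx hcx, fun y hy hyk hyb => ?_⟩
    rw [hk] at hyk
    have h1 : b y ≠ 0 := left_ne_zero_of_mul hyb
    have h2 : c y ≠ 0 := right_ne_zero_of_mul hyb
    have hyV : y ∈ V := hsub ⟨hyk.2, h2⟩
    rw [hfg hyV, h y hyV hyk.1 h1]
    simp only [Pi.mul_apply]
    field_simp
  isOpen_ne := by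
    let _ := fracTopology W A
    intro U f hf
    have hB := fracTopology_basis W A hcover hdir
    rw [isOpen_iff_forall_mem_open]
    rintro x ⟨hx, hfx⟩
    obtain ⟨i, hi, a, ha, b, hb, hbx, h⟩ := hf x hx
    have hax : a x ≠ 0 := by
      intro h0
      exact hfx (by rw [h x hx hi hbx, h0, zero_div])
    refine ⟨U.carrier ∩ {y | y ∈ W i ∧ (a * b) y ≠ 0}, ?_,
      U.isOpen.inter (hB.isOpen ⟨i, a * b, mul_mem ha hb, rfl⟩), hx, hi, mul_ne_zero hax hbx⟩
    rintro y ⟨hy, hyi, hab⟩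
    have h1 : a y ≠ 0 := left_ne_zero_of_mul hab
    have h2 : b y ≠ 0 := right_ne_zero_of_mul hab
    refine ⟨hy, ?_⟩
    rw [h y hy hyi h2]
    exact div_ne_zero h1 h2
  inv_mem := by
    intro U f hf hne x hx
    obtain ⟨i, hi, a, ha, b, hb, hbx, h⟩ := hf x hx
    have hax : a x ≠ 0 := by
      intro h0
      exact hne x hx (by rw [h x hx hi hbx, h0, zero_div])
    refine ⟨i, hi, b * b, mul_mem hb hb, a * b, mul_mem ha hb, mul_ne_zero hax hbx,
      fun y hy hyi hab => ?_⟩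
    have h1 : a y ≠ 0 := left_ne_zero_of_mul hab
    have h2 : b y ≠ 0 := right_ne_zero_of_mul hab
    simp only [Pi.inv_apply, Pi.mul_apply, h y hy hyi h2]
    field_simp

end Fractions

/-- The algebra of polynomial functions on a vector space, generated by the linear forms. -/
def polyFun (K V : Type u) [Field K] [AddCommGroup V] [Module K V] : Subalgebra K (V → K) :=
  Algebra.adjoin K {f | ∃ l : Module.Dual K V, f = fun v => l v}

/-- The affine space of a (finite-dimensional) vector space `V`: the topology has the basis
`{v | a v ≠ 0}`, `a` polynomial, and regular functions are locally fractions of polynomials. -/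
def affine (K V : Type u) [Field K] [AddCommGroup V] [Module K V] : SpaceWithFunctions K :=
  ofFractions (T := V) (ι := PUnit) (fun _ => Set.univ) (fun _ => polyFun K V)
    (fun _ => ⟨PUnit.unit, trivial⟩)
    (fun _ _ => ⟨PUnit.unit, (Set.inter_univ _).symm, le_rfl, le_rfl⟩)

/-- The functions `∑ fᵢ(x) gᵢ(y)` on `X × Y` with `fᵢ` regular on `U` and `gᵢ` regular on `V`. -/
def prodFun (X Y : SpaceWithFunctions K) (U : Opens X) (V : Opens Y) :
    Subalgebra K (X.carrier × Y.carrier → K) :=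
  Algebra.adjoin K
    ({h | ∃ f ∈ X.reg U, h = fun w => f w.1} ∪ {h | ∃ g ∈ Y.reg V, h = fun w => g w.2})

theorem prodFun_mono (X Y : SpaceWithFunctions K) {U U' : Opens X} {V V' : Opens Y}
    (hU : U' ≤ U) (hV : V' ≤ V) : prodFun X Y U V ≤ prodFun X Y U' V' := by
  refine Algebra.adjoin_mono (Set.union_subset_union ?_ ?_)
  · rintro _ ⟨f, hf, rfl⟩
    exact ⟨f, X.reg_mono hU hf, rfl⟩
  · rintro _ ⟨f, hf, rfl⟩
    exact ⟨f, Y.reg_mono hV hf, rfl⟩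

/-- The product: the topology has the basis of all `{(x, y) ∈ U × V | ∑ fᵢ(x) gᵢ(y) ≠ 0}`, and
regular functions are locally fractions of functions `∑ fᵢ(x) gᵢ(y)`. -/
def prod (X Y : SpaceWithFunctions K) : SpaceWithFunctions K :=
  ofFractions (T := X.carrier × Y.carrier) (ι := Opens X × Opens Y)
    (fun i => (i.1 : Set X) ×ˢ (i.2 : Set Y)) (fun i => prodFun X Y i.1 i.2)
    (fun _ => ⟨(⊤, ⊤), trivial, trivial⟩)
    (fun i j => ⟨(i.1 ⊓ j.1, i.2 ⊓ j.2), by simp [Set.prod_inter_prod],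
      prodFun_mono X Y inf_le_left inf_le_left, prodFun_mono X Y inf_le_right inf_le_right⟩)

/-- The structure induced on a subset `S`: the subspace topology, and the functions which are
locally restrictions of regular functions. -/
def restrict (X : SpaceWithFunctions K) (S : Set X) : SpaceWithFunctions K where
  carrier := S
  reg := fun U =>
    { carrier := {f | ∀ x ∈ U, ∃ V : Opens X, x.1 ∈ V ∧ ∃ g ∈ X.reg V,
        ∀ y ∈ U, y.1 ∈ V → f y = g y.1}
      mul_mem' := by
        intro f f' hf hf' x hx
        obtain ⟨V, hV, g, hg, h⟩ := hf x hx
        obtain ⟨V', hV', g', hg', h'⟩ := hf' x hx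
        exact ⟨V ⊓ V', ⟨hV, hV'⟩, g * g', mul_mem (X.reg_mono inf_le_left hg)
          (X.reg_mono inf_le_right hg'), fun y hy hyV => by
            simp [h y hy hyV.1, h' y hy hyV.2]⟩
      add_mem' := by
        intro f f' hf hf' x hx
        obtain ⟨V, hV, g, hg, h⟩ := hf x hx
        obtain ⟨V', hV', g', hg', h'⟩ := hf' x hx
        exact ⟨V ⊓ V', ⟨hV, hV'⟩, g + g', add_mem (X.reg_mono inf_le_left hg)
          (X.reg_mono inf_le_right hg'), fun y hy hyV => by
            simp [h y hy hyV.1, h' y hy hyV.2]⟩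
      algebraMap_mem' := fun c _ _ =>
        ⟨⊤, trivial, algebraMap K _ c, Subalgebra.algebraMap_mem _ c, fun _ _ _ => rfl⟩ }
  mem_of_local := by
    intro U f hf x hx
    obtain ⟨V, hxV, f', hf', hff'⟩ := hf x hx
    obtain ⟨V', hV', g, hg, h⟩ := hf' x hxV
    obtain ⟨O, hO, hOV⟩ := isOpen_induced_iff.mp V.isOpen
    have key : ∀ y : S, y.1 ∈ O → y ∈ V := fun y hy => by
      have : y ∈ (Subtype.val ⁻¹' O : Set S) := hy
      rw [hOV] at this
      exact this
    have hxO : x.1 ∈ O := by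
      have : x ∈ (Subtype.val ⁻¹' O : Set S) := by
        rw [hOV]
        exact hxV
      exact this
    refine ⟨V' ⊓ ⟨O, hO⟩, ⟨hV', hxO⟩, g, X.reg_mono inf_le_left hg, fun y _ hyV => ?_⟩
    rw [hff' (key y hyV.2), h y (key y hyV.2) hyV.1]
  isOpen_ne := by
    intro U f hf
    rw [isOpen_iff_forall_mem_open]
    rintro x ⟨hx, hfx⟩
    obtain ⟨V, hV, g, hg, h⟩ := hf x hx
    refine ⟨(U : Set S) ∩ Subtype.val ⁻¹' {z | z ∈ V ∧ g z ≠ 0}, ?_,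
      U.isOpen.inter ((X.isOpen_ne V g hg).preimage continuous_subtype_val), hx, hV, ?_⟩
    · rintro y ⟨hy, hyV, hgy⟩
      exact ⟨hy, by rw [h y hy hyV]; exact hgy⟩
    · rw [← h x hx hV]
      exact hfx
  inv_mem := by
    intro U f hf hne x hx
    obtain ⟨V, hV, g, hg, h⟩ := hf x hx
    have hgx : g x.1 ≠ 0 := by
      rw [← h x hx hV]
      exact hne x hx
    let V' : Opens X := ⟨{z | z ∈ V ∧ g z ≠ 0}, X.isOpen_ne V g hg⟩
    have hV' : V' ≤ V := fun z hz => hz.1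
    exact ⟨V', ⟨hV, hgx⟩, g⁻¹, X.inv_mem V' g (X.reg_mono hV' hg) fun z hz => hz.2,
      fun y hy hyV => by simp [h y hy hyV.1]⟩

/-- The quotient structure along `q : X → T`: a set is open if its preimage is, and a function is
regular on `U` if its composite with `q` is regular on the preimage of `U`. -/
def coinduced (X : SpaceWithFunctions K) {T : Type u} (q : X → T) : SpaceWithFunctions K :=
  letI : TopologicalSpace T := TopologicalSpace.coinduced q X.top
  let pre : Opens T → Opens X := fun U => ⟨q ⁻¹' U, U.isOpen⟩
  { carrier := T
    reg := fun U =>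
      { carrier := {f | f ∘ q ∈ X.reg (pre U)}
        mul_mem' := fun {a b} ha hb => (X.reg (pre U)).mul_mem (x := a ∘ q) (y := b ∘ q) ha hb
        add_mem' := fun {a b} ha hb => (X.reg (pre U)).add_mem (x := a ∘ q) (y := b ∘ q) ha hb
        algebraMap_mem' := fun c => Subalgebra.algebraMap_mem (X.reg (pre U)) c }
    mem_of_local := by
      intro U f hf
      refine X.mem_of_local (pre U) (f ∘ q) fun x hx => ?_
      obtain ⟨V, hV, g, hg, h⟩ := hf (q x) hx
      exact ⟨pre V, hV, g ∘ q, hg, fun y hy => h hy⟩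
    isOpen_ne := fun U f hf => X.isOpen_ne (pre U) (f ∘ q) hf
    inv_mem := fun U f hf hne => X.inv_mem (pre U) (f ∘ q) hf fun x hx => hne (q x) hx }

/-! ### Morphisms and varieties -/

/-- Morphisms: continuous maps that pull regular functions back to regular functions. -/
def IsMorphism {X Y : SpaceWithFunctions K} (p : X → Y) : Prop :=
  ∃ hp : Continuous p, ∀ (U : Opens Y), ∀ f ∈ Y.reg U, f ∘ p ∈ X.reg (Opens.comap ⟨p, hp⟩ U)

/-- Isomorphisms: morphisms with an inverse morphism. -/
def IsIso {X Y : SpaceWithFunctions K} (p : X → Y) : Prop :=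
  IsMorphism p ∧ ∃ q : Y → X, IsMorphism q ∧ Function.LeftInverse q p ∧ Function.RightInverse q p

/-- Affine algebraic sets: isomorphic to a Zariski closed subset of some affine space `K ^ N`. -/
def IsAffine (X : SpaceWithFunctions K) : Prop :=
  ∃ (N : ℕ) (Z : Set (affine K (Fin N → K))), IsClosed Z ∧
    ∃ p : X → (affine K (Fin N → K)).restrict Z, IsIso p

/-- The diagonal is closed in the product variety. -/
def IsSeparated (X : SpaceWithFunctions K) : Prop :=
  IsClosed (X := (X.prod X).carrier) {w : X.carrier × X.carrier | w.1 = w.2}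

/-- Irreducible algebraic varieties: irreducible separated spaces with functions which have a finite
open cover by affine algebraic sets. -/
structure IsVariety (X : SpaceWithFunctions K) : Prop where
  irreducible : IrreducibleSpace X
  separated : IsSeparated X
  cover : ∃ (r : ℕ) (U : Fin r → Opens X), (∀ x, ∃ i, x ∈ U i) ∧
    ∀ i, IsAffine (X.restrict (U i : Set X))

/-- The local ring at `x`: germs at `x` of functions regular on a neighbourhood of `x`. -/
def localRing (X : SpaceWithFunctions K) (x : X) : Subring (Filter.Germ (nhds x) K) where
  carrier := {g | ∃ U : Opens X, x ∈ U ∧ ∃ f ∈ X.reg U, g = (f : Filter.Germ (nhds x) K)}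
  mul_mem' := by
    rintro _ _ ⟨U, hU, f, hf, rfl⟩ ⟨V, hV, g, hg, rfl⟩
    exact ⟨U ⊓ V, ⟨hU, hV⟩, f * g,
      mul_mem (X.reg_mono inf_le_left hf) (X.reg_mono inf_le_right hg), rfl⟩
  add_mem' := by
    rintro _ _ ⟨U, hU, f, hf, rfl⟩ ⟨V, hV, g, hg, rfl⟩
    exact ⟨U ⊓ V, ⟨hU, hV⟩, f + g,
      add_mem (X.reg_mono inf_le_left hf) (X.reg_mono inf_le_right hg), rfl⟩
  one_mem' := ⟨⊤, trivial, 1, one_mem _, rfl⟩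
  zero_mem' := ⟨⊤, trivial, 0, zero_mem _, rfl⟩
  neg_mem' := by
    rintro _ ⟨U, hU, f, hf, rfl⟩
    exact ⟨U, hU, -f, neg_mem hf, rfl⟩

/-- Nonsingular: all local rings are regular local rings. -/
def IsSmooth (X : SpaceWithFunctions K) : Prop :=
  ∀ x : X, IsRegularLocalRing (X.localRing x)

/-- Proper morphisms between varieties: `p × id : Y × Z → X × Z` is a closed map for every
variety `Z`. -/
def IsProper {Y X : SpaceWithFunctions K} (p : Y → X) : Prop :=
  ∀ Z : SpaceWithFunctions K, IsVariety Z →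
    IsClosedMap (X := (Y.prod Z).carrier) (Y := (X.prod Z).carrier) (Prod.map p id)

/-- Birational morphisms between irreducible varieties: `p` restricts to an isomorphism between
nonempty open subsets `V` of `Y` and `U` of `X`. -/
def IsBirational {Y X : SpaceWithFunctions K} (p : Y → X) : Prop :=
  ∃ (V : Opens Y) (U : Opens X), (V : Set Y).Nonempty ∧ (U : Set X).Nonempty ∧
    ∃ h : Set.MapsTo p V U,
      IsIso (X := Y.restrict (V : Set Y)) (Y := X.restrict (U : Set X)) (h.restrict p V U)

/-- Resolutions of singularities: proper birational morphisms of varieties with nonsingular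
source. -/
structure IsResolution {Y X : SpaceWithFunctions K} (p : Y → X) : Prop where
  target : IsVariety X
  source : IsVariety Y
  smooth : IsSmooth Y
  morphism : IsMorphism p
  proper : IsProper p
  birational : IsBirational p

open Classical in
/-- The codimension `dim X - dim Z` of a subset `Z` of an irreducible variety `X`, where `dim` is
the Krull dimension of the topology; the empty set has codimension `⊤`. -/
noncomputable def codim (X : SpaceWithFunctions K) (Z : Set X) : ℕ∞ :=
  if Z = ∅ then ⊤ else (topologicalKrullDim X).unbotD 0 - (topologicalKrullDim Z).unbotD 0

/-- Small resolutions: resolutions of singularities such that for all `i > 0` the locus of points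
whose fibre has dimension at least `i` has codimension greater than `2 * i`. -/
structure IsSmallResolution {Y X : SpaceWithFunctions K} (p : Y → X) : Prop where
  resolution : IsResolution p
  small : ∀ i : ℕ, 0 < i →
    ((2 * i : ℕ) : ℕ∞) < X.codim {x | (i : WithBot ℕ∞) ≤ topologicalKrullDim (p ⁻¹' {x})}

end SpaceWithFunctions

/-! ### Projective spaces, Grassmannians, determinantal varieties -/

namespace Determinantal

open SpaceWithFunctions

/-- The set `V ∖ {0}`. -/
def nonzeroVectors (V : Type u) [AddCommGroup V] : Set V := {v | v ≠ 0}

/-- The projective space `ℙ(V)` as a variety: the quotient of `V ∖ {0}` by scalars. -/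
def projSpace (K V : Type u) [Field K] [AddCommGroup V] [Module K V] : SpaceWithFunctions K :=
  ((affine K V).restrict (nonzeroVectors V)).coinduced (T := Projectivization K V)
    (fun v : {v : V // v ≠ 0} => Projectivization.mk' K v)

/-- The frame variety: `k`-tuples of linearly independent vectors in `K ^ n`, an open subset of
the affine space of all `k`-tuples. -/
def frames (K : Type u) [Field K] (k n : ℕ) : SpaceWithFunctions K :=
  (affine K (Fin k → Fin n → K)).restrict {A : Fin k → Fin n → K | LinearIndependent K A}

/-- The subspace spanned by a frame. -/
def spanOfFrame (K : Type u) [Field K] (k n : ℕ)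
    (A : {A : Fin k → Fin n → K // LinearIndependent K A}) :
    {L : Submodule K (Fin n → K) // Module.finrank K L = k} :=
  ⟨Submodule.span K (Set.range A.1), by simpa using finrank_span_eq_card A.2⟩

/-- The Grassmannian `G(k, n)` of `k`-dimensional linear subspaces of `K ^ n` as a variety: the
quotient of the frame variety by `GL_k`. -/
def grassmannian (K : Type u) [Field K] (k n : ℕ) : SpaceWithFunctions K :=
  (frames K k n).coinduced (T := {L : Submodule K (Fin n → K) // Module.finrank K L = k})
    (spanOfFrame K k n)

/-- The kernel in `K ^ n` of a nonzero `m × n` matrix given up to scalar. -/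
noncomputable def ker {K : Type u} [Field K] {m n : ℕ}
    (φ : Projectivization K (Matrix (Fin m) (Fin n) K)) : Submodule K (Fin n → K) :=
  LinearMap.ker φ.rep.mulVecLin

/-- The set of matrices up to scalar whose kernel has dimension at least `k`. -/
def tauSet (K : Type u) [Field K] (m n k : ℕ) :
    Set (Projectivization K (Matrix (Fin m) (Fin n) K)) :=
  {φ | k ≤ Module.finrank K (ker φ)}

/-- The determinantal variety `τ_{m,n,k}` in `ℙ ^ (mn - 1)`. -/
def tau (K : Type u) [Field K] (m n k : ℕ) : SpaceWithFunctions K :=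
  (projSpace K (Matrix (Fin m) (Fin n) K)).restrict (tauSet K m n k)

/-- The incidence set `{(Λ, φ) | φ ∈ τ_{m,n,k}, Λ ⊆ ker φ}`. -/
def tauHatSet (K : Type u) [Field K] (m n k : ℕ) :
    Set ({L : Submodule K (Fin n → K) // Module.finrank K L = k} ×
      Projectivization K (Matrix (Fin m) (Fin n) K)) :=
  {w | w.2 ∈ tauSet K m n k ∧ w.1.1 ≤ ker w.2}

/-- The Tjurina transform of `τ_{m,n,k}`, inside `G(k, n) × ℙ ^ (mn - 1)`. -/
def tauHat (K : Type u) [Field K] (m n k : ℕ) : SpaceWithFunctions K :=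
  ((grassmannian K k n).prod (projSpace K (Matrix (Fin m) (Fin n) K))).restrict
    (tauHatSet K m n k)

/-- The projection `ν (Λ, φ) = φ`. -/
def nu (K : Type u) [Field K] (m n k : ℕ) : tauHat K m n k → tau K m n k :=
  fun w : tauHatSet K m n k => (⟨w.1.2, w.2.1⟩ : tauSet K m n k)

end Determinantal

/-! Put l = n - k. In the standard chart of the Grassmannian, Λ is the row space of a matrix (1 |
B), and Λ ⊆ ker φ says exactly that the left block of φ is -ΦBᵀ, where Φ is its right block. So B
and Φ, with one entry of Φ scaled to 1, are free coordinates on the incidence variety (`freeChart`).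
It is therefore covered by affine spaces of dimension (k + m)l - 1, and its local rings are
localizations of polynomial rings, hence regular. It is irreducible because it is the image of an
open subset of the affine space of pairs of matrices (`exists_isMorphism_parameters`); τ is
irreducible because ν is onto.

Properness is the completeness of the Grassmannian, proved with valuations
(`exists_mem_of_renormalize_mem`). If a point lies in the closure of the projection of a closed set,
some generic point over the closed set specializes to it along a valuation ring. In the chart whose
maximal minor has the largest valuation the coordinates of Λ are integral, and the Nullstellensatz
turns the specialization into a point over K. For birationality, where an l × l minor of φ is
invertible, Cramer's rule gives B as a regular function of φ, so Λ is recovered from φ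
(`isIso_nu_restrict`).

Smallness is a dimension count. The dimension of τ is (k + m)l - 1: at most that because a closed
continuous surjection from a Noetherian space does not raise Krull dimension
(`IsClosedMap.topologicalKrullDim_le`), at least that because a nonempty open subset of an affine
space embeds in τ. If ker φ has dimension k + d, the fibre over φ has dimension at most kd. Hence a
fibre of dimension at least i forces d ≥ s, where s is least with ks ≥ i, and φ lies in the
determinantal variety for k + s. The codimension is at least s(m - n + 2k + s) = 2ks + s(m - n + s),
which exceeds 2i. -/

namespace SpaceWithFunctions

variable {K : Type u} [Field K] {X Y Z : SpaceWithFunctions K}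

/-! ### Regular functions and morphisms -/

theorem reg_congr {U : Opens X} {f g : X → K} (hf : f ∈ X.reg U) (h : Set.EqOn g f U) :
    g ∈ X.reg U :=
  X.mem_of_local U g fun _ hx => ⟨U, hx, f, hf, h⟩

theorem const_mem_reg (U : Opens X) (a : K) : (fun _ => a) ∈ X.reg U :=
  Subalgebra.algebraMap_mem (X.reg U) a

theorem div_mem_reg {U : Opens X} {f g : X → K} (hf : f ∈ X.reg U) (hg : g ∈ X.reg U)
    (h : ∀ x ∈ U, g x ≠ 0) : (fun x => f x / g x) ∈ X.reg U := by
  have := mul_mem hf (X.inv_mem U g hg h)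
  refine reg_congr this fun x _ => ?_
  simp [div_eq_mul_inv]

theorem isClosed_setOf_eq {J : Type*} {f g : J → X → K} (hf : ∀ j, f j ∈ X.reg ⊤)
    (hg : ∀ j, g j ∈ X.reg ⊤) : IsClosed {x | ∀ j, f j x = g j x} := by
  have : {x | ∀ j, f j x = g j x} = ⋂ j, {x | x ∈ (⊤ : Opens X) ∧ (f j - g j) x ≠ 0}ᶜ := by
    ext x
    simp [sub_eq_zero]
  rw [this]
  exact isClosed_iInter fun j => (X.isOpen_ne ⊤ _ (sub_mem (hf j) (hg j))).isClosed_compl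

theorem isMorphism_id : IsMorphism (X := X) (Y := X) id :=
  ⟨continuous_id, fun _ _ hf => hf⟩

theorem IsMorphism.continuous {p : X → Y} (hp : IsMorphism p) : Continuous p := hp.1

theorem IsMorphism.reg {p : X → Y} (hp : IsMorphism p) {U : Opens Y} {f : Y → K}
    (hf : f ∈ Y.reg U) {W : Opens X} (hW : Set.MapsTo p W U) : (fun x => f (p x)) ∈ X.reg W := by
  obtain ⟨h, h'⟩ := hp
  exact X.reg_mono (V := W) (U := Opens.comap ⟨p, h⟩ U) (fun x hx => hW hx) (h' U f hf)

theorem IsMorphism.comp {q : Y → Z} {p : X → Y} (hq : IsMorphism q) (hp : IsMorphism p) :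
    IsMorphism (fun x => q (p x)) :=
  ⟨hq.continuous.comp hp.continuous, fun U _ hf =>
    hp.reg (hq.reg (W := Opens.comap ⟨q, hq.continuous⟩ U) hf fun _ hx => hx) fun _ hx => hx⟩

/-! ### Morphisms into spaces whose regular functions are local fractions. -/

section Fractions

variable {T ι : Type u} {W : ι → Set T} {A : ι → Subalgebra K (T → K)}
  {hcover : ∀ x, ∃ i, x ∈ W i} {hdir : ∀ i j, ∃ k, W k = W i ∩ W j ∧ A i ≤ A k ∧ A j ≤ A k}

theorem isOpen_ofFractions {i : ι} {a : T → K} (ha : a ∈ A i) :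
    IsOpen (X := (ofFractions W A hcover hdir).carrier) {x : T | x ∈ W i ∧ a x ≠ 0} :=
  let _ := fracTopology W A
  (fracTopology_basis W A hcover hdir).isOpen ⟨i, a, ha, rfl⟩

theorem isOpen_ofFractions_source (i : ι) :
    IsOpen (X := (ofFractions W A hcover hdir).carrier) (W i) := by
  have := isOpen_ofFractions (hcover := hcover) (hdir := hdir) (one_mem (A i))
  have h : {x : T | x ∈ W i ∧ (1 : T → K) x ≠ 0} = W i := by ext; simp
  exact h ▸ this

theorem exists_subset_of_isOpen_ofFractions {O : Set T}
    (hO : IsOpen (X := (ofFractions W A hcover hdir).carrier) O) {x : T} (hx : x ∈ O) :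
    ∃ i, ∃ a ∈ A i, x ∈ W i ∧ a x ≠ 0 ∧ ∀ y ∈ W i, a y ≠ 0 → y ∈ O := by
  let _ := fracTopology W A
  obtain ⟨_, ⟨i, a, ha, rfl⟩, ⟨h1, h2⟩, h3⟩ :=
    (fracTopology_basis W A hcover hdir).exists_subset_of_mem_open hx hO
  exact ⟨i, a, ha, h1, h2, fun y hy hay => h3 ⟨hy, hay⟩⟩

theorem mem_reg_ofFractions {i : ι} {a : T → K} (ha : a ∈ A i) {U : Opens (ofFractions W A hcover hdir)}
    (hU : ∀ x : T, x ∈ U.carrier → x ∈ W i) : a ∈ (ofFractions W A hcover hdir).reg U := by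
  intro x hx
  exact ⟨i, hU x hx, a, ha, 1, one_mem _, one_ne_zero, fun y _ _ _ => by simp⟩

/-- Testing on the generators suffices: basic open sets pull back to nonvanishing loci of regular
functions, and fractions pull back to fractions. Morphisms into affine spaces and into products are
both recognized this way. -/
theorem isMorphism_ofFractions {p : X → T} (h1 : ∀ i, IsOpen (p ⁻¹' W i))
    (h2 : ∀ i, ∀ a ∈ A i, (fun x => a (p x)) ∈ X.reg ⟨p ⁻¹' W i, h1 i⟩) :
    IsMorphism (Y := ofFractions W A hcover hdir) p := by
  have hc : Continuous (Y := (ofFractions W A hcover hdir).carrier) p := by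
    let _ := fracTopology W A
    refine continuous_generateFrom_iff.mpr ?_
    rintro _ ⟨i, a, ha, rfl⟩
    exact X.isOpen_ne _ _ (h2 i a ha)
  refine ⟨hc, fun U f hf => X.mem_of_local _ _ fun x hx => ?_⟩
  obtain ⟨i, hi, a, ha, b, hb, hbx, h⟩ := hf (p x) hx
  let O : Opens X := ⟨p ⁻¹' W i, h1 i⟩
  let V : Opens X := ⟨{y | y ∈ O ∧ b (p y) ≠ 0}, X.isOpen_ne O _ (h2 i b hb)⟩
  have hV : V ≤ O := fun y hy => hy.1
  refine ⟨V ⊓ ⟨p ⁻¹' U.carrier, U.isOpen.preimage hc⟩, ⟨⟨hi, hbx⟩, hx⟩, fun y => a (p y) / b (p y),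
    X.reg_mono inf_le_left (div_mem_reg (X.reg_mono hV (h2 i a ha)) (X.reg_mono hV (h2 i b hb))
      fun y hy => hy.2), fun y hy => h (p y) hy.2 hy.1.1 hy.1.2⟩

end Fractions

/-! ### Products -/

theorem comp_mem_of_mem_adjoin {T T' : Type*} (p : T → T') {s : Set (T' → K)}
    {B : Subalgebra K (T → K)} (h : ∀ f ∈ s, (fun x => f (p x)) ∈ B) {f : T' → K}
    (hf : f ∈ Algebra.adjoin K s) : (fun x => f (p x)) ∈ B := by
  induction hf using Algebra.adjoin_induction with
  | mem f hf => exact h f hf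
  | algebraMap r => exact B.algebraMap_mem r
  | add f g _ _ hf hg => exact B.add_mem hf hg
  | mul f g _ _ hf hg => exact B.mul_mem hf hg

theorem isMorphism_fst : IsMorphism (X := X.prod Y) (Y := X) (fun w : X.carrier × Y.carrier => w.1) := by
  have hc : Continuous (X := (X.prod Y).carrier) (fun w : X.carrier × Y.carrier => w.1) := by
    refine ⟨fun U hU => ?_⟩
    have := isOpen_ofFractions_source (hcover := fun _ => ⟨((⊤ : Opens X), (⊤ : Opens Y)), trivial, trivial⟩)
      (hdir := fun i j => ⟨(i.1 ⊓ j.1, i.2 ⊓ j.2), by simp [Set.prod_inter_prod],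
      prodFun_mono X Y inf_le_left inf_le_left, prodFun_mono X Y inf_le_right inf_le_right⟩)
      (W := fun i : Opens X × Opens Y => (i.1 : Set X) ×ˢ (i.2 : Set Y))
      (A := fun i => prodFun X Y i.1 i.2) ((⟨U, hU⟩ : Opens X), (⊤ : Opens Y))
    refine Eq.mp (congrArg (IsOpen (X := (X.prod Y).carrier)) ?_) this
    ext w
    simp only [Opens.coe_mk, Opens.coe_top, Set.mem_prod, Set.mem_univ, and_true]
    exact Iff.rfl
  refine ⟨hc, fun U f hf => ?_⟩
  refine mem_reg_ofFractions (i := (U, (⊤ : Opens Y)))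
    (A := fun i : Opens X × Opens Y => prodFun X Y i.1 i.2)
    (Algebra.subset_adjoin (Or.inl ⟨f, hf, rfl⟩)) fun w (hw : w.1 ∈ U) => ⟨hw, trivial⟩

theorem isMorphism_snd : IsMorphism (X := X.prod Y) (Y := Y) (fun w : X.carrier × Y.carrier => w.2) := by
  have hc : Continuous (X := (X.prod Y).carrier) (fun w : X.carrier × Y.carrier => w.2) := by
    refine ⟨fun U hU => ?_⟩
    have := isOpen_ofFractions_source (hcover := fun _ => ⟨((⊤ : Opens X), (⊤ : Opens Y)), trivial, trivial⟩)
      (hdir := fun i j => ⟨(i.1 ⊓ j.1, i.2 ⊓ j.2), by simp [Set.prod_inter_prod],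
      prodFun_mono X Y inf_le_left inf_le_left, prodFun_mono X Y inf_le_right inf_le_right⟩)
      (W := fun i : Opens X × Opens Y => (i.1 : Set X) ×ˢ (i.2 : Set Y))
      (A := fun i => prodFun X Y i.1 i.2) ((⊤ : Opens X), (⟨U, hU⟩ : Opens Y))
    refine Eq.mp (congrArg (IsOpen (X := (X.prod Y).carrier)) ?_) this
    ext w
    simp only [Opens.coe_mk, Opens.coe_top, Set.mem_prod, Set.mem_univ, true_and]
    exact Iff.rfl
  refine ⟨hc, fun U f hf => ?_⟩
  refine mem_reg_ofFractions (i := ((⊤ : Opens X), U))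
    (A := fun i : Opens X × Opens Y => prodFun X Y i.1 i.2)
    (Algebra.subset_adjoin (Or.inr ⟨f, hf, rfl⟩)) fun w (hw : w.2 ∈ U) => ⟨trivial, hw⟩

/-- The universal property of the product. Continuity is not componentwise, since the topology of
`X.prod Y` is in general finer than the product topology; it comes from pulling back the functions ∑
fᵢ(x) gᵢ(y). -/
theorem IsMorphism.prodMk {p : Z → X} {q : Z → Y} (hp : IsMorphism p) (hq : IsMorphism q) :
    IsMorphism (X := Z) (Y := X.prod Y) (fun z => ((p z, q z) : X.carrier × Y.carrier)) := by
  refine isMorphism_ofFractions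
    (fun i => (i.1.isOpen.preimage hp.continuous).inter (i.2.isOpen.preimage hq.continuous))
    fun i a ha => ?_
  refine comp_mem_of_mem_adjoin (fun z => (p z, q z)) ?_ ha
  rintro _ (⟨f, hf, rfl⟩ | ⟨g, hg, rfl⟩)
  · exact hp.reg hf fun z hz => hz.1
  · exact hq.reg hg fun z hz => hz.2

theorem IsMorphism.prodMap {X' Y' : SpaceWithFunctions K} {p : X → X'} {q : Y → Y'}
    (hp : IsMorphism p) (hq : IsMorphism q) :
    IsMorphism (X := X.prod Y) (Y := X'.prod Y') (Prod.map p q) :=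
  (hp.comp isMorphism_fst).prodMk (hq.comp isMorphism_snd)

/-! ### Subspaces -/

theorem isMorphism_val (S : Set X) :
    IsMorphism (X := X.restrict S) (Y := X) (fun x : S => x.1) :=
  ⟨continuous_subtype_val, fun U f hf _ hx => ⟨U, hx, f, hf, fun _ _ _ => rfl⟩⟩

theorem IsMorphism.codRestrict {p : Z → X} (hp : IsMorphism p) {S : Set X} (h : ∀ z, p z ∈ S) :
    IsMorphism (X := Z) (Y := X.restrict S) (fun z => (⟨p z, h z⟩ : S)) := by
  have hc : Continuous (Y := (X.restrict S).carrier) (fun z => (⟨p z, h z⟩ : S)) :=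
    hp.continuous.subtype_mk h
  refine ⟨hc, fun U f hf => Z.mem_of_local _ _ fun z hz => ?_⟩
  obtain ⟨V, hV, g, hg, hfg⟩ := hf _ hz
  refine ⟨Opens.comap ⟨p, hp.continuous⟩ V ⊓ Opens.comap ⟨_, hc⟩ U, ⟨hV, hz⟩, fun y => g (p y),
    hp.reg hg fun y hy => hy.1, fun y hy => hfg _ hy.2 hy.1⟩

theorem IsMorphism.restrict {p : Z → X} (hp : IsMorphism p) {S : Set Z} {T : Set X}
    (h : Set.MapsTo p S T) :
    IsMorphism (X := Z.restrict S) (Y := X.restrict T) (h.restrict p S T) :=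
  (hp.comp (isMorphism_val S)).codRestrict fun z => h z.2

/-- The open subset of `X` given by an open subset of an open subspace. -/
def openImage (W : Opens X) (U : Opens (X.restrict (W : Set X))) : Opens X :=
  ⟨Subtype.val '' U.carrier, W.isOpen.isOpenMap_subtype_val _ U.isOpen⟩

/-- Passing to an open subspace creates no new regular functions: the local extensions agree with
`f` on sets that are open in `X` itself, so they glue. -/
theorem mem_reg_openImage {W : Opens X} {U : Opens (X.restrict (W : Set X))} {f : X → K}
    (hf : (fun x : (W : Set X) => f x.1) ∈ (X.restrict (W : Set X)).reg U) :
    f ∈ X.reg (openImage W U) := by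
  refine X.mem_of_local _ _ ?_
  rintro _ ⟨x, hx, rfl⟩
  obtain ⟨V, hV, g, hg, h⟩ := hf x hx
  refine ⟨V ⊓ openImage W U, ⟨hV, x, hx, rfl⟩, g, X.reg_mono inf_le_left hg, ?_⟩
  rintro _ ⟨hy, y, hyU, rfl⟩
  exact h y hyU hy

/-! ### Quotients -/

theorem isMorphism_coinduced {T : Type u} (q : X → T) :
    IsMorphism (X := X) (Y := X.coinduced q) q :=
  ⟨continuous_coinduced_rng, fun _ _ hf => hf⟩

/-! ### Affine spaces -/

section Affine

variable {V : Type u} [AddCommGroup V] [Module K V]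

theorem isMorphism_affine {p : X → V}
    (h : ∀ l : Module.Dual K V, (fun x => l (p x)) ∈ X.reg ⊤) :
    IsMorphism (X := X) (Y := affine K V) p := by
  refine isMorphism_ofFractions (fun i => isOpen_univ) fun i a ha => ?_
  refine comp_mem_of_mem_adjoin p ?_ ha
  rintro _ ⟨l, rfl⟩
  exact h l

theorem polyFun_mem_reg {a : V → K} (ha : a ∈ polyFun K V) (U : Opens (affine K V)) :
    a ∈ (affine K V).reg U :=
  mem_reg_ofFractions (i := PUnit.unit) ha fun _ _ => trivial

theorem dual_mem_polyFun (l : Module.Dual K V) : (fun v => l v) ∈ polyFun K V :=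
  Algebra.subset_adjoin ⟨l, rfl⟩

end Affine

end SpaceWithFunctions

namespace SpaceWithFunctions

variable {K : Type u} [Field K] {X Y Z : SpaceWithFunctions K}

/-! ### Affine space with coordinates -/

/-- The affine space `K ^ ι`. -/
abbrev affineSpace (K : Type u) [Field K] (ι : Type) : SpaceWithFunctions K := affine K (ι → K)

section AffineSpace

open MvPolynomial

variable {ι : Type}

theorem eval_mem_subalgebra {T : Type*} {B : Subalgebra K (T → K)} {c : T → ι → K}
    (h : ∀ i, (fun x => c x i) ∈ B) (P : MvPolynomial ι K) : (fun x => eval (c x) P) ∈ B := by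
  induction P using MvPolynomial.induction_on with
  | C a => simp only [eval_C]; exact B.algebraMap_mem a
  | add P Q hP hQ => simpa using! B.add_mem hP hQ
  | mul_X P i hP => simpa using! B.mul_mem hP (h i)

theorem coord_mem_polyFun (i : ι) : (fun v : ι → K => v i) ∈ polyFun K (ι → K) :=
  dual_mem_polyFun (LinearMap.proj (R := K) (φ := fun _ : ι => K) i)

theorem dual_eq_sum [Fintype ι] [DecidableEq ι] (l : Module.Dual K (ι → K)) (v : ι → K) :
    l v = ∑ i, v i * l (Pi.single i 1) := by
  conv_lhs => rw [← Finset.univ_sum_single v, map_sum]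
  refine Finset.sum_congr rfl fun i _ => ?_
  rw [← smul_eq_mul, ← map_smul]
  congr 1
  ext j
  simp [Pi.single_apply]

theorem exists_eval_of_mem_polyFun [Finite ι] {a : (ι → K) → K} (ha : a ∈ polyFun K (ι → K)) :
    ∃ P : MvPolynomial ι K, ∀ v, a v = eval v P := by
  classical
  have := Fintype.ofFinite ι
  induction ha using Algebra.adjoin_induction with
  | mem a ha =>
    obtain ⟨l, rfl⟩ := ha
    refine ⟨∑ i, X i * C (l (Pi.single i 1)), fun v => ?_⟩
    simpa using dual_eq_sum l v
  | algebraMap r => exact ⟨C r, fun v => by simp⟩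
  | add a b _ _ ha hb =>
    obtain ⟨P, hP⟩ := ha
    obtain ⟨Q, hQ⟩ := hb
    exact ⟨P + Q, fun v => by simp [hP, hQ]⟩
  | mul a b _ _ ha hb =>
    obtain ⟨P, hP⟩ := ha
    obtain ⟨Q, hQ⟩ := hb
    exact ⟨P * Q, fun v => by simp [hP, hQ]⟩

theorem eval_mem_reg {U : Opens X} {c : X → ι → K} (h : ∀ i, (fun x => c x i) ∈ X.reg U)
    (P : MvPolynomial ι K) : (fun x => eval (c x) P) ∈ X.reg U :=
  eval_mem_subalgebra h P

theorem isOpen_eval_ne {U : Opens X} {c : X → ι → K} (h : ∀ i, (fun x => c x i) ∈ X.reg U)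
    (P : MvPolynomial ι K) : IsOpen {x | x ∈ U ∧ eval (c x) P ≠ 0} :=
  X.isOpen_ne U _ (eval_mem_reg h P)

theorem coord_mem_reg (i : ι) (U : Opens (affineSpace K ι)) :
    (fun v : ι → K => v i) ∈ (affineSpace K ι).reg U :=
  polyFun_mem_reg (coord_mem_polyFun i) U

theorem isOpen_affineSpace_eval_ne (P : MvPolynomial ι K) :
    IsOpen (X := (affineSpace K ι).carrier) {v : ι → K | eval v P ≠ 0} := by
  have := isOpen_eval_ne (X := affineSpace K ι) (U := ⊤) (c := fun v => v)
    (fun i => coord_mem_reg i ⊤) P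
  have h : {v : (affineSpace K ι).carrier | v ∈ (⊤ : Opens (affineSpace K ι)) ∧ eval v P ≠ 0} =
      {v : ι → K | eval v P ≠ 0} := by
    ext v
    exact ⟨fun h => h.2, fun h => ⟨trivial, h⟩⟩
  exact h ▸ this

theorem isMorphism_affineSpace [Finite ι] {p : X → ι → K} (h : ∀ i, (fun x => p x i) ∈ X.reg ⊤) :
    IsMorphism (X := X) (Y := affineSpace K ι) p := by
  refine isMorphism_affine fun l => ?_
  obtain ⟨P, hP⟩ := exists_eval_of_mem_polyFun (dual_mem_polyFun l)
  simp only [hP]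
  exact eval_mem_reg h P

theorem exists_eval_ne_of_isOpen [Finite ι] {O : Set (ι → K)}
    (hO : IsOpen (X := (affineSpace K ι).carrier) O) {x : ι → K} (hx : x ∈ O) :
    ∃ P : MvPolynomial ι K, eval x P ≠ 0 ∧ ∀ y, eval y P ≠ 0 → y ∈ O := by
  obtain ⟨_, a, ha, -, hax, h⟩ := exists_subset_of_isOpen_ofFractions hO hx
  obtain ⟨P, hP⟩ := exists_eval_of_mem_polyFun ha
  exact ⟨P, by rwa [← hP], fun y hy => h y trivial (by rwa [hP])⟩

theorem exists_eval_of_notMem_isClosed [Finite ι] {Z : Set (ι → K)}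
    (hZ : IsClosed (X := (affineSpace K ι).carrier) Z) {x : ι → K} (hx : x ∉ Z) :
    ∃ P : MvPolynomial ι K, eval x P ≠ 0 ∧ ∀ y ∈ Z, eval y P = 0 := by
  obtain ⟨P, h1, h2⟩ := exists_eval_ne_of_isOpen hZ.isOpen_compl hx
  exact ⟨P, h1, fun y hy => by_contra fun h => h2 y h hy⟩

/-- The basic open set of a polynomial in the prime spectrum pulls back to its nonvanishing locus.
Noetherianity and the upper bound for the dimension of affine space are thereby inherited from the
spectrum of the polynomial ring. -/
theorem isInducing_pointToPoint [Finite ι] :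
    Topology.IsInducing (X := (affineSpace K ι).carrier)
      (fun v : ι → K => (pointToPoint v : PrimeSpectrum (MvPolynomial ι K))) := by
  have key : ∀ P : MvPolynomial ι K, (fun v : ι → K =>
      (pointToPoint v : PrimeSpectrum (MvPolynomial ι K))) ⁻¹' (PrimeSpectrum.basicOpen P) = {v : ι → K | eval v P ≠ 0} := by
    intro P
    ext v
    simp [pointToPoint, aeval_eq_eval]
  have hc : Continuous (X := (affineSpace K ι).carrier)
      (fun v : ι → K => (pointToPoint v : PrimeSpectrum (MvPolynomial ι K))) := by
    refine PrimeSpectrum.isTopologicalBasis_basic_opens.continuous_iff.mpr ?_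
    rintro _ ⟨P, rfl⟩
    exact (key P) ▸ isOpen_affineSpace_eval_ne P
  refine ⟨le_antisymm hc.le_induced fun O hO => ?_⟩
  refine ⟨⋃ P ∈ {P : MvPolynomial ι K | ∀ y, eval y P ≠ 0 → y ∈ O}, PrimeSpectrum.basicOpen P,
    isOpen_biUnion fun P _ => PrimeSpectrum.isOpen_basicOpen, ?_⟩
  ext v
  refine ⟨fun h => ?_, fun h => ?_⟩
  · obtain ⟨P, hP, h⟩ := Set.mem_iUnion₂.mp h
    exact hP v ((key P).subset h)
  · obtain ⟨P, h1, h2⟩ := exists_eval_ne_of_isOpen hO h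
    exact Set.mem_iUnion₂.mpr ⟨P, h2, (key P).symm.subset h1⟩

theorem noetherianSpace_affineSpace [Finite ι] : NoetherianSpace (affineSpace K ι).carrier :=
  isInducing_pointToPoint.noetherianSpace

theorem topologicalKrullDim_affineSpace_le [Finite ι] :
    topologicalKrullDim (affineSpace K ι).carrier ≤ Nat.card ι := by
  refine isInducing_pointToPoint.topologicalKrullDim_le.trans ?_
  rw [PrimeSpectrum.topologicalKrullDim_eq_ringKrullDim, MvPolynomial.ringKrullDim_of_isNoetherianRing,
    ringKrullDim_eq_zero_of_field, zero_add]

/-- Two nonempty open sets contain the nonvanishing loci of nonzero polynomials P and Q; over an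
infinite field the nonzero polynomial PQ takes a nonzero value somewhere. -/
theorem irreducibleSpace_affineSpace [Infinite K] [Finite ι] :
    IrreducibleSpace (affineSpace K ι).carrier := by
  have : PreirreducibleSpace (affineSpace K ι).carrier := by
    refine ⟨fun U V hU hV => ?_⟩
    rintro ⟨x, -, hx⟩ ⟨y, -, hy⟩
    obtain ⟨P, hP, hPU⟩ := exists_eval_ne_of_isOpen hU hx
    obtain ⟨Q, hQ, hQV⟩ := exists_eval_ne_of_isOpen hV hy
    have hPQ : P * Q ≠ 0 := mul_ne_zero (by rintro rfl; simp at hP) (by rintro rfl; simp at hQ)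
    obtain ⟨z, hz⟩ : ∃ z, eval z (P * Q) ≠ 0 := by
      by_contra! h
      exact hPQ (MvPolynomial.funext fun z => by simpa using h z)
    rw [map_mul] at hz
    exact ⟨z, trivial, hPU z (left_ne_zero_of_mul hz), hQV z (right_ne_zero_of_mul hz)⟩
  exact ⟨⟨(0 : ι → K)⟩⟩

end AffineSpace

end SpaceWithFunctions

namespace SpaceWithFunctions

variable {K : Type u} [Field K] {X Y Z : SpaceWithFunctions K}

/-! ### Affine charts -/

/-- An isomorphism of an open subset of `X` with a closed subset of `K ^ ι`. -/
structure AffineChart (X : SpaceWithFunctions K) (ι : Type) where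
  /-- the open subset of `X` -/
  source : Opens X
  /-- the closed subset of `K ^ ι` -/
  target : Set (ι → K)
  isClosed_target : IsClosed (X := (affineSpace K ι).carrier) target
  /-- the coordinates, of which only the values on `source` matter -/
  coord : X → ι → K
  coord_mem_reg : ∀ i, (fun x => coord x i) ∈ X.reg source
  /-- the point with given coordinates -/
  point : target → X
  isMorphism_point : IsMorphism (X := (affineSpace K ι).restrict target) point
  point_mem : ∀ z, point z ∈ source
  coord_point : ∀ z, coord (point z) = z.1
  coord_mem : ∀ x ∈ source, coord x ∈ target
  point_coord : ∀ x (hx : x ∈ source), point ⟨coord x, coord_mem x hx⟩ = x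

namespace AffineChart

open MvPolynomial

variable {ι κ : Type}

theorem coord_injOn (C : AffineChart X ι) {x y : X} (hx : x ∈ C.source) (hy : y ∈ C.source)
    (h : C.coord x = C.coord y) : x = y := by
  rw [← C.point_coord x hx, ← C.point_coord y hy]
  congr 1
  exact Subtype.ext h

theorem isOpen_eval_ne (C : AffineChart X ι) (P : MvPolynomial ι K) :
    IsOpen {x | x ∈ C.source ∧ eval (C.coord x) P ≠ 0} :=
  SpaceWithFunctions.isOpen_eval_ne C.coord_mem_reg P

theorem exists_eval_ne [Finite ι] (C : AffineChart X ι) {V : Set X} (hV : IsOpen V) {x : X}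
    (hx : x ∈ C.source) (hxV : x ∈ V) :
    ∃ P : MvPolynomial ι K, eval (C.coord x) P ≠ 0 ∧
      ∀ y ∈ C.source, eval (C.coord y) P ≠ 0 → y ∈ V := by
  obtain ⟨O, hO, h⟩ := isOpen_induced_iff.mp (hV.preimage C.isMorphism_point.continuous)
  have key : ∀ y (hy : y ∈ C.source), C.coord y ∈ O ↔ y ∈ V := fun y hy => by
    have : C.coord y ∈ O ↔ C.point ⟨C.coord y, C.coord_mem y hy⟩ ∈ V :=
      Set.ext_iff.mp h ⟨C.coord y, C.coord_mem y hy⟩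
    rwa [C.point_coord y hy] at this
  obtain ⟨P, hP, hPO⟩ := exists_eval_ne_of_isOpen hO ((key x hx).mpr hxV)
  exact ⟨P, hP, fun y hy hyP => (key y hy).mp (hPO _ hyP)⟩

theorem isMorphism_coord [Finite ι] (C : AffineChart X ι) :
    IsMorphism (X := X.restrict (C.source : Set X)) (Y := affineSpace K ι)
      (fun x : (C.source : Set X) => C.coord x.1) :=
  isMorphism_affineSpace fun i => (isMorphism_val _).reg (C.coord_mem_reg i) fun x _ => x.2

/-- Since `point` is a continuous inverse of the coordinates, anything living inside the source of a
chart carries the topology induced from affine space. Dimension bounds and Noetherianity are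
transferred through this. -/
theorem isInducing_coord [Finite ι] (C : AffineChart X ι) {T : Type*} [TopologicalSpace T]
    {f : T → X} (hf : Topology.IsInducing f) (h : ∀ t, f t ∈ C.source) :
    Topology.IsInducing (Y := (affineSpace K ι).carrier) (fun t => C.coord (f t)) := by
  have hc : Continuous (Y := (affineSpace K ι).carrier) (fun t => C.coord (f t)) :=
    C.isMorphism_coord.continuous.comp (hf.continuous.subtype_mk h)
  refine ⟨le_antisymm hc.le_induced fun O hO => ?_⟩
  obtain ⟨V, hV, rfl⟩ := hf.isOpen_iff.mp hO
  obtain ⟨O, hO, h'⟩ := isOpen_induced_iff.mp (hV.preimage C.isMorphism_point.continuous)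
  refine ⟨O, hO, ?_⟩
  ext t
  have : C.coord (f t) ∈ O ↔ C.point ⟨C.coord (f t), C.coord_mem _ (h t)⟩ ∈ V :=
    Set.ext_iff.mp h' ⟨C.coord (f t), C.coord_mem _ (h t)⟩
  rwa [C.point_coord _ (h t)] at this

/-- The product of two charts. -/
noncomputable def prod [Finite ι] [Finite κ] (C : AffineChart X ι) (D : AffineChart Y κ) :
    AffineChart (X.prod Y) (ι ⊕ κ) where
  source := ⟨{w : X.carrier × Y.carrier | w.1 ∈ C.source ∧ w.2 ∈ D.source},
    (C.source.isOpen.preimage isMorphism_fst.continuous).inter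
      (D.source.isOpen.preimage isMorphism_snd.continuous)⟩
  target := {z | (fun i => z (Sum.inl i)) ∈ C.target ∧ (fun i => z (Sum.inr i)) ∈ D.target}
  isClosed_target :=
    (C.isClosed_target.preimage (isMorphism_affineSpace (X := affineSpace K (ι ⊕ κ))
      (p := fun (z : ι ⊕ κ → K) i => z (Sum.inl i))
      fun i => SpaceWithFunctions.coord_mem_reg (Sum.inl i) ⊤).continuous).inter
    (D.isClosed_target.preimage (isMorphism_affineSpace (X := affineSpace K (ι ⊕ κ))
      (p := fun (z : ι ⊕ κ → K) i => z (Sum.inr i))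
      fun i => SpaceWithFunctions.coord_mem_reg (Sum.inr i) ⊤).continuous)
  coord := fun w => Sum.elim (C.coord w.1) (D.coord w.2)
  coord_mem_reg := by
    rintro (i | i)
    · exact isMorphism_fst.reg (C.coord_mem_reg i) fun w hw => hw.1
    · exact isMorphism_snd.reg (D.coord_mem_reg i) fun w hw => hw.2
  point := fun z => (C.point ⟨_, z.2.1⟩, D.point ⟨_, z.2.2⟩)
  isMorphism_point := by
    refine IsMorphism.prodMk
      (C.isMorphism_point.comp (IsMorphism.codRestrict (Z := (affineSpace K (ι ⊕ κ)).restrict _)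
        (X := affineSpace K ι) (isMorphism_affineSpace fun i => ?_) fun w => w.2.1))
      (D.isMorphism_point.comp (IsMorphism.codRestrict (Z := (affineSpace K (ι ⊕ κ)).restrict _)
        (X := affineSpace K κ) (isMorphism_affineSpace fun i => ?_) fun w => w.2.2))
    · exact (isMorphism_val _).reg (SpaceWithFunctions.coord_mem_reg (Sum.inl i) ⊤)
        fun _ _ => trivial
    · exact (isMorphism_val _).reg (SpaceWithFunctions.coord_mem_reg (Sum.inr i) ⊤)
        fun _ _ => trivial
  point_mem := fun _ => ⟨C.point_mem _, D.point_mem _⟩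
  coord_point := fun z => by
    simp only [C.coord_point, D.coord_point]
    ext (i | i) <;> rfl
  coord_mem := fun w hw => ⟨C.coord_mem _ hw.1, D.coord_mem _ hw.2⟩
  point_coord := fun w hw => Prod.ext (C.point_coord _ hw.1) (D.point_coord _ hw.2)

/-- The chart of a closed subset given by a chart of the ambient space. -/
def restrict (C : AffineChart X ι) {S : Set X} (hS : IsClosed S) :
    AffineChart (X.restrict S) ι where
  source := ⟨{x : S | x.1 ∈ C.source}, C.source.isOpen.preimage continuous_subtype_val⟩
  target := {z | ∃ h : z ∈ C.target, C.point ⟨z, h⟩ ∈ S}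
  isClosed_target := by
    have h1 := C.isClosed_target.isClosedEmbedding_subtypeVal.isClosedMap _
      (hS.preimage C.isMorphism_point.continuous)
    refine Eq.mp (congrArg (IsClosed (X := (affineSpace K ι).carrier)) ?_) h1
    ext z
    symm
    exact ⟨fun ⟨h, h'⟩ => ⟨⟨z, h⟩, h', rfl⟩, fun ⟨z', h', h⟩ => h ▸ ⟨z'.2, h'⟩⟩
  coord := fun x => C.coord x.1
  coord_mem_reg := fun i => (isMorphism_val S).reg (C.coord_mem_reg i) fun x hx => hx
  point := fun z => ⟨C.point ⟨z.1, z.2.1⟩, z.2.2⟩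
  isMorphism_point := (C.isMorphism_point.comp (IsMorphism.codRestrict
    (Z := (affineSpace K ι).restrict {z | ∃ h : z ∈ C.target, C.point ⟨z, h⟩ ∈ S})
    (X := affineSpace K ι) (isMorphism_val _) fun z => z.2.1)).codRestrict _
  point_mem := fun z => C.point_mem _
  coord_point := fun z => C.coord_point _
  coord_mem := fun x hx => ⟨C.coord_mem _ hx, by rw [C.point_coord _ hx]; exact x.2⟩
  point_coord := fun x hx => Subtype.ext (C.point_coord _ hx)

/-- A chart with target the whole affine space. -/
def ofMorphism (U : Opens X) (c : X → ι → K) (hc : ∀ i, (fun x => c x i) ∈ X.reg U)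
    (s : (ι → K) → X) (hs : IsMorphism (X := affineSpace K ι) s) (hsU : ∀ z, s z ∈ U)
    (hcs : ∀ z, c (s z) = z) (hsc : ∀ x ∈ U, s (c x) = x) : AffineChart X ι where
  source := U
  target := Set.univ
  isClosed_target := isClosed_univ
  coord := c
  coord_mem_reg := hc
  point := fun z => s z.1
  isMorphism_point := hs.comp (isMorphism_val _)
  point_mem := fun _ => hsU _
  coord_point := fun _ => hcs _
  coord_mem := fun _ _ => trivial
  point_coord := hsc

/-- The chart with renamed coordinates. -/
def reindex [Finite κ] (C : AffineChart X ι) (e : ι ≃ κ) : AffineChart X κ where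
  source := C.source
  target := {z | (fun i => z (e i)) ∈ C.target}
  isClosed_target := by
    have := Finite.of_equiv κ e.symm
    exact C.isClosed_target.preimage (isMorphism_affineSpace (X := affineSpace K κ)
      (p := fun (z : κ → K) i => z (e i))
      fun i => SpaceWithFunctions.coord_mem_reg (e i) ⊤).continuous
  coord := fun x i => C.coord x (e.symm i)
  coord_mem_reg := fun i => C.coord_mem_reg _
  point := fun z => C.point ⟨_, z.2⟩
  isMorphism_point := by
    have := Finite.of_equiv κ e.symm
    refine C.isMorphism_point.comp (IsMorphism.codRestrict (Z := (affineSpace K κ).restrict _)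
        (X := affineSpace K ι) (isMorphism_affineSpace fun i => ?_) fun z => z.2)
    exact (isMorphism_val _).reg (SpaceWithFunctions.coord_mem_reg (e i) ⊤)
        fun _ _ => trivial
  point_mem := fun z => C.point_mem _
  coord_point := fun z => by simp [C.coord_point]
  coord_mem := fun x hx => by simpa using C.coord_mem x hx
  point_coord := fun x hx => by simpa using C.point_coord x hx

theorem isAffine [Finite ι] (C : AffineChart X ι) : IsAffine (X.restrict (C.source : Set X)) := by
  obtain ⟨N, ⟨e⟩⟩ := Finite.exists_equiv_fin ι
  let D := C.reindex e
  refine ⟨N, D.target, D.isClosed_target, fun x => ⟨D.coord x.1, D.coord_mem _ x.2⟩,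
    D.isMorphism_coord.codRestrict _, fun z => ⟨D.point z, D.point_mem z⟩,
    D.isMorphism_point.codRestrict _, fun x => Subtype.ext (D.point_coord x.1 x.2),
    fun z => Subtype.ext (D.coord_point z)⟩

end AffineChart

/-- Translates the affine open sets in the definition of a variety into the charts used in the proof
of properness. -/
theorem IsAffine.exists_chart {U : Opens X} (h : IsAffine (X.restrict (U : Set X))) :
    ∃ (N : ℕ) (C : AffineChart X (Fin N)), C.source = U := by
  classical
  obtain ⟨N, T, hT, p, hp, q, hq, hqp, hpq⟩ := h
  have hext : ∀ x (hx : x ∈ U), (if h : x ∈ U then (p ⟨x, h⟩).1 else 0 : Fin N → K) =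
      (p ⟨x, hx⟩).1 := fun x hx => dif_pos hx
  refine ⟨N,
    { source := U
      target := T
      isClosed_target := hT
      coord := fun x => if h : x ∈ U then (p ⟨x, h⟩).1 else 0
      coord_mem_reg := ?_
      point := fun z => (q z).1
      isMorphism_point := (isMorphism_val _).comp hq
      point_mem := fun z => (q z).2
      coord_point := fun z => by
        rw [hext _ (q z).2]
        exact congrArg Subtype.val (hpq z)
      coord_mem := fun x hx => by
        rw [hext x hx]
        exact (p ⟨x, hx⟩).2
      point_coord := fun x hx => by
        have := congrArg Subtype.val (hqp ⟨x, hx⟩)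
        simpa only [hext x hx] using! this }, rfl⟩
  intro i
  have h1 : (fun x => (p x).1 i) ∈ (X.restrict (U : Set X)).reg ⊤ :=
    ((isMorphism_val T).comp hp).reg (coord_mem_reg i ⊤) fun _ _ => trivial
  have h2 : (fun x => (if h : x ∈ U then (p ⟨x, h⟩).1 else 0 : Fin N → K) i) ∈
      X.reg (openImage U ⊤) := by
    refine mem_reg_openImage (reg_congr h1 fun x _ => ?_)
    simp only [hext x.1 x.2]
    rfl
  exact X.reg_mono (V := U) (U := openImage U ⊤) (fun x hx => ⟨⟨x, hx⟩, trivial, rfl⟩) h2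

theorem IsVariety.of_charts (hirr : IrreducibleSpace X) (hsep : IsSeparated X) {A : Type*}
    [Finite A] {ι : A → Type} [∀ a, Finite (ι a)] (C : ∀ a, AffineChart X (ι a))
    (hcover : ∀ x, ∃ a, x ∈ (C a).source) : IsVariety X := by
  refine ⟨hirr, hsep, ?_⟩
  obtain ⟨r, ⟨e⟩⟩ := Finite.exists_equiv_fin A
  refine ⟨r, fun i => (C (e.symm i)).source, fun x => ?_, fun i => (C _).isAffine⟩
  obtain ⟨a, ha⟩ := hcover x
  exact ⟨e a, by show x ∈ (C (e.symm (e a))).source; rwa [e.symm_apply_apply]⟩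

/-! ### Separatedness -/

/-- A function regular near (x, y), nonzero there and zero on the diagonal has a nonvanishing locus
that is a neighbourhood of (x, y) missing the diagonal. -/
theorem isSeparated_of_reg (h : ∀ x y : X, x ≠ y → ∃ (O : Opens (X.prod X)) (f : (X.prod X).carrier → K),
    (x, y) ∈ O ∧ f ∈ (X.prod X).reg O ∧ f (x, y) ≠ 0 ∧ ∀ z : X, (z, z) ∈ O → f (z, z) = 0) :
    IsSeparated X := by
  refine ⟨isOpen_iff_forall_mem_open.mpr ?_⟩
  rintro ⟨x, y⟩ hxy
  obtain ⟨O, f, hO, hf, hne, h0⟩ := h x y hxy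
  refine ⟨_, ?_, (X.prod X).isOpen_ne O f hf, hO, hne⟩
  rintro ⟨z, w⟩ ⟨hz, hzw⟩ (rfl : z = w)
  exact hzw (h0 z hz)

/-- The complement of the diagonal of `Y` pulls back along `p × p` to an open set missing the
diagonal of `X`, so morphisms to separated spaces that separate points suffice. -/
theorem isSeparated_of_morphisms (h : ∀ x y : X, x ≠ y → ∃ (Y : SpaceWithFunctions K) (p : X → Y),
    IsSeparated Y ∧ IsMorphism p ∧ p x ≠ p y) : IsSeparated X := by
  refine ⟨isOpen_iff_forall_mem_open.mpr ?_⟩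
  rintro ⟨x, y⟩ hxy
  obtain ⟨Y, p, hY, hp, hne⟩ := h x y hxy
  refine ⟨_, ?_, hY.isOpen_compl.preimage (hp.prodMap hp).continuous, hne⟩
  rintro ⟨z, w⟩ hzw (rfl : z = w)
  exact hzw rfl

end SpaceWithFunctions

/-! ### Linear algebra of frames -/

namespace Matrix

variable {K : Type*} [Field K] {k : ℕ} {ι : Type*}

/-- Row rank equals column rank, so k independent columns can be selected. -/
theorem exists_det_submatrix_ne_zero [Fintype ι] {A : Matrix (Fin k) ι K}
    (hA : LinearIndependent K A.row) : ∃ e : Fin k → ι, (A.submatrix id e).det ≠ 0 := by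
  have hr : Module.finrank K (Submodule.span K (Set.range A.col)) = k := by
    rw [← Matrix.rank_eq_finrank_span_cols, hA.rank_matrix, Fintype.card_fin]
  have hf := Submodule.exists_fun_fin_finrank_span_eq K (Set.range A.col)
  rw [hr] at hf
  obtain ⟨f, hf, -, hli⟩ := hf
  choose e he using hf
  refine ⟨e, ?_⟩
  have : (A.submatrix id e).col = f := by
    ext i j
    rw [← he]
    rfl
  rw [← this, linearIndependent_cols_iff_isUnit, isUnit_iff_isUnit_det] at hli
  exact hli.ne_zero

theorem linearIndependent_row_of_det_submatrix_ne_zero {A : Matrix (Fin k) ι K} {e : Fin k → ι}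
    (h : (A.submatrix id e).det ≠ 0) : LinearIndependent K A.row := by
  have h1 : LinearIndependent K (A.submatrix id e).row :=
    linearIndependent_rows_iff_isUnit.mpr ((isUnit_iff_isUnit_det _).mpr h.isUnit)
  exact LinearIndependent.of_comp (LinearMap.funLeft K K e) h1

theorem injective_of_det_submatrix_ne_zero {A : Matrix (Fin k) ι K} {e : Fin k → ι}
    (h : (A.submatrix id e).det ≠ 0) : Function.Injective e := by
  intro i j hij
  by_contra hne
  exact h (det_zero_of_column_eq hne fun l => by simp [hij])

theorem exists_mul_eq_of_span_le {l : ℕ} {A : Matrix (Fin k) ι K} {B : Matrix (Fin l) ι K}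
    (h : Submodule.span K (Set.range B.row) ≤ Submodule.span K (Set.range A.row)) :
    ∃ g : Matrix (Fin l) (Fin k) K, B = g * A := by
  have : ∀ i, ∃ c : Fin k → K, ∑ j, c j • A.row j = B.row i := fun i =>
    (Submodule.mem_span_range_iff_exists_fun K).mp (h (Submodule.subset_span ⟨i, rfl⟩))
  choose g hg using this
  refine ⟨of g, ?_⟩
  ext i j
  have := congrFun (hg i) j
  simpa [mul_apply] using! this.symm

/-- The matrix obtained from `A` by the row operations that make the columns `e` an identity
matrix. -/
noncomputable def normalizeCols (e : Fin k → ι) (A : Matrix (Fin k) ι K) : Matrix (Fin k) ι K :=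
  (A.submatrix id e)⁻¹ * A

theorem submatrix_mul_left [Fintype ι] {l : ℕ} (g : Matrix (Fin l) (Fin k) K)
    (A : Matrix (Fin k) ι K) (e : Fin l → ι) :
    (g * A).submatrix id e = g * A.submatrix id e := by
  ext i j
  simp [mul_apply]

/-- The normalized matrix is invariant under the left action of GL_k, so it depends only on the row
space; its entries are the coordinates on the Grassmannian. -/
theorem normalizeCols_mul [Fintype ι] {g : Matrix (Fin k) (Fin k) K} (hg : IsUnit g.det)
    (A : Matrix (Fin k) ι K) (e : Fin k → ι) : normalizeCols e (g * A) = normalizeCols e A := by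
  rw [normalizeCols, submatrix_mul_left, mul_inv_rev, Matrix.mul_assoc, ← Matrix.mul_assoc g⁻¹,
    nonsing_inv_mul _ hg, Matrix.one_mul, normalizeCols]

theorem normalizeCols_submatrix [Fintype ι] {A : Matrix (Fin k) ι K} {e : Fin k → ι}
    (h : (A.submatrix id e).det ≠ 0) : (normalizeCols e A).submatrix id e = 1 := by
  rw [normalizeCols, submatrix_mul_left, nonsing_inv_mul _ h.isUnit]

theorem normalizeCols_of_eq_one {A : Matrix (Fin k) ι K} {e : Fin k → ι}
    (h : A.submatrix id e = 1) : normalizeCols e A = A := by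
  rw [normalizeCols, h, inv_one, Matrix.one_mul]

theorem span_row_mul [Fintype ι] {g : Matrix (Fin k) (Fin k) K} (hg : IsUnit g.det)
    (A : Matrix (Fin k) ι K) :
    Submodule.span K (Set.range (g * A).row) = Submodule.span K (Set.range A.row) := by
  have key : ∀ (g : Matrix (Fin k) (Fin k) K) (A : Matrix (Fin k) ι K),
      Submodule.span K (Set.range (g * A).row) ≤ Submodule.span K (Set.range A.row) := by
    intro g A
    refine Submodule.span_le.mpr ?_
    rintro _ ⟨i, rfl⟩
    refine (Submodule.mem_span_range_iff_exists_fun K).mpr ⟨g i, ?_⟩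
    ext j
    simp [mul_apply]
  refine le_antisymm (key g A) ?_
  have := key g⁻¹ (g * A)
  rwa [← Matrix.mul_assoc, nonsing_inv_mul _ hg, Matrix.one_mul] at this

/-- Write B = gA and A = g'B. Then gg'B = B, and independence of the rows of B forces gg' = 1. Hence
two bases of the same subspace differ by an element of GL_k. -/
theorem exists_isUnit_mul_eq_of_span_eq {A B : Matrix (Fin k) ι K}
    (hB : LinearIndependent K B.row)
    (h : Submodule.span K (Set.range A.row) = Submodule.span K (Set.range B.row)) :
    ∃ g : Matrix (Fin k) (Fin k) K, IsUnit g.det ∧ B = g * A := by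
  obtain ⟨g, hg⟩ := exists_mul_eq_of_span_le h.ge
  obtain ⟨g', hg'⟩ := exists_mul_eq_of_span_le h.le
  refine ⟨g, ?_, hg⟩
  have h1 : (g * g') * B = (1 : Matrix (Fin k) (Fin k) K) * B := by rw [Matrix.mul_assoc, ← hg', ← hg, Matrix.one_mul]
  have h2 : g * g' = 1 := by
    ext i j
    have h3 := congrFun (congrFun h1 i)
    have h4 : ∑ l, (g * g') i l • B.row l = ∑ l, (1 : Matrix (Fin k) (Fin k) K) i l • B.row l := by
      ext j
      simpa [mul_apply, Finset.sum_apply] using! h3 j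
    have h5 : ∑ l, ((g * g') i l - (1 : Matrix (Fin k) (Fin k) K) i l) • B.row l = 0 := by
      simp only [sub_smul, Finset.sum_sub_distrib, h4, sub_self]
    exact sub_eq_zero.mp (Fintype.linearIndependent_iff.mp hB _ h5 j)
  exact (isUnit_iff_isUnit_det g).mp (IsUnit.of_mul_eq_one _ h2)

end Matrix

namespace SpaceWithFunctions

variable {K : Type u} [Field K] {X Y Z : SpaceWithFunctions K}

/-! ### Regular families of matrices -/

section RegularMatrices

variable {T : Type*} {B : Subalgebra K (T → K)} {a b c : Type*}

theorem sum_mem_subalgebra {s : Finset a} {f : a → T → K} (h : ∀ i ∈ s, f i ∈ B) :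
    (fun x => ∑ i ∈ s, f i x) ∈ B := by
  rw [← Finset.sum_fn]
  exact B.sum_mem h

theorem prod_mem_subalgebra {s : Finset a} {f : a → T → K} (h : ∀ i ∈ s, f i ∈ B) :
    (fun x => ∏ i ∈ s, f i x) ∈ B := by
  rw [← Finset.prod_fn]
  exact B.prod_mem h

theorem matrix_mul_mem [Fintype b] {M : T → Matrix a b K} {N : T → Matrix b c K}
    (hM : ∀ i j, (fun x => M x i j) ∈ B) (hN : ∀ i j, (fun x => N x i j) ∈ B) (i : a) (j : c) :
    (fun x => (M x * N x) i j) ∈ B := by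
  simp only [Matrix.mul_apply]
  exact sum_mem_subalgebra fun l _ => B.mul_mem (hM i l) (hN l j)

theorem det_mem [Fintype a] [DecidableEq a] {M : T → Matrix a a K}
    (hM : ∀ i j, (fun x => M x i j) ∈ B) : (fun x => (M x).det) ∈ B := by
  simp only [Matrix.det_apply']
  exact sum_mem_subalgebra fun σ _ => B.mul_mem (B.algebraMap_mem _)
    (prod_mem_subalgebra fun l _ => hM _ _)

theorem adjugate_mem [Fintype a] [DecidableEq a] {M : T → Matrix a a K}
    (hM : ∀ i j, (fun x => M x i j) ∈ B) (i j : a) : (fun x => (M x).adjugate i j) ∈ B := by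
  simp only [Matrix.adjugate_apply]
  refine det_mem fun i' j' => ?_
  simp only [Matrix.updateRow_apply]
  split_ifs
  · exact B.algebraMap_mem _
  · exact hM _ _

/-- Cramer's rule: the inverse is the adjugate divided by the determinant. -/
theorem matrix_inv_mem {U : Opens X} [Fintype a] [DecidableEq a] {M : X → Matrix a a K}
    (hM : ∀ i j, (fun x => M x i j) ∈ X.reg U) (h : ∀ x ∈ U, (M x).det ≠ 0) (i j : a) :
    (fun x => (M x)⁻¹ i j) ∈ X.reg U := by
  refine reg_congr (div_mem_reg (adjugate_mem hM i j) (det_mem hM) h) fun x _ => ?_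
  simp [Matrix.inv_def, Ring.inverse_eq_inv, div_eq_inv_mul]

theorem normalizeCols_mem {U : Opens X} {k : ℕ} {M : X → Matrix (Fin k) a K} {e : Fin k → a}
    (hM : ∀ i j, (fun x => M x i j) ∈ X.reg U) (h : ∀ x ∈ U, ((M x).submatrix id e).det ≠ 0)
    (i : Fin k) (j : a) : (fun x => (M x).normalizeCols e i j) ∈ X.reg U :=
  matrix_mul_mem (matrix_inv_mem (fun i j => hM i (e j)) h) hM i j

end RegularMatrices

section AffineMatrix

variable {a b : Type}

theorem entry_mem_reg (i : a) (j : b) (U : Opens (affine K (a → b → K))) :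
    (fun A : a → b → K => A i j) ∈ (affine K (a → b → K)).reg U :=
  polyFun_mem_reg (dual_mem_polyFun ((LinearMap.proj (R := K) (φ := fun _ : b => K) j).comp
    (LinearMap.proj (R := K) (φ := fun _ : a => b → K) i))) U

theorem isMorphism_matrix [Finite a] [Finite b] {p : X → a → b → K}
    (h : ∀ i j, (fun x => p x i j) ∈ X.reg ⊤) :
    IsMorphism (X := X) (Y := affine K (a → b → K)) p := by
  refine isMorphism_affine fun l => ?_
  obtain ⟨P, hP⟩ := exists_eval_of_mem_polyFun
    (dual_mem_polyFun (l.comp (LinearEquiv.curry K K a b).toLinearMap))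
  refine reg_congr (eval_mem_reg (c := fun x (w : a × b) => p x w.1 w.2)
    (fun w => h w.1 w.2) P) fun x _ => ?_
  rw [← hP, LinearMap.comp_apply]
  rfl

end AffineMatrix

end SpaceWithFunctions

namespace Determinantal

open SpaceWithFunctions

variable {K : Type u} [Field K] {X : SpaceWithFunctions K} {m n k : ℕ}

/-! ### Charts of projective space -/

/-- The projective space of `m × n` matrices. -/
abbrev projMatrix (K : Type u) [Field K] (m n : ℕ) : SpaceWithFunctions K :=
  projSpace K (Matrix (Fin m) (Fin n) K)

/-- The matrix in the class `φ` whose entry `a` is `1`, if that entry is not zero. -/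
noncomputable def normalizedRep (a : Fin m × Fin n)
    (φ : Projectivization K (Matrix (Fin m) (Fin n) K)) : Matrix (Fin m) (Fin n) K :=
  (φ.rep a.1 a.2)⁻¹ • φ.rep

/-- The scalar relating `M` to the chosen representative cancels, so the coordinates do not depend
on that choice. -/
theorem normalizedRep_mk (a : Fin m × Fin n) (M : Matrix (Fin m) (Fin n) K) (hM : M ≠ 0) :
    normalizedRep a (Projectivization.mk K M hM) = (M a.1 a.2)⁻¹ • M := by
  obtain ⟨c, hc⟩ := Projectivization.exists_smul_eq_mk_rep K M hM
  rw [normalizedRep, ← hc]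
  have hc0 : (c : K) ≠ 0 := c.ne_zero
  ext i j
  simp only [Matrix.smul_apply, Units.smul_def, smul_eq_mul]
  rw [mul_inv, mul_mul_mul_comm, inv_mul_cancel₀ hc0, one_mul]

theorem isMorphism_mk : IsMorphism
    (X := (affine K (Matrix (Fin m) (Fin n) K)).restrict
      (nonzeroVectors (Matrix (Fin m) (Fin n) K))) (Y := projMatrix K m n)
    (fun v : {v : Matrix (Fin m) (Fin n) K // v ≠ 0} => Projectivization.mk' K v) :=
  isMorphism_coinduced _

theorem isMorphism_projMatrix {p : X → Matrix (Fin m) (Fin n) K} (hp : ∀ x, p x ≠ 0)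
    (h : ∀ i j, (fun x => p x i j) ∈ X.reg ⊤) :
    IsMorphism (X := X) (Y := projMatrix K m n) (fun x => Projectivization.mk K (p x) (hp x)) :=
  isMorphism_mk.comp ((isMorphism_matrix h).codRestrict hp)

theorem rep_apply_ne_zero_iff (a : Fin m × Fin n) (M : Matrix (Fin m) (Fin n) K) (hM : M ≠ 0) :
    (Projectivization.mk K M hM).rep a.1 a.2 ≠ 0 ↔ M a.1 a.2 ≠ 0 := by
  obtain ⟨c, hc⟩ := Projectivization.exists_smul_eq_mk_rep K M hM
  rw [← hc]
  simp [Units.smul_def]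

/-- The chart of projective space on which the entry `a` does not vanish. -/
noncomputable def projChart (K : Type u) [Field K] {m n : ℕ} (a : Fin m × Fin n) :
    AffineChart (projMatrix K m n) (Fin m × Fin n) where
  source := ⟨{φ | φ.rep a.1 a.2 ≠ 0}, by
    refine isOpen_coinduced.mpr ?_
    have h := (isMorphism_val (nonzeroVectors (Matrix (Fin m) (Fin n) K))).reg
      (entry_mem_reg (K := K) a.1 a.2 ⊤) (W := ⊤) fun _ _ => trivial
    refine Eq.mp (congrArg _ (Set.ext fun v => ?_)) (isOpen_ne _ _ _ h)
    refine ⟨fun hv => (rep_apply_ne_zero_iff a v.1 v.2).mpr hv.2, fun hv => ⟨trivial, ?_⟩⟩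
    exact (rep_apply_ne_zero_iff a v.1 v.2).mp hv⟩
  -- All entries are kept as coordinates, including the one normalized to 1, so the target is a
  -- hyperplane and not the whole space.
  target := {z | z a = 1}
  isClosed_target := by
    have := isClosed_setOf_eq (X := affineSpace K (Fin m × Fin n)) (J := Unit)
      (f := fun _ z => z a) (g := fun _ _ => 1) (fun _ => SpaceWithFunctions.coord_mem_reg a ⊤)
      fun _ => const_mem_reg _ 1
    exact (Set.ext fun z => ⟨fun h => h (), fun h _ => h⟩ : {z : Fin m × Fin n → K |
      Unit → z a = 1} = {z | z a = 1}) ▸ this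
  coord := fun φ i => normalizedRep a φ i.1 i.2
  -- By the definition of the quotient structure, regularity is tested on nonzero matrices, where
  -- the coordinate is the quotient of the entries `i` and `a`.
  coord_mem_reg := fun i => by
    have h : ∀ (b : Fin m × Fin n) U, (fun v : {v : Matrix (Fin m) (Fin n) K // v ≠ 0} => v.1 b.1 b.2) ∈
        ((affine K (Matrix (Fin m) (Fin n) K)).restrict
          (nonzeroVectors (Matrix (Fin m) (Fin n) K))).reg U := fun b U => (isMorphism_val _).reg
      (entry_mem_reg (K := K) b.1 b.2 ⊤) fun _ _ => trivial
    refine reg_congr (X := (affine K (Matrix (Fin m) (Fin n) K)).restrict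
          (nonzeroVectors (Matrix (Fin m) (Fin n) K))) (div_mem_reg (h i _) (h a _) fun v hv => ?_) fun v _ => ?_
    · exact (rep_apply_ne_zero_iff a v.1 v.2).mp hv
    · refine (congrFun (congrFun (normalizedRep_mk a v.1 v.2) i.1) i.2).trans ?_
      exact (div_eq_inv_mul _ _).symm
  point := fun z => Projectivization.mk K (Matrix.of fun i j => z.1 (i, j)) fun h =>
    one_ne_zero (z.2.symm.trans (congrFun (congrFun h a.1) a.2))
  isMorphism_point := isMorphism_projMatrix _ fun i j =>
    (isMorphism_val _).reg (coord_mem_reg (i, j) ⊤) fun _ _ => trivial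
  point_mem := fun z => (rep_apply_ne_zero_iff a _ _).mpr (by
    have : z.1 a = 1 := z.2
    simp [this])
  coord_point := fun z => by
    have : z.1 a = 1 := z.2
    ext i
    simp [normalizedRep_mk, this]
  coord_mem := fun φ hφ => inv_mul_cancel₀ hφ
  point_coord := fun φ hφ => by
    refine Eq.trans ?_ (Projectivization.mk_rep φ)
    exact (Projectivization.mk_eq_mk_iff' K _ _ _ _).mpr ⟨(Projectivization.rep φ a.1 a.2)⁻¹, rfl⟩

theorem exists_mem_projChart (φ : Projectivization K (Matrix (Fin m) (Fin n) K)) :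
    ∃ a, φ ∈ (projChart K a).source := by
  by_contra! h
  refine φ.rep_nonzero ?_
  ext i j
  by_contra hne
  exact h (i, j) hne

/-! ### Charts of Grassmannians -/

/-- A matrix whose rows are a basis of `Λ`. -/
noncomputable def frameOf (Λ : {L : Submodule K (Fin n → K) // Module.finrank K L = k}) :
    Matrix (Fin k) (Fin n) K :=
  fun i => ((Module.finBasisOfFinrankEq K Λ.1 Λ.2 i : Λ.1) : Fin n → K)

theorem linearIndependent_frameOf (Λ : {L : Submodule K (Fin n → K) // Module.finrank K L = k}) :
    LinearIndependent K (frameOf Λ) :=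
  (Module.finBasisOfFinrankEq K Λ.1 Λ.2).linearIndependent.map' Λ.1.subtype (by simp)

theorem span_frameOf (Λ : {L : Submodule K (Fin n → K) // Module.finrank K L = k}) :
    Submodule.span K (Set.range (frameOf Λ)) = Λ.1 := by
  have : Set.range (frameOf Λ) = Λ.1.subtype '' Set.range (Module.finBasisOfFinrankEq K Λ.1 Λ.2) := by
    rw [← Set.range_comp]
    rfl
  rw [this, Submodule.span_image, Module.Basis.span_eq, Submodule.map_top, Submodule.range_subtype]

theorem spanOfFrame_frameOf (Λ : {L : Submodule K (Fin n → K) // Module.finrank K L = k}) :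
    spanOfFrame K k n ⟨frameOf Λ, linearIndependent_frameOf Λ⟩ = Λ :=
  Subtype.ext (span_frameOf Λ)

theorem frames_entry_mem_reg (i : Fin k) (j : Fin n) (U : Opens (frames K k n)) :
    (fun A : {A : Fin k → Fin n → K // LinearIndependent K A} => A.1 i j) ∈ (frames K k n).reg U :=
  IsMorphism.reg (X := frames K k n) (isMorphism_val (X := affine K (Fin k → Fin n → K)) _)
    (entry_mem_reg (K := K) i j ⊤) fun _ _ => trivial

theorem isMorphism_spanOfFrame :
    IsMorphism (X := frames K k n) (Y := grassmannian K k n) (spanOfFrame K k n) :=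
  isMorphism_coinduced _

theorem isMorphism_grassmannian {p : X → Matrix (Fin k) (Fin n) K}
    (hp : ∀ x, LinearIndependent K (p x).row) (h : ∀ i j, (fun x => p x i j) ∈ X.reg ⊤) :
    IsMorphism (X := X) (Y := grassmannian K k n) (fun x => spanOfFrame K k n ⟨p x, hp x⟩) :=
  isMorphism_spanOfFrame.comp ((isMorphism_matrix h).codRestrict hp)

theorem exists_frameOf_spanOfFrame_eq (A : {A : Fin k → Fin n → K // LinearIndependent K A}) :
    ∃ g : Matrix (Fin k) (Fin k) K, IsUnit g.det ∧
      frameOf (spanOfFrame K k n A) = g * (Matrix.of A.1) :=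
  Matrix.exists_isUnit_mul_eq_of_span_eq (linearIndependent_frameOf (spanOfFrame K k n A))
    (span_frameOf (spanOfFrame K k n A)).symm

/-- A change of basis of Λ multiplies each maximal minor by the same unit, so the arbitrary choice
made in `frameOf` does not matter. -/
theorem det_frameOf_spanOfFrame_ne_zero_iff (e : Fin k → Fin n)
    (A : {A : Fin k → Fin n → K // LinearIndependent K A}) :
    ((frameOf (spanOfFrame K k n A)).submatrix id e).det ≠ 0 ↔
      (Matrix.submatrix (Matrix.of A.1) id e).det ≠ 0 := by
  obtain ⟨g, hg, h⟩ := exists_frameOf_spanOfFrame_eq A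
  rw [h, Matrix.submatrix_mul_left, Matrix.det_mul]
  simp [hg.ne_zero]

theorem normalizeCols_frameOf_spanOfFrame (e : Fin k → Fin n)
    (A : {A : Fin k → Fin n → K // LinearIndependent K A}) :
    (frameOf (spanOfFrame K k n A)).normalizeCols e =
      Matrix.normalizeCols e (Matrix.of A.1) := by
  obtain ⟨g, hg, h⟩ := exists_frameOf_spanOfFrame_eq A
  rw [h, Matrix.normalizeCols_mul hg]

/-- The chart of the Grassmannian of subspaces with a basis whose columns `e` form an identity
matrix. -/
noncomputable def grassChart (K : Type u) [Field K] {k n : ℕ} (e : Fin k → Fin n) :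
    AffineChart (grassmannian K k n) (Fin k × Fin n) where
  source := ⟨{Λ | ((frameOf Λ).submatrix id e).det ≠ 0}, by
    refine isOpen_coinduced.mpr ?_
    have h := det_mem (B := (frames K k n).reg ⊤)
      (M := fun A : {A : Fin k → Fin n → K // LinearIndependent K A} => Matrix.submatrix (Matrix.of A.1) id e) fun i j =>
      frames_entry_mem_reg i (e j) ⊤
    refine Eq.mp (congrArg _ (Set.ext fun v => ?_)) (isOpen_ne _ _ _ h)
    refine ⟨fun hv => (det_frameOf_spanOfFrame_ne_zero_iff e v).mpr hv.2, fun hv => ⟨trivial, ?_⟩⟩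
    exact (det_frameOf_spanOfFrame_ne_zero_iff e v).mp hv⟩
  -- Here too the normalized columns stay among the coordinates; a chart onto a full affine space is
  -- built only for the incidence variety.
  target := {z | ∀ i j, z (i, e j) = (1 : Matrix (Fin k) (Fin k) K) i j}
  isClosed_target := by
    have := isClosed_setOf_eq (X := affineSpace K (Fin k × Fin n)) (J := Fin k × Fin k)
      (f := fun w z => z (w.1, e w.2)) (g := fun w _ => (1 : Matrix (Fin k) (Fin k) K) w.1 w.2)
      (fun w => SpaceWithFunctions.coord_mem_reg (w.1, e w.2) ⊤) fun w => const_mem_reg _ _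
    exact (Set.ext fun z => ⟨fun h i j => h (i, j), fun h w => h w.1 w.2⟩ :
      {z : Fin k × Fin n → K | ∀ w : Fin k × Fin k, z (w.1, e w.2) =
        (1 : Matrix (Fin k) (Fin k) K) w.1 w.2} =
      {z | ∀ i j, z (i, e j) = (1 : Matrix (Fin k) (Fin k) K) i j}) ▸ this
  coord := fun Λ i => (frameOf Λ).normalizeCols e i.1 i.2
  coord_mem_reg := fun i => by
    refine reg_congr (X := frames K k n) (normalizeCols_mem
      (M := fun A : {A : Fin k → Fin n → K // LinearIndependent K A} => Matrix.of A.1) (e := e) (fun i j => frames_entry_mem_reg i j _) (fun v hv => ?_) i.1 i.2) fun v hv => ?_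
    · exact (det_frameOf_spanOfFrame_ne_zero_iff e v).mp hv
    · exact congrFun (congrFun (normalizeCols_frameOf_spanOfFrame e v) i.1) i.2
  point := fun z => spanOfFrame K k n ⟨fun i j => z.1 (i, j), by
    refine Matrix.linearIndependent_row_of_det_submatrix_ne_zero
      (A := Matrix.of fun i j => z.1 (i, j)) (e := e) ?_
    have : (Matrix.of fun i j => z.1 (i, j)).submatrix id e = 1 := by
      ext i j
      exact z.2 i j
    rw [this, Matrix.det_one]
    exact one_ne_zero⟩
  isMorphism_point := isMorphism_grassmannian _ fun i j =>
    (isMorphism_val _).reg (coord_mem_reg (i, j) ⊤) fun _ _ => trivial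
  point_mem := fun z => (det_frameOf_spanOfFrame_ne_zero_iff e _).mpr (by
    have : (Matrix.of fun i j => z.1 (i, j)).submatrix id e = 1 := by
      ext i j
      exact z.2 i j
    refine ne_of_eq_of_ne ((congrArg Matrix.det this).trans Matrix.det_one) one_ne_zero)
  coord_point := fun z => by
    have : (Matrix.of fun i j => z.1 (i, j)).submatrix id e = 1 := by
      ext i j
      exact z.2 i j
    ext i
    rw [normalizeCols_frameOf_spanOfFrame]
    exact congrFun (congrFun (Matrix.normalizeCols_of_eq_one this) i.1) i.2
  coord_mem := fun Λ hΛ i j => congrFun (congrFun (Matrix.normalizeCols_submatrix hΛ) i) j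
  point_coord := fun Λ hΛ => by
    refine Subtype.ext (Eq.trans ?_ (span_frameOf Λ))
    exact Matrix.span_row_mul (Matrix.isUnit_nonsing_inv_det _ (IsUnit.mk0 _ hΛ)) (frameOf Λ)

theorem exists_mem_grassChart (Λ : {L : Submodule K (Fin n → K) // Module.finrank K L = k}) :
    ∃ e, Λ ∈ (grassChart K e).source :=
  Matrix.exists_det_submatrix_ne_zero (linearIndependent_frameOf Λ)

end Determinantal

namespace SpaceWithFunctions

theorem isClosed_of_reg {K : Type u} [Field K] {X : SpaceWithFunctions K} {S : Set X}
    (h : ∀ x, x ∉ S → ∃ (O : Opens X) (f : X → K), x ∈ O ∧ f ∈ X.reg O ∧ f x ≠ 0 ∧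
      ∀ y ∈ O, y ∈ S → f y = 0) : IsClosed S := by
  refine ⟨isOpen_iff_forall_mem_open.mpr fun x hx => ?_⟩
  obtain ⟨O, f, hO, hf, hne, h0⟩ := h x hx
  exact ⟨_, fun y hy hyS => hy.2 (h0 y hy.1 hyS), X.isOpen_ne O f hf, hO, hne⟩

end SpaceWithFunctions

open scoped Matrix

/-! ### Minors, rank, and completing a frame to a basis. -/

namespace Matrix

variable {K : Type*} [Field K] {k : ℕ} {ι κ : Type*}

/-- First select independent columns that span the column space, then as many independent rows of
what is left, by the full-rank case applied to the transpose. -/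
theorem exists_det_submatrix_ne_zero_of_rank [Fintype ι] [Fintype κ] (M : Matrix κ ι K) :
    ∃ (f : Fin M.rank → κ) (e : Fin M.rank → ι), (M.submatrix f e).det ≠ 0 := by
  have h := Submodule.exists_fun_fin_finrank_span_eq K (Set.range M.col)
  rw [← Matrix.rank_eq_finrank_span_cols] at h
  obtain ⟨c, hc, -, hli⟩ := h
  choose e he using hc
  have h1 : (M.submatrix id e)ᵀ.row = c := by
    ext i j
    rw [← he]
    rfl
  obtain ⟨f, hf⟩ := exists_det_submatrix_ne_zero (h1 ▸ hli)
  refine ⟨f, e, ?_⟩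
  rw [← det_transpose]
  exact hf

theorem le_rank_of_det_submatrix_ne_zero [Fintype ι] {r : ℕ} {M : Matrix κ ι K}
    {f : Fin r → κ} {e : Fin r → ι} (h : (M.submatrix f e).det ≠ 0) : r ≤ M.rank := by
  have := rank_submatrix_le M f e
  rwa [rank_of_isUnit _ ((isUnit_iff_isUnit_det _).mpr h.isUnit), Fintype.card_fin] at this

theorem rank_add_finrank_ker [Fintype ι] (M : Matrix κ ι K) :
    M.rank + Module.finrank K (LinearMap.ker M.mulVecLin) = Fintype.card ι := by
  rw [Matrix.rank, LinearMap.finrank_range_add_finrank_ker, Module.finrank_fintype_fun_eq_card]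

theorem span_row_le_ker_iff {a : Type*} [Fintype ι] (A : Matrix a ι K) (M : Matrix κ ι K) :
    Submodule.span K (Set.range A.row) ≤ LinearMap.ker M.mulVecLin ↔ M * Aᵀ = 0 := by
  rw [Submodule.span_le]
  constructor
  · intro h
    ext i j
    have := congrFun (LinearMap.mem_ker.mp (h ⟨j, rfl⟩)) i
    simpa [mulVec, dotProduct, mul_apply] using this
  · rintro h _ ⟨j, rfl⟩
    refine LinearMap.mem_ker.mpr ?_
    ext i
    have := congrFun (congrFun h i) j
    simpa [mulVec, dotProduct, mul_apply] using this

/-- Any injection `Fin k → Fin n` extends to a bijection of `Fin k ⊕ Fin l` with `Fin n`. -/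
theorem exists_equiv_extending {l n : ℕ} (h : k + l = n) {e : Fin k → Fin n}
    (he : Function.Injective e) : ∃ σ : Fin k ⊕ Fin l ≃ Fin n, ∀ i, σ (Sum.inl i) = e i := by
  classical
  have hcard : Fintype.card ((Set.range e)ᶜ : Set (Fin n)) = Fintype.card (Fin l) := by
    rw [Fintype.card_compl_set, Set.card_range_of_injective he]
    simp
    omega
  have τ := Fintype.equivOfCardEq hcard
  refine ⟨(Equiv.sumCongr (Equiv.ofInjective e he) τ.symm).trans (Equiv.Set.sumCompl _), fun i => ?_⟩
  simp

/-- Complete `A` below by the rows (0 | 1): the result is block triangular, with determinant the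
given minor. -/
theorem exists_isUnit_det_extending {l n : ℕ} (σ : Fin k ⊕ Fin l ≃ Fin n)
    {A : Matrix (Fin k) (Fin n) K} (hA : (A.submatrix id (fun i => σ (Sum.inl i))).det ≠ 0) :
    ∃ g : Matrix (Fin n) (Fin n) K, g.det ≠ 0 ∧ ∀ i j, g (σ (Sum.inl i)) j = A i j := by
  let g : Matrix (Fin k ⊕ Fin l) (Fin k ⊕ Fin l) K := fromBlocks
    (A.submatrix id (fun i => σ (Sum.inl i))) (A.submatrix id (fun i => σ (Sum.inr i))) 0 1
  refine ⟨g.submatrix σ.symm σ.symm, ?_, fun i j => ?_⟩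
  · rw [det_submatrix_equiv_self, det_fromBlocks_zero₂₁, det_one, mul_one]
    exact hA
  · obtain ⟨s, rfl⟩ := σ.surjective j
    cases s <;> simp [g]

end Matrix

namespace Determinantal

open SpaceWithFunctions
open scoped Matrix

variable {K : Type u} [Field K] {X : SpaceWithFunctions K} {m n k l : ℕ}

/-! ### The incidence variety -/

theorem ker_mk (M : Matrix (Fin m) (Fin n) K) (hM : M ≠ 0) :
    ker (Projectivization.mk K M hM) = LinearMap.ker M.mulVecLin := by
  obtain ⟨c, hc⟩ := Projectivization.exists_smul_eq_mk_rep K M hM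
  rw [ker, ← hc]
  ext v
  simp only [LinearMap.mem_ker, Matrix.mulVecLin_apply, Units.smul_def, Matrix.smul_mulVec]
  simp

theorem normalizedRep_ne_zero {a : Fin m × Fin n}
    {φ : Projectivization K (Matrix (Fin m) (Fin n) K)} (h : φ.rep a.1 a.2 ≠ 0) :
    normalizedRep a φ ≠ 0 :=
  smul_ne_zero (inv_ne_zero h) φ.rep_nonzero

theorem mk_normalizedRep {a : Fin m × Fin n}
    {φ : Projectivization K (Matrix (Fin m) (Fin n) K)} (h : φ.rep a.1 a.2 ≠ 0) :
    Projectivization.mk K _ (normalizedRep_ne_zero h) = φ :=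
  Eq.trans ((Projectivization.mk_eq_mk_iff' K _ _ _ _).mpr ⟨(φ.rep a.1 a.2)⁻¹, rfl⟩) φ.mk_rep

theorem ker_normalizedRep {a : Fin m × Fin n}
    {φ : Projectivization K (Matrix (Fin m) (Fin n) K)} (h : φ.rep a.1 a.2 ≠ 0) :
    LinearMap.ker (normalizedRep a φ).mulVecLin = ker φ := by
  rw [← ker_mk _ (normalizedRep_ne_zero h), mk_normalizedRep h]

theorem normalizedRep_mem_reg (a i : Fin m × Fin n) : (fun φ => normalizedRep a φ i.1 i.2) ∈
    (projMatrix K m n).reg (projChart K a).source :=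
  (projChart K a).coord_mem_reg i

/-- The matrix of `Λ` in the chart `e`. -/
noncomputable abbrev normalizedFrame (e : Fin k → Fin n)
    (Λ : {L : Submodule K (Fin n → K) // Module.finrank K L = k}) : Matrix (Fin k) (Fin n) K :=
  (frameOf Λ).normalizeCols e

theorem span_normalizedFrame {e : Fin k → Fin n}
    {Λ : {L : Submodule K (Fin n → K) // Module.finrank K L = k}}
    (h : ((frameOf Λ).submatrix id e).det ≠ 0) :
    Submodule.span K (Set.range (normalizedFrame e Λ).row) = Λ.1 :=
  (Matrix.span_row_mul (Matrix.isUnit_nonsing_inv_det _ (IsUnit.mk0 _ h)) (frameOf Λ)).trans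
    (span_frameOf Λ)

/-- In a chart of the product, incidence becomes a matrix equation in the coordinates. It provides
both the local equations and the solved form in `freeChart`. -/
theorem le_ker_iff {e : Fin k → Fin n} {Λ : {L : Submodule K (Fin n → K) // Module.finrank K L = k}}
    (h : ((frameOf Λ).submatrix id e).det ≠ 0) {a : Fin m × Fin n}
    {φ : Projectivization K (Matrix (Fin m) (Fin n) K)} (h' : φ.rep a.1 a.2 ≠ 0) :
    Λ.1 ≤ ker φ ↔ normalizedRep a φ * (normalizedFrame e Λ)ᵀ = 0 := by
  rw [← ker_normalizedRep h', ← span_normalizedFrame h, Matrix.span_row_le_ker_iff]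

theorem mem_tauSet_of_le {Λ : {L : Submodule K (Fin n → K) // Module.finrank K L = k}}
    {φ : Projectivization K (Matrix (Fin m) (Fin n) K)} (h : Λ.1 ≤ ker φ) : φ ∈ tauSet K m n k := by
  have := Submodule.finrank_mono h
  rwa [Λ.2] at this

/-- Rank is lower semicontinuous. If φ lies outside, a nonvanishing minor of φ whose size is the
rank of φ, which is more than n - k, vanishes at every point of the set in the chart. -/
theorem isClosed_tauSet : IsClosed (X := (projMatrix K m n).carrier) (tauSet K m n k) := by
  refine isClosed_of_reg (X := projMatrix K m n) fun φ hφ => ?_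
  obtain ⟨a, ha⟩ := exists_mem_projChart φ
  obtain ⟨f, e, hfe⟩ := (normalizedRep a φ).exists_det_submatrix_ne_zero_of_rank
  refine ⟨(projChart K a).source, fun ψ => ((normalizedRep a ψ).submatrix f e).det, ha,
    det_mem fun i j => normalizedRep_mem_reg a (f i, e j), hfe, fun ψ hψ hψk => ?_⟩
  by_contra h
  have h1 := Matrix.le_rank_of_det_submatrix_ne_zero h
  have h2 := (normalizedRep a ψ).rank_add_finrank_ker
  have h3 := (normalizedRep a φ).rank_add_finrank_ker
  rw [ker_normalizedRep hψ] at h2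
  rw [ker_normalizedRep ha] at h3
  have h4 : k ≤ Module.finrank K (ker ψ) := hψk
  have h5 : ¬ k ≤ Module.finrank K (ker φ) := hφ
  omega

/-- The product of Grassmannian and projective space. -/
abbrev grassProj (K : Type u) [Field K] (m n k : ℕ) : SpaceWithFunctions K :=
  (grassmannian K k n).prod (projMatrix K m n)

/-- A chart of the product of Grassmannian and projective space. -/
noncomputable abbrev prodChart (K : Type u) [Field K] {m n k : ℕ} (e : Fin k → Fin n)
    (a : Fin m × Fin n) : AffineChart (grassProj K m n k) (Fin k × Fin n ⊕ Fin m × Fin n) :=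
  (grassChart K e).prod (projChart K a)

theorem prodChart_frame_mem_reg (e : Fin k → Fin n) (a : Fin m × Fin n) (i : Fin k) (j : Fin n) :
    (fun w : (grassProj K m n k).carrier => normalizedFrame e w.1 i j) ∈
      (grassProj K m n k).reg (prodChart K e a).source :=
  (prodChart K e a).coord_mem_reg (Sum.inl (i, j))

theorem prodChart_rep_mem_reg (e : Fin k → Fin n) (a : Fin m × Fin n) (i : Fin m) (j : Fin n) :
    (fun w : (grassProj K m n k).carrier => normalizedRep a w.2 i j) ∈
      (grassProj K m n k).reg (prodChart K e a).source :=
  (prodChart K e a).coord_mem_reg (Sum.inr (i, j))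

/-- The entries of the product in `le_ker_iff` are local equations; the rank condition on φ needs
none, because it follows from Λ ⊆ ker φ. -/
theorem isClosed_tauHatSet : IsClosed (X := (grassProj K m n k).carrier) (tauHatSet K m n k) := by
  refine isClosed_of_reg (X := grassProj K m n k) fun w hw => ?_
  obtain ⟨e, he⟩ := exists_mem_grassChart w.1
  obtain ⟨a, ha⟩ := exists_mem_projChart w.2
  have h1 : normalizedRep a w.2 * (normalizedFrame e w.1)ᵀ ≠ 0 := fun h =>
    hw ⟨mem_tauSet_of_le ((le_ker_iff he ha).mpr h), (le_ker_iff he ha).mpr h⟩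
  obtain ⟨i, j, hij⟩ : ∃ i j, (normalizedRep a w.2 * (normalizedFrame e w.1)ᵀ) i j ≠ 0 := by
    by_contra! h
    exact h1 (Matrix.ext h)
  refine ⟨(prodChart K e a).source, fun w => (normalizedRep a w.2 * (normalizedFrame e w.1)ᵀ) i j,
    ⟨he, ha⟩, matrix_mul_mem (prodChart_rep_mem_reg e a) (fun i j => prodChart_frame_mem_reg e a j i)
      i j, hij, fun v hv hvS => ?_⟩
  exact congrFun (congrFun ((le_ker_iff hv.1 hv.2).mp hvS.2) i) j

/-- A chart of the determinantal variety. -/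
noncomputable abbrev tauChart (K : Type u) [Field K] {m n : ℕ} (k : ℕ) (a : Fin m × Fin n) :
    AffineChart (tau K m n k) (Fin m × Fin n) :=
  (projChart K a).restrict isClosed_tauSet

/-- A chart of the incidence variety. -/
noncomputable abbrev tauHatChart (K : Type u) [Field K] {m n k : ℕ} (e : Fin k → Fin n)
    (a : Fin m × Fin n) : AffineChart (tauHat K m n k) (Fin k × Fin n ⊕ Fin m × Fin n) :=
  (prodChart K e a).restrict isClosed_tauHatSet

theorem isMorphism_tauHat {p : X → Matrix (Fin k) (Fin n) K} {q : X → Matrix (Fin m) (Fin n) K}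
    (hp : ∀ x, LinearIndependent K (p x).row) (hq : ∀ x, q x ≠ 0)
    (hpr : ∀ i j, (fun x => p x i j) ∈ X.reg ⊤) (hqr : ∀ i j, (fun x => q x i j) ∈ X.reg ⊤)
    (h : ∀ x, q x * (p x)ᵀ = 0) :
    ∃ s : X → tauHat K m n k, IsMorphism s ∧
      ∀ x, (s x).1.1 = spanOfFrame K k n ⟨p x, hp x⟩ ∧ (s x).1.2 = Projectivization.mk K (q x) (hq x) := by
  have hle : ∀ x, (spanOfFrame K k n ⟨p x, hp x⟩).1 ≤ ker (Projectivization.mk K (q x) (hq x)) := by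
    intro x
    rw [ker_mk]
    exact (Matrix.span_row_le_ker_iff (p x) (q x)).mpr (h x)
  have h1 := ((isMorphism_grassmannian hp hpr).prodMk (isMorphism_projMatrix hq hqr)).codRestrict
    (S := tauHatSet K m n k) fun x => ⟨mem_tauSet_of_le (hle x), hle x⟩
  exact ⟨_, h1, fun x => ⟨rfl, rfl⟩⟩

end Determinantal

namespace Determinantal

open SpaceWithFunctions
open scoped Matrix

variable {K : Type u} [Field K] {X : SpaceWithFunctions K} {m n k l : ℕ}

theorem rep_ne_zero_of_eq_mk {φ : Projectivization K (Matrix (Fin m) (Fin n) K)}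
    {M : Matrix (Fin m) (Fin n) K} {hM : M ≠ 0} (h : φ = Projectivization.mk K M hM)
    {a : Fin m × Fin n} (ha : M a.1 a.2 ≠ 0) : φ.rep a.1 a.2 ≠ 0 :=
  h ▸ (rep_apply_ne_zero_iff a M hM).mpr ha

theorem normalizedRep_of_eq_mk {φ : Projectivization K (Matrix (Fin m) (Fin n) K)}
    {M : Matrix (Fin m) (Fin n) K} {hM : M ≠ 0} (h : φ = Projectivization.mk K M hM)
    {a : Fin m × Fin n} (ha : M a.1 a.2 = 1) : normalizedRep a φ = M := by
  rw [h, normalizedRep_mk, ha, inv_one, one_smul]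

theorem det_frameOf_ne_zero_of_eq_span
    {Λ : {L : Submodule K (Fin n → K) // Module.finrank K L = k}} {A : Matrix (Fin k) (Fin n) K}
    {hA : LinearIndependent K A.row} (h : Λ = spanOfFrame K k n ⟨A, hA⟩) {e : Fin k → Fin n}
    (he : A.submatrix id e = 1) : ((frameOf Λ).submatrix id e).det ≠ 0 := by
  rw [h, det_frameOf_spanOfFrame_ne_zero_iff]
  exact ne_of_eq_of_ne ((congrArg Matrix.det he).trans Matrix.det_one) one_ne_zero

theorem normalizedFrame_of_eq_span
    {Λ : {L : Submodule K (Fin n → K) // Module.finrank K L = k}} {A : Matrix (Fin k) (Fin n) K}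
    {hA : LinearIndependent K A.row} (h : Λ = spanOfFrame K k n ⟨A, hA⟩) {e : Fin k → Fin n}
    (he : A.submatrix id e = 1) : normalizedFrame e Λ = A := by
  rw [normalizedFrame, h, normalizeCols_frameOf_spanOfFrame]
  exact Matrix.normalizeCols_of_eq_one he

/-! ### Charts of the incidence variety that are affine spaces -/

/-- The matrix with an identity matrix in the columns `σ (inl _)` and `B` in the others. -/
def freeFrame (σ : Fin k ⊕ Fin l ≃ Fin n) (B : Matrix (Fin k) (Fin l) K) :
    Matrix (Fin k) (Fin n) K :=
  (Matrix.fromCols 1 B).submatrix id σ.symm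

/-- The matrix with `Φ` in the columns `σ (inr _)` whose kernel contains the rows of
`freeFrame σ B`. -/
def freeMatrix (σ : Fin k ⊕ Fin l ≃ Fin n) (B : Matrix (Fin k) (Fin l) K)
    (Φ : Matrix (Fin m) (Fin l) K) : Matrix (Fin m) (Fin n) K :=
  (Matrix.fromCols (-(Φ * Bᵀ)) Φ).submatrix id σ.symm

variable (σ : Fin k ⊕ Fin l ≃ Fin n) (B : Matrix (Fin k) (Fin l) K) (Φ : Matrix (Fin m) (Fin l) K)

@[simp] theorem freeFrame_inl (i i' : Fin k) :
    freeFrame σ B i (σ (Sum.inl i')) = (1 : Matrix (Fin k) (Fin k) K) i i' := by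
  simp [freeFrame]

@[simp] theorem freeFrame_inr (i : Fin k) (j : Fin l) : freeFrame σ B i (σ (Sum.inr j)) = B i j := by
  simp [freeFrame]

@[simp] theorem freeMatrix_inl (r : Fin m) (i : Fin k) :
    freeMatrix σ B Φ r (σ (Sum.inl i)) = -(Φ * Bᵀ) r i := by
  simp [freeMatrix]

@[simp] theorem freeMatrix_inr (r : Fin m) (j : Fin l) :
    freeMatrix σ B Φ r (σ (Sum.inr j)) = Φ r j := by
  simp [freeMatrix]

theorem freeMatrix_mul : freeMatrix σ B Φ * (freeFrame σ B)ᵀ = 0 := by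
  ext r i
  rw [Matrix.mul_apply, ← σ.sum_comp, Fintype.sum_sum_type]
  simp [Matrix.one_apply, Matrix.mul_apply]

theorem freeFrame_submatrix :
    (freeFrame σ B).submatrix id (fun i => σ (Sum.inl i)) = 1 := by
  ext i i'
  simp

theorem freeFrame_linearIndependent : LinearIndependent K (freeFrame σ B).row :=
  Matrix.linearIndependent_row_of_det_submatrix_ne_zero (e := fun i => σ (Sum.inl i)) (by
    rw [freeFrame_submatrix, Matrix.det_one]
    exact one_ne_zero)

variable {σ}

theorem eq_freeFrame {A : Matrix (Fin k) (Fin n) K}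
    (h : A.submatrix id (fun i => σ (Sum.inl i)) = 1) :
    freeFrame σ (A.submatrix id fun j => σ (Sum.inr j)) = A := by
  ext i j
  obtain ⟨s, rfl⟩ := σ.surjective j
  rcases s with i' | j
  · rw [freeFrame_inl, ← h]
    rfl
  · simp

/-- With A = (1 | B), the equation F Aᵀ = 0 expresses the left block of F as -ΦBᵀ, with Φ the right
block. This is why the incidence variety has free coordinates. -/
theorem eq_freeMatrix {A : Matrix (Fin k) (Fin n) K}
    (h : A.submatrix id (fun i => σ (Sum.inl i)) = 1) {F : Matrix (Fin m) (Fin n) K}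
    (hF : F * Aᵀ = 0) : freeMatrix σ (A.submatrix id fun j => σ (Sum.inr j))
      (F.submatrix id fun j => σ (Sum.inr j)) = F := by
  ext r j
  obtain ⟨s, rfl⟩ := σ.surjective j
  rcases s with i | j
  · have h1 := congrFun (congrFun hF r) i
    have h2 : ∀ i', A i (σ (Sum.inl i')) = (1 : Matrix (Fin k) (Fin k) K) i i' := fun i' => by
      rw [← h]
      rfl
    rw [Matrix.mul_apply, ← σ.sum_comp, Fintype.sum_sum_type] at h1
    simp only [Matrix.transpose_apply, h2, Matrix.one_apply, mul_ite, mul_one, mul_zero,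
      Finset.sum_ite_eq, Finset.mem_univ, if_true, Matrix.zero_apply] at h1
    rw [freeMatrix_inl, eq_comm, eq_neg_iff_add_eq_zero, Matrix.mul_apply]
    exact h1
  · simp

/-- The index type of the free coordinates. -/
abbrev FreeIndex (k l m : ℕ) (a : Fin m × Fin l) : Type :=
  Fin k × Fin l ⊕ {p : Fin m × Fin l // p ≠ a}

theorem card_freeIndex (a : Fin m × Fin l) : Nat.card (FreeIndex k l m a) = (k + m) * l - 1 := by
  -- The existence of the entry `a` ensures that subtracting 1 does not truncate.
  have h : 0 < m * l := by
    have := Fintype.card_pos_iff.mpr ⟨a⟩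
    simpa using this
  rw [Nat.card_eq_fintype_card, Fintype.card_sum, Fintype.card_subtype_compl]
  simp
  rw [add_mul]
  omega

/-- The matrix with free coordinates `z`. -/
def freeEntries (a : Fin m × Fin l) (z : FreeIndex k l m a → K) : Matrix (Fin m) (Fin l) K :=
  Matrix.of fun r j => if h : (r, j) = a then 1 else z (Sum.inr ⟨(r, j), h⟩)

/-- The other matrix with free coordinates `z`. -/
def freeColumns (a : Fin m × Fin l) (z : FreeIndex k l m a → K) : Matrix (Fin k) (Fin l) K :=
  Matrix.of fun i j => z (Sum.inl (i, j))

variable (σ)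

theorem freeMatrix_apply_eq_one (a : Fin m × Fin l) (z : FreeIndex k l m a → K) :
    freeMatrix σ (freeColumns a z) (freeEntries a z) a.1 (σ (Sum.inr a.2)) = 1 := by
  simp [freeEntries]

theorem freeMatrix_ne_zero (a : Fin m × Fin l) (z : FreeIndex k l m a → K) :
    freeMatrix σ (freeColumns a z) (freeEntries a z) ≠ 0 := fun h =>
  one_ne_zero ((freeMatrix_apply_eq_one σ a z).symm.trans (by rw [h]; rfl))

theorem freeColumns_mem_reg (a : Fin m × Fin l) (i : Fin k) (j : Fin l) :
    (fun z => freeColumns a z i j) ∈ (affineSpace K (FreeIndex k l m a)).reg ⊤ :=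
  coord_mem_reg (Sum.inl (i, j)) ⊤

theorem freeEntries_mem_reg (a : Fin m × Fin l) (r : Fin m) (j : Fin l) :
    (fun z => freeEntries a z r j) ∈ (affineSpace K (FreeIndex k l m a)).reg ⊤ := by
  by_cases h : (r, j) = a
  · refine reg_congr (X := affineSpace K (FreeIndex k l m a)) (const_mem_reg ⊤ 1) fun z _ => ?_
    simp [freeEntries, h]
  · refine reg_congr (X := affineSpace K (FreeIndex k l m a))
      (coord_mem_reg (Sum.inr ⟨(r, j), h⟩) ⊤) fun z _ => ?_
    simp [freeEntries, h]

theorem freeFrame_mem_reg (a : Fin m × Fin l) (i : Fin k) (j : Fin n) :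
    (fun z => freeFrame σ (freeColumns a z) i j) ∈ (affineSpace K (FreeIndex k l m a)).reg ⊤ := by
  obtain ⟨s, rfl⟩ := σ.surjective j
  rcases s with i' | j
  · simp only [freeFrame_inl]
    exact const_mem_reg (X := affineSpace K (FreeIndex k l m a)) ⊤ _
  · simp only [freeFrame_inr]
    exact freeColumns_mem_reg a i j

theorem freeMatrix_mem_reg (a : Fin m × Fin l) (r : Fin m) (j : Fin n) :
    (fun z => freeMatrix σ (freeColumns a z) (freeEntries a z) r j) ∈
      (affineSpace K (FreeIndex k l m a)).reg ⊤ := by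
  obtain ⟨s, rfl⟩ := σ.surjective j
  rcases s with i' | j
  · simp only [freeMatrix_inl]
    exact neg_mem (matrix_mul_mem (freeEntries_mem_reg a) (fun i j => freeColumns_mem_reg a j i) r i')
  · simp only [freeMatrix_inr]
    exact freeEntries_mem_reg a r j

theorem exists_isMorphism_free (a : Fin m × Fin l) :
    ∃ s : (FreeIndex k l m a → K) → tauHat K m n k, IsMorphism (X := affineSpace K _) s ∧
      ∀ z, (s z).1.1 = spanOfFrame K k n ⟨_, freeFrame_linearIndependent σ (freeColumns a z)⟩ ∧
        (s z).1.2 = Projectivization.mk K _ (freeMatrix_ne_zero σ a z) :=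
  isMorphism_tauHat (X := affineSpace K (FreeIndex k l m a)) _ _ (freeFrame_mem_reg σ a)
    (freeMatrix_mem_reg σ a) fun _ => freeMatrix_mul σ _ _

theorem mul_transpose_eq_zero_of_mem {e : Fin k → Fin n} {a : Fin m × Fin n}
    {w : (tauHat K m n k).carrier} (hw : w ∈ (tauHatChart K e a).source) :
    normalizedRep a w.1.2 * (normalizedFrame e w.1.1)ᵀ = 0 :=
  (le_ker_iff hw.1 hw.2).mp w.2.2

/-- The chart of the incidence variety with target the affine space. -/
noncomputable def freeChart (K : Type u) [Field K] {m n k l : ℕ} (σ : Fin k ⊕ Fin l ≃ Fin n)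
    (a : Fin m × Fin l) : AffineChart (tauHat K m n k) (FreeIndex k l m a) :=
  AffineChart.ofMorphism
    -- The entry scaled to 1 must be in the right block, since only those entries are free;
    -- `exists_mem_freeChart` shows that this loses no points.
    (tauHatChart K (fun i => σ (Sum.inl i)) (a.1, σ (Sum.inr a.2))).source
    (fun w => Sum.elim
      (fun p => normalizedFrame (fun i => σ (Sum.inl i)) w.1.1 p.1 (σ (Sum.inr p.2)))
      (fun p => normalizedRep (a.1, σ (Sum.inr a.2)) w.1.2 p.1.1 (σ (Sum.inr p.1.2))))
    (by
      rintro (p | p)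
      · exact (tauHatChart K (fun i => σ (Sum.inl i)) (a.1, σ (Sum.inr a.2))).coord_mem_reg
          (Sum.inl (p.1, σ (Sum.inr p.2)))
      · exact (tauHatChart K (fun i => σ (Sum.inl i)) (a.1, σ (Sum.inr a.2))).coord_mem_reg
          (Sum.inr (p.1.1, σ (Sum.inr p.1.2))))
    (exists_isMorphism_free σ a).choose
    (exists_isMorphism_free σ a).choose_spec.1
    (fun z => by
      obtain ⟨h1, h2⟩ := (exists_isMorphism_free σ a).choose_spec.2 z
      exact ⟨det_frameOf_ne_zero_of_eq_span h1 (freeFrame_submatrix σ _),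
        rep_ne_zero_of_eq_mk (a := (a.1, σ (Sum.inr a.2))) h2
          (ne_of_eq_of_ne (freeMatrix_apply_eq_one σ a z) one_ne_zero)⟩)
    (fun z => by
      obtain ⟨h1, h2⟩ := (exists_isMorphism_free σ a).choose_spec.2 z
      have h3 := normalizedFrame_of_eq_span h1 (freeFrame_submatrix σ (freeColumns a z))
      have h4 := normalizedRep_of_eq_mk (a := (a.1, σ (Sum.inr a.2))) h2
        (freeMatrix_apply_eq_one σ a z)
      ext (p | p)
      · refine (congrFun (congrFun h3 p.1) (σ (Sum.inr p.2))).trans ?_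
        exact freeFrame_inr σ (freeColumns a z) p.1 p.2
      · refine (congrFun (congrFun h4 p.1.1) (σ (Sum.inr p.1.2))).trans ?_
        rw [freeMatrix_inr]
        simp [freeEntries, p.2])
    (fun w hw => by
      obtain ⟨h1, h2⟩ := (exists_isMorphism_free σ a).choose_spec.2 (Sum.elim
        (fun p => normalizedFrame (fun i => σ (Sum.inl i)) w.1.1 p.1 (σ (Sum.inr p.2)))
        (fun p => normalizedRep (a.1, σ (Sum.inr a.2)) w.1.2 p.1.1 (σ (Sum.inr p.1.2))))
      have h3 := mul_transpose_eq_zero_of_mem hw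
      have h4 := Matrix.normalizeCols_submatrix hw.1
      have h5 : (normalizedRep (a.1, σ (Sum.inr a.2)) w.1.2) a.1 (σ (Sum.inr a.2)) = 1 :=
        inv_mul_cancel₀ hw.2
      -- The omitted coordinate is restored as 1, which is the true value because the representative
      -- is normalized at that entry.
      have h6 : freeEntries a (Sum.elim
        (fun p => normalizedFrame (fun i => σ (Sum.inl i)) w.1.1 p.1 (σ (Sum.inr p.2)))
        (fun p => normalizedRep (a.1, σ (Sum.inr a.2)) w.1.2 p.1.1 (σ (Sum.inr p.1.2)))) =
          (normalizedRep (a.1, σ (Sum.inr a.2)) w.1.2).submatrix id fun j => σ (Sum.inr j) := by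
        ext r j
        by_cases h : (r, j) = a
        · subst h
          simp [freeEntries, h5]
        · simp [freeEntries, h]
      refine Subtype.ext (Prod.ext (h1.trans (Subtype.ext ?_)) (h2.trans ?_))
      · refine Eq.trans ?_ (span_normalizedFrame hw.1)
        exact congrArg (fun A : Matrix (Fin k) (Fin n) K => Submodule.span K (Set.range A.row))
          (eq_freeFrame h4)
      · refine Eq.trans ?_ (mk_normalizedRep hw.2)
        congr 1
        rw [h6]
        exact eq_freeMatrix h4 h3)

/-- If the right block of φ vanished, so would the left block -ΦBᵀ, and φ would be zero. So some
entry of the right block can be scaled to 1. -/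
theorem exists_mem_freeChart (hkl : k + l = n) (w : (tauHat K m n k).carrier) :
    ∃ (σ : Fin k ⊕ Fin l ≃ Fin n) (a : Fin m × Fin l), w ∈ (freeChart K σ a).source := by
  obtain ⟨e, he⟩ := exists_mem_grassChart w.1.1
  obtain ⟨σ, hσ⟩ := Matrix.exists_equiv_extending hkl (Matrix.injective_of_det_submatrix_ne_zero he)
  obtain rfl : (fun i => σ (Sum.inl i)) = e := funext hσ
  obtain ⟨b, hb⟩ := exists_mem_projChart w.1.2
  suffices h : ∃ a : Fin m × Fin l, Projectivization.rep w.1.2 a.1 (σ (Sum.inr a.2)) ≠ 0 by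
    obtain ⟨a, ha⟩ := h
    exact ⟨σ, a, he, ha⟩
  by_contra! h
  have h1 := (le_ker_iff he hb).mp w.2.2
  refine normalizedRep_ne_zero hb ?_
  rw [← eq_freeMatrix (Matrix.normalizeCols_submatrix he) h1]
  have : (normalizedRep b w.1.2).submatrix id (fun j => σ (Sum.inr j)) = 0 := by
    ext r j
    have := h (r, j)
    simp only [normalizedRep, Matrix.submatrix_apply, id, Matrix.smul_apply, this, smul_zero,
      Matrix.zero_apply]
  rw [this]
  ext r j
  obtain ⟨s, rfl⟩ := σ.surjective j
  cases s <;> simp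

end Determinantal

namespace Matrix

/-- Here σ is fixed in advance, while the columns of a nonzero minor depend on `A`. The completion
is made with a bijection σ' adapted to `A`, and its rows are then permuted, which changes the
determinant only by a sign. -/
theorem exists_det_ne_zero_extending {K : Type*} [Field K] {k l n : ℕ} (σ : Fin k ⊕ Fin l ≃ Fin n)
    {A : Matrix (Fin k) (Fin n) K} (hA : LinearIndependent K A.row) :
    ∃ g : Matrix (Fin n) (Fin n) K, g.det ≠ 0 ∧ ∀ i j, g (σ (Sum.inl i)) j = A i j := by
  obtain ⟨e, he⟩ := exists_det_submatrix_ne_zero hA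
  have hkl : k + l = n := by simpa using Fintype.card_congr σ
  obtain ⟨σ', hσ'⟩ := exists_equiv_extending hkl (injective_of_det_submatrix_ne_zero he)
  obtain rfl : (fun i => σ' (Sum.inl i)) = e := funext hσ'
  obtain ⟨g, hg, h⟩ := exists_isUnit_det_extending σ' he
  refine ⟨g.submatrix (σ.symm.trans σ') id, ?_, fun i j => ?_⟩
  · rw [det_permute]
    refine mul_ne_zero ?_ hg
    rcases Int.units_eq_one_or (Equiv.Perm.sign (σ.symm.trans σ')) with h | h <;> simp [h]
  · simpa using h i j

end Matrix

namespace SpaceWithFunctions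

theorem irreducibleSpace_of_surjective {X Y : Type*} [TopologicalSpace X] [TopologicalSpace Y]
    [IrreducibleSpace X] {f : X → Y} (hf : Continuous f) (hs : Function.Surjective f) :
    IrreducibleSpace Y := by
  rw [irreducibleSpace_def]
  simpa [hs.range_eq] using (irreducibleSpace_def X |>.mp inferInstance).image f hf.continuousOn

end SpaceWithFunctions

namespace Determinantal

open SpaceWithFunctions
open scoped Matrix

variable {K : Type u} [Field K] {X : SpaceWithFunctions K} {m n k l : ℕ}

/-! ### Separatedness -/

theorem isSeparated_projMatrix : IsSeparated (projMatrix K m n) := by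
  refine isSeparated_of_reg fun φ ψ hne => ?_
  obtain ⟨a, ha⟩ := exists_mem_projChart φ
  obtain ⟨b, hb⟩ := exists_mem_projChart ψ
  -- The 2 × 2 minors of the two coordinate vectors that involve the entry `b` detect
  -- proportionality, because the second vector has a 1 there.
  obtain ⟨i, hi⟩ : ∃ i : Fin m × Fin n,
      normalizedRep a φ i.1 i.2 * normalizedRep b ψ b.1 b.2 -
        normalizedRep a φ b.1 b.2 * normalizedRep b ψ i.1 i.2 ≠ 0 := by
    by_contra! h
    refine hne ?_
    have h1 : normalizedRep b ψ b.1 b.2 = 1 := inv_mul_cancel₀ hb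
    refine (mk_normalizedRep ha).symm.trans (Eq.trans ?_ (mk_normalizedRep hb))
    refine (Projectivization.mk_eq_mk_iff' K _ _ _ _).mpr ⟨normalizedRep a φ b.1 b.2, ?_⟩
    ext i j
    have := h (i, j)
    rw [h1, mul_one, sub_eq_zero] at this
    exact this.symm
  refine ⟨((projChart K a).prod (projChart K b)).source,
    fun w => normalizedRep a w.1 i.1 i.2 * normalizedRep b w.2 b.1 b.2 -
      normalizedRep a w.1 b.1 b.2 * normalizedRep b w.2 i.1 i.2, ⟨ha, hb⟩,
    sub_mem (mul_mem ?_ ?_) (mul_mem ?_ ?_), hi, fun z _ => ?_⟩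
  · exact ((projChart K a).prod (projChart K b)).coord_mem_reg (Sum.inl i)
  · exact ((projChart K a).prod (projChart K b)).coord_mem_reg (Sum.inr b)
  · exact ((projChart K a).prod (projChart K b)).coord_mem_reg (Sum.inl b)
  · exact ((projChart K a).prod (projChart K b)).coord_mem_reg (Sum.inr i)
  · simp only [normalizedRep, Matrix.smul_apply, smul_eq_mul]
    ring

theorem isSeparated_grassmannian : IsSeparated (grassmannian K k n) := by
  refine isSeparated_of_reg fun Λ Λ' hne => ?_
  obtain ⟨e, he⟩ := exists_mem_grassChart Λ
  obtain ⟨e', he'⟩ := exists_mem_grassChart Λ'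
  -- As A is the identity in the columns `e`, the rows of A' lie in the row space of A only if A' =
  -- A'ₑ A, with A'ₑ the columns `e` of A'. These equations hold on the diagonal and force Λ' = Λ by
  -- equality of dimensions.
  obtain ⟨i, j, hij⟩ : ∃ i j, (normalizedFrame e' Λ' -
      (normalizedFrame e' Λ').submatrix id e * normalizedFrame e Λ) i j ≠ 0 := by
    by_contra! h
    have h1 : normalizedFrame e' Λ' = (normalizedFrame e' Λ').submatrix id e * normalizedFrame e Λ :=
      sub_eq_zero.mp (Matrix.ext h)
    refine hne (Subtype.ext (Submodule.eq_of_le_of_finrank_eq ?_ (Λ'.2.trans Λ.2.symm)).symm)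
    rw [← span_normalizedFrame he, ← span_normalizedFrame he', Submodule.span_le]
    rintro _ ⟨i, rfl⟩
    refine (Submodule.mem_span_range_iff_exists_fun K).mpr ⟨(normalizedFrame e' Λ').submatrix id e i, ?_⟩
    ext j
    refine Eq.trans ?_ (congrFun (congrFun h1 i) j).symm
    simp [Matrix.mul_apply]
  refine ⟨((grassChart K e).prod (grassChart K e')).source,
    fun w => (normalizedFrame e' w.2 - (normalizedFrame e' w.2).submatrix id e *
      normalizedFrame e w.1) i j, ⟨he, he'⟩, sub_mem ?_ (matrix_mul_mem (fun i j => ?_)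
      (fun i j => ?_) i j), hij, fun Λ hΛ => ?_⟩
  · exact ((grassChart K e).prod (grassChart K e')).coord_mem_reg (Sum.inr (i, j))
  · exact ((grassChart K e).prod (grassChart K e')).coord_mem_reg (Sum.inr (i, e j))
  · exact ((grassChart K e).prod (grassChart K e')).coord_mem_reg (Sum.inl (i, j))
  · have h1 : ((frameOf Λ).submatrix id e).det ≠ 0 := hΛ.1
    have : normalizedFrame e' Λ = (normalizedFrame e' Λ).submatrix id e * normalizedFrame e Λ := by
      show Matrix.normalizeCols e' (frameOf Λ) = (Matrix.normalizeCols e' (frameOf Λ)).submatrix id e *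
        Matrix.normalizeCols e (frameOf Λ)
      rw [Matrix.normalizeCols, Matrix.submatrix_mul_left,
        Matrix.normalizeCols, Matrix.mul_assoc, ← Matrix.mul_assoc _ _ (frameOf Λ),
        Matrix.mul_nonsing_inv _ h1.isUnit, Matrix.one_mul]
    exact sub_eq_zero.mpr (congrFun (congrFun this i) j)

theorem isSeparated_tau : IsSeparated (tau K m n k) :=
  isSeparated_of_morphisms fun _ _ h => ⟨_, _, isSeparated_projMatrix,
    isMorphism_val (X := projMatrix K m n) (tauSet K m n k), fun h' => h (Subtype.ext h')⟩

theorem isSeparated_tauHat : IsSeparated (tauHat K m n k) := by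
  refine isSeparated_of_morphisms fun x y h => ?_
  by_cases h1 : x.1.1 = y.1.1
  · refine ⟨_, _, isSeparated_projMatrix, isMorphism_snd.comp
      (isMorphism_val (X := grassProj K m n k) (tauHatSet K m n k)), fun h' => h ?_⟩
    exact Subtype.ext (Prod.ext h1 h')
  · exact ⟨_, _, isSeparated_grassmannian, isMorphism_fst.comp
      (isMorphism_val (X := grassProj K m n k) (tauHatSet K m n k)), h1⟩

/-! ### The projection -/

theorem isMorphism_nu : IsMorphism (nu K m n k) :=
  IsMorphism.codRestrict (X := projMatrix K m n) (isMorphism_snd.comp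
    (isMorphism_val (X := grassProj K m n k) (tauHatSet K m n k))) fun w => w.2.1

theorem nu_surjective : Function.Surjective (nu K m n k) := by
  rintro ⟨φ, hφ⟩
  obtain ⟨f, hf⟩ := exists_linearIndependent_of_le_finrank (R := K) (M := ker φ) hφ
  have hf' : LinearIndependent K (fun i => (f i : Fin n → K)) := hf.map' (ker φ).subtype (by simp)
  refine ⟨⟨(spanOfFrame K k n ⟨_, hf'⟩, φ), hφ, ?_⟩, rfl⟩
  refine Submodule.span_le.mpr ?_
  rintro _ ⟨i, rfl⟩
  exact (f i).2

/-! ### Irreducibility -/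

/-- The matrix `Ψ g⁻¹`, up to scalar, for `Ψ` with the columns `σ (inl _)` replaced by zero. -/
noncomputable def killing (σ : Fin k ⊕ Fin l ≃ Fin n) (g : Matrix (Fin n) (Fin n) K)
    (Ψ : Matrix (Fin m) (Fin n) K) : Matrix (Fin m) (Fin n) K :=
  Ψ * Matrix.diagonal (fun j => if (σ.symm j).isRight then (1 : K) else 0) * gᵀ.adjugate

variable (σ : Fin k ⊕ Fin l ≃ Fin n)

/-- The adjugate cancels against gᵀ up to the determinant, and the diagonal projector annihilates
the columns belonging to Λ. -/
theorem killing_mul (g : Matrix (Fin n) (Fin n) K) (Ψ : Matrix (Fin m) (Fin n) K) :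
    killing σ g Ψ * (g.submatrix (fun i => σ (Sum.inl i)) id)ᵀ = 0 := by
  have h1 : killing σ g Ψ * gᵀ = g.det •
      (Ψ * Matrix.diagonal (fun j => if (σ.symm j).isRight then (1 : K) else 0)) := by
    rw [killing, Matrix.mul_assoc, Matrix.adjugate_mul, Matrix.det_transpose, Matrix.mul_smul,
      Matrix.mul_one]
  ext r i
  have h2 := congrFun (congrFun h1 r) (σ (Sum.inl i))
  rw [Matrix.smul_apply, Matrix.mul_diagonal] at h2
  simpa [Matrix.mul_apply] using h2

/-- If M kills the rows of g that span Λ, the corresponding columns of Mgᵀ are already zero and the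
projector does nothing. Hence every φ vanishing on Λ arises from `killing`. -/
theorem killing_eq {g : Matrix (Fin n) (Fin n) K} {M : Matrix (Fin m) (Fin n) K}
    (h : M * (g.submatrix (fun i => σ (Sum.inl i)) id)ᵀ = 0) :
    killing σ g (M * gᵀ) = g.det • M := by
  have h1 : M * gᵀ * Matrix.diagonal (fun j => if (σ.symm j).isRight then (1 : K) else 0) = M * gᵀ := by
    ext r j
    rw [Matrix.mul_diagonal]
    obtain ⟨s, rfl⟩ := σ.surjective j
    rcases s with i | j
    · have := congrFun (congrFun h r) i
      simp only [Matrix.mul_apply, Matrix.transpose_apply, Matrix.submatrix_apply, id,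
        Matrix.zero_apply] at this ⊢
      simp [this]
    · simp
  rw [killing, h1, Matrix.mul_assoc, Matrix.mul_adjugate, Matrix.det_transpose, Matrix.mul_smul,
    Matrix.mul_one]

/-- Coordinates of a pair of matrices. -/
abbrev PairIndex (m n : ℕ) : Type := Fin n × Fin n ⊕ Fin m × Fin n

/-- The first matrix of a pair. -/
def pairLeft (z : PairIndex m n → K) : Matrix (Fin n) (Fin n) K :=
  Matrix.of fun i j => z (Sum.inl (i, j))

/-- The second matrix of a pair. -/
def pairRight (z : PairIndex m n → K) : Matrix (Fin m) (Fin n) K :=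
  Matrix.of fun i j => z (Sum.inr (i, j))

/-- The parameters of the incidence variety. -/
def parameters : Set (PairIndex m n → K) :=
  {z | (pairLeft z).det ≠ 0 ∧ killing σ (pairLeft z) (pairRight z) ≠ 0}

theorem pairLeft_mem_reg (i j : Fin n) :
    (fun z => pairLeft z i j) ∈ (affineSpace K (PairIndex m n)).reg ⊤ :=
  coord_mem_reg (Sum.inl (i, j)) ⊤

theorem killing_mem_reg (i : Fin m) (j : Fin n) :
    (fun z => killing σ (pairLeft z) (pairRight z) i j) ∈
      (affineSpace K (PairIndex m n)).reg ⊤ := by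
  have h1 : ∀ i j, (fun z => (pairRight z * Matrix.diagonal
      (fun j => if (σ.symm j).isRight then (1 : K) else 0)) i j) ∈
        (affineSpace K (PairIndex m n)).reg ⊤ :=
    matrix_mul_mem (M := fun z : PairIndex m n → K => pairRight z) (N := fun _ => Matrix.diagonal
      (fun j => if (σ.symm j).isRight then (1 : K) else 0))
      (fun i j => coord_mem_reg (Sum.inr (i, j)) ⊤)
      fun i j => const_mem_reg (X := affineSpace K (PairIndex m n)) ⊤ _
  have h2 : ∀ i j, (fun z : PairIndex m n → K => (pairLeft z)ᵀ.adjugate i j) ∈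
      (affineSpace K (PairIndex m n)).reg ⊤ :=
    adjugate_mem (M := fun z : PairIndex m n → K => (pairLeft z)ᵀ) fun i j => pairLeft_mem_reg j i
  exact matrix_mul_mem h1 h2 i j

theorem isOpen_parameters :
    IsOpen (X := (affineSpace K (PairIndex m n)).carrier) (parameters (K := K) (m := m) σ) := by
  have h1 := isOpen_ne _ ⊤ _ (det_mem (K := K) (B := (affineSpace K (PairIndex m n)).reg ⊤)
    pairLeft_mem_reg)
  have h2 := isClosed_setOf_eq (X := affineSpace K (PairIndex m n)) (J := Fin m × Fin n)
    (f := fun w z => killing σ (pairLeft z) (pairRight z) w.1 w.2) (g := fun _ _ => 0)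
    (fun w => killing_mem_reg σ w.1 w.2) fun _ => const_mem_reg _ 0
  refine Eq.mp (congrArg (IsOpen (X := (affineSpace K (PairIndex m n)).carrier)) ?_)
    (h1.inter h2.isOpen_compl)
  ext z
  refine ⟨fun h => ⟨h.1.2, fun h' => h.2 fun w => congrFun (congrFun h' w.1) w.2⟩,
    fun h => ⟨⟨trivial, h.1⟩, fun h' => h.2 (Matrix.ext fun i j => h' (i, j))⟩⟩

/-- A pair (g, Ψ) yields the span of k rows of g and a matrix killing them. The adjugate in place of
the inverse keeps everything polynomial on the affine space, so irreducibility passes to the image.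
-/
theorem exists_isMorphism_parameters :
    ∃ s : parameters (K := K) (m := m) σ → tauHat K m n k,
      IsMorphism (X := (affineSpace K (PairIndex m n)).restrict (parameters σ)) s ∧
        Function.Surjective s := by
  have hreg : ∀ {f : (PairIndex m n → K) → K}, f ∈ (affineSpace K (PairIndex m n)).reg ⊤ →
      (fun z : parameters (K := K) (m := m) σ => f z.1) ∈
        ((affineSpace K (PairIndex m n)).restrict (parameters σ)).reg ⊤ := fun hf =>
    (isMorphism_val (X := affineSpace K (PairIndex m n)) (parameters σ)).reg hf fun _ _ => trivial
  obtain ⟨s, hs, h⟩ := isMorphism_tauHat (X := (affineSpace K (PairIndex m n)).restrict (parameters σ))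
    (p := fun z => (pairLeft z.1).submatrix (fun i => σ (Sum.inl i)) id)
    (q := fun z => killing σ (pairLeft z.1) (pairRight z.1))
    (fun z => (Matrix.linearIndependent_rows_iff_isUnit.mpr ((Matrix.isUnit_iff_isUnit_det _).mpr
      (IsUnit.mk0 _ z.2.1))).comp _ (σ.injective.comp Sum.inl_injective)) (fun z => z.2.2)
    (fun i j => hreg (pairLeft_mem_reg (σ (Sum.inl i)) j)) (fun i j => hreg (killing_mem_reg σ i j))
    fun z => killing_mul σ _ _
  refine ⟨s, hs, fun w => ?_⟩
  obtain ⟨g, hg, hgA⟩ := Matrix.exists_det_ne_zero_extending σ (linearIndependent_frameOf w.1.1)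
  have hgA' : g.submatrix (fun i => σ (Sum.inl i)) id = frameOf w.1.1 := Matrix.ext hgA
  have h1 : Projectivization.rep w.1.2 * (frameOf w.1.1)ᵀ = 0 := by
    refine (Matrix.span_row_le_ker_iff _ _).mp ?_
    exact (span_frameOf w.1.1).trans_le w.2.2
  rw [← hgA'] at h1
  have h2 := killing_eq σ h1
  -- The parameters of a given (Λ, φ): g completes a basis of Λ, and Ψ = Mgᵀ with M representing φ,
  -- as `killing_eq` requires.
  let z : PairIndex m n → K := Sum.elim (fun i => g i.1 i.2)
    fun i => ((Projectivization.rep w.1.2 : Matrix (Fin m) (Fin n) K) * gᵀ) i.1 i.2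
  have hz : z ∈ parameters σ := ⟨hg, by
    refine ne_of_eq_of_ne h2 (smul_ne_zero hg (Projectivization.rep_nonzero _))⟩
  refine ⟨⟨z, hz⟩, Subtype.ext (Prod.ext ((h _).1.trans ?_) ((h _).2.trans ?_))⟩
  · refine Eq.trans ?_ (spanOfFrame_frameOf w.1.1)
    congr 1
    exact Subtype.ext hgA'
  · refine Eq.trans ?_ (Projectivization.mk_rep w.1.2)
    exact (Projectivization.mk_eq_mk_iff' K _ _ _ _).mpr ⟨g.det, h2.symm⟩

theorem nonempty_tauHat (hkl : k + l = n) (hl : 0 < l) (hm : 0 < m) :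
    Nonempty (tauHat K m n k).carrier := by
  obtain ⟨s, -⟩ := exists_isMorphism_free (K := K) (m := m) (finSumFinEquiv.trans (finCongr hkl))
    (⟨0, hm⟩, ⟨0, hl⟩)
  exact ⟨s 0⟩

theorem irreducibleSpace_tauHat [Infinite K] (hkl : k + l = n) (hl : 0 < l) (hm : 0 < m) :
    IrreducibleSpace (tauHat K m n k).carrier := by
  obtain ⟨s, hs, hsurj⟩ := exists_isMorphism_parameters (K := K) (m := m)
    (finSumFinEquiv.trans (finCongr hkl))
  have := irreducibleSpace_affineSpace (K := K) (ι := PairIndex m n)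
  obtain ⟨w⟩ := nonempty_tauHat (K := K) hkl hl hm
  obtain ⟨z, -⟩ := hsurj w
  have h1 : IsIrreducible (X := (affineSpace K (PairIndex m n)).carrier)
      (parameters (finSumFinEquiv.trans (finCongr hkl))) :=
    ⟨⟨z.1, z.2⟩, (PreirreducibleSpace.isPreirreducible_univ (X :=
      (affineSpace K (PairIndex m n)).carrier)).open_subset (isOpen_parameters _)
        (Set.subset_univ _)⟩
  have : IrreducibleSpace ((affineSpace K (PairIndex m n)).restrict
      (parameters (finSumFinEquiv.trans (finCongr hkl)))).carrier := Subtype.irreducibleSpace h1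
  exact irreducibleSpace_of_surjective hs.continuous hsurj

theorem isVariety_tauHat [Infinite K] (hkl : k + l = n) (hl : 0 < l) (hm : 0 < m) :
    IsVariety (tauHat K m n k) :=
  IsVariety.of_charts (irreducibleSpace_tauHat hkl hl hm) isSeparated_tauHat
    (A := (Fin k ⊕ Fin l ≃ Fin n) × (Fin m × Fin l)) (fun p => freeChart K p.1 p.2) fun w => by
      obtain ⟨σ, a, h⟩ := exists_mem_freeChart hkl w
      exact ⟨(σ, a), h⟩

theorem isVariety_tau [Infinite K] (hkl : k + l = n) (hl : 0 < l) (hm : 0 < m) :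
    IsVariety (tau K m n k) :=
  IsVariety.of_charts
    (by
      have := irreducibleSpace_tauHat (K := K) hkl hl hm
      exact irreducibleSpace_of_surjective isMorphism_nu.continuous nu_surjective)
    isSeparated_tau (fun a => tauChart K k a) fun φ => exists_mem_projChart φ.1

end Determinantal

namespace SpaceWithFunctions

variable {K : Type u} [Field K] {X : SpaceWithFunctions K}

/-! ### Nonsingularity -/

namespace AffineChart

open MvPolynomial

variable {ι : Type}

/-- Near a point, a regular function is one fraction of polynomials in the coordinates, valid
wherever its denominator is nonzero on the chart. -/
theorem exists_eq_div [Finite ι] (C : AffineChart X ι) {U : Opens X} {f : X → K} (hf : f ∈ X.reg U)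
    {x : X} (hx : x ∈ C.source) (hxU : x ∈ U) : ∃ P Q : MvPolynomial ι K, eval (C.coord x) Q ≠ 0 ∧
      ∀ y ∈ C.source, eval (C.coord y) Q ≠ 0 → f y = eval (C.coord y) P / eval (C.coord y) Q := by
  have h1 := C.isMorphism_point.reg hf
    (W := ⟨_, U.isOpen.preimage C.isMorphism_point.continuous⟩) fun _ h => h
  have hpt : ∀ y (hy : y ∈ C.source), y ∈ U → C.point ⟨C.coord y, C.coord_mem y hy⟩ ∈ U :=
    fun y hy hyU => by rwa [C.point_coord y hy]
  obtain ⟨V, hV, g, hg, hfg⟩ := h1 ⟨C.coord x, C.coord_mem x hx⟩ (hpt x hx hxU)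
  obtain ⟨_, -, a, ha, b, hb, hbx, hgab⟩ := hg (C.coord x) hV
  obtain ⟨A, hA⟩ := exists_eval_of_mem_polyFun ha
  obtain ⟨B, hB⟩ := exists_eval_of_mem_polyFun hb
  obtain ⟨P, hP, hPU⟩ := C.exists_eval_ne U.isOpen hx hxU
  obtain ⟨Q, hQ, hQV⟩ := exists_eval_ne_of_isOpen V.isOpen hV
  -- The common factor PQ shrinks the nonvanishing locus of the denominator into the open sets where
  -- the fraction is known to represent `f`.
  refine ⟨A * (P * Q), B * (P * Q), ?_, fun y hy hne => ?_⟩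
  · simp only [map_mul]
    exact mul_ne_zero (by rwa [← hB]) (mul_ne_zero hP hQ)
  · simp only [map_mul] at hne ⊢
    obtain ⟨hB0, hPQ⟩ := mul_ne_zero_iff.mp hne
    obtain ⟨hP0, hQ0⟩ := mul_ne_zero_iff.mp hPQ
    have h2 : f (C.point ⟨C.coord y, C.coord_mem y hy⟩) = g (C.coord y) :=
      hfg ⟨C.coord y, C.coord_mem y hy⟩ (hpt y hy (hPU y hy hP0)) (hQV _ hQ0)
    have h2' : f y = g (C.coord y) := (congrArg f (C.point_coord y hy)).symm.trans h2
    have h3 := hgab (C.coord y) (hQV _ hQ0) trivial (by rwa [hB])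
    rw [h2', h3, hA, hB, mul_div_mul_right _ _ hPQ]

/-- Polynomials in the coordinates as germs of regular functions. -/
noncomputable def toLocalRing (C : AffineChart X ι) {x : X} (hx : x ∈ C.source) :
    MvPolynomial ι K →+* X.localRing x :=
  ((Filter.Germ.coeRingHom (nhds x)).comp (RingHom.pi fun y => eval (C.coord y))).codRestrict
    (X.localRing x) fun P => ⟨C.source, hx, _, eval_mem_reg C.coord_mem_reg P, rfl⟩

/-- The local ring is the localization of the polynomial ring at the maximal ideal of the point, and
polynomial rings over a field are regular. -/
theorem isRegularLocalRing [Infinite K] [Finite ι] (C : AffineChart X ι) (hC : C.target = Set.univ)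
    {x : X} (hx : x ∈ C.source) : IsRegularLocalRing (X.localRing x) := by
  let p : Ideal (MvPolynomial ι K) := vanishingIdeal K {C.coord x}
  have hp : ∀ P : MvPolynomial ι K, P ∈ p.primeCompl ↔ eval (C.coord x) P ≠ 0 := fun P =>
    not_congr ((mem_vanishingIdeal_singleton_iff _ _).trans (by rw [aeval_eq_eval]))
  let _ := (C.toLocalRing hx).toAlgebra
  have hloc : IsLocalization.AtPrime (X.localRing x) p := by
    refine ⟨fun Q => ?_, fun g => ?_, fun {P Q} hPQ => ?_⟩
    · have hQ := (hp Q).mp Q.2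
      let V : Opens X := ⟨_, C.isOpen_eval_ne Q.1⟩
      have hV : V ≤ C.source := fun y hy => hy.1
      have hreg := X.inv_mem V _ (X.reg_mono hV (eval_mem_reg C.coord_mem_reg Q.1))
        fun y hy => hy.2
      refine IsUnit.of_mul_eq_one ⟨_, V, ⟨hx, hQ⟩, _, hreg, rfl⟩ (Subtype.ext ?_)
      refine Filter.Germ.coe_eq.mpr ?_
      filter_upwards [V.isOpen.mem_nhds ⟨hx, hQ⟩] with y hy
      exact mul_inv_cancel₀ hy.2
    · obtain ⟨_, U, hU, f, hf, rfl⟩ := g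
      obtain ⟨P, Q, hQ, h⟩ := C.exists_eq_div hf hx hU
      refine ⟨(P, ⟨Q, (hp Q).mpr hQ⟩), Subtype.ext (Filter.Germ.coe_eq.mpr ?_)⟩
      filter_upwards [(C.isOpen_eval_ne Q).mem_nhds ⟨hx, hQ⟩] with y hy
      show f y * eval (C.coord y) Q = eval (C.coord y) P
      rw [h y hy.1 hy.2, div_mul_cancel₀ _ hy.2]
    · have h1 : (fun y => eval (C.coord y) P) =ᶠ[nhds x] fun y => eval (C.coord y) Q :=
        Filter.Germ.coe_eq.mp (congrArg Subtype.val hPQ)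
      obtain ⟨V, hV, hVo, hxV⟩ := eventually_nhds_iff.mp h1
      -- Multiplying by R, which vanishes outside the neighbourhood where P and Q agree, makes them
      -- agree at all points of affine space; since K is infinite, RP = RQ as polynomials.
      obtain ⟨R, hR, hRV⟩ := C.exists_eval_ne hVo hx hxV
      refine ⟨⟨R, (hp R).mpr hR⟩, MvPolynomial.funext fun z => ?_⟩
      have hz : z ∈ C.target := hC ▸ trivial
      have h2 := C.coord_point ⟨z, hz⟩
      simp only [map_mul]
      by_cases h0 : eval z R = 0
      · simp [h0]
      · congr 1
        have := hV (C.point ⟨z, hz⟩) (hRV _ (C.point_mem _) (by rwa [h2]))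
        simpa only [h2] using this
  have := MvPolynomial.isRegularRing_of_isRegularRing (R := K) (ι := ι)
  have := IsRegularRing.isRegularLocalRing_localization p
  exact IsRegularLocalRing.of_ringEquiv
    (IsLocalization.algEquiv p.primeCompl (Localization.AtPrime p) (X.localRing x)).toRingEquiv

end AffineChart

end SpaceWithFunctions

namespace Determinantal

open SpaceWithFunctions

theorem isSmooth_tauHat {K : Type u} [Field K] [Infinite K] {m n k l : ℕ} (hkl : k + l = n) :
    IsSmooth (tauHat K m n k) := fun w => by
  obtain ⟨σ, a, h⟩ := exists_mem_freeChart hkl w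
  exact (freeChart K σ a).isRegularLocalRing rfl h

end Determinantal

/-! ### Specialization of frames along valuations -/

namespace MvPolynomial

variable {K : Type u} [Field K]

theorem exists_forall_eval_eq_zero [IsAlgClosed K] {τ : Type*} [Finite τ]
    {I : Ideal (MvPolynomial τ K)} (hI : I ≠ ⊤) : ∃ x : τ → K, ∀ P ∈ I, eval x P = 0 := by
  obtain ⟨M, hM, hIM⟩ := I.exists_le_maximal hI
  obtain ⟨x, hx⟩ := (isMaximal_iff_eq_vanishingIdeal_singleton (K := K)).mp hM
  refine ⟨x, fun P hP => ?_⟩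
  have := hIM hP
  rwa [hx, mem_vanishingIdeal_singleton_iff, aeval_eq_eval] at this

/-- The exponent and the cleared expression do not depend on `f` or its target field, so one
identity serves both K-points and a generic point. -/
theorem exists_clear_denominators {S τ : Type*} [CommRing S] [Algebra K S] (h : S) (H : τ → S)
    (P : MvPolynomial τ K) : ∃ (N : ℕ) (T : S), ∀ {F : Type u} [Field F] [Algebra K F]
      (f : S →ₐ[K] F), f h ≠ 0 → f T = f h ^ N * aeval (fun i => f (H i) / f h) P := by
  induction P using MvPolynomial.induction_on with
  | C a => exact ⟨0, algebraMap K S a, fun f _ => by simp⟩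
  | add P Q hP hQ =>
    obtain ⟨N, T, hT⟩ := hP
    obtain ⟨N', T', hT'⟩ := hQ
    refine ⟨N + N', h ^ N' * T + h ^ N * T', fun f hf => ?_⟩
    rw [map_add, map_mul, map_mul, hT f hf, hT' f hf, map_add, map_pow, map_pow]
    ring
  | mul_X P i hP =>
    obtain ⟨N, T, hT⟩ := hP
    refine ⟨N + 1, T * H i, fun f hf => ?_⟩
    rw [map_mul, map_mul, hT f hf, aeval_X]
    field_simp
    ring

end MvPolynomial

namespace Matrix

variable {F : Type*} [Field F] {k : ℕ} {ι : Type*}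

/-- Cramer's rule: the numerator is the minor in which column `i` of the selection is replaced by
column `j`. -/
theorem normalizeCols_apply_eq_div (e : Fin k → ι) (A : Matrix (Fin k) ι F) (i : Fin k) (j : ι) :
    A.normalizeCols e i j =
      (A.submatrix id (Function.update e i j)).det / (A.submatrix id e).det := by
  have h1 : A.submatrix id (Function.update e i j) = (A.submatrix id e).updateCol i (A.col j) := by
    ext r s
    by_cases h : s = i
    · subst h; simp
    · simp [h]
  rw [h1, ← cramer_apply, cramer_eq_adjugate_mulVec, normalizeCols, inv_def, Ring.inverse_eq_inv,
    smul_mul, smul_apply, smul_eq_mul, div_eq_inv_mul]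
  rfl

/-- Take the maximal minor of greatest valuation as denominator; every coordinate is another maximal
minor divided by it. This is the valuative criterion for the Grassmannian. -/
theorem exists_normalizeCols_mem [Finite ι] (V : ValuationSubring F) {A : Matrix (Fin k) ι F}
    (hA : ∃ e, (A.submatrix id e).det ≠ 0) :
    ∃ e, (A.submatrix id e).det ≠ 0 ∧ ∀ i j, A.normalizeCols e i j ∈ V := by
  obtain ⟨e₀, h₀⟩ := hA
  have : Nonempty (Fin k → ι) := ⟨e₀⟩
  obtain ⟨e, he⟩ := Finite.exists_max fun e : Fin k → ι => V.valuation (A.submatrix id e).det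
  have hpos : 0 < V.valuation (A.submatrix id e).det :=
    (zero_lt_iff.mpr ((map_ne_zero V.valuation).mpr h₀)).trans_le (he e₀)
  refine ⟨e, (map_ne_zero V.valuation).mp hpos.ne', fun i j => ?_⟩
  rw [normalizeCols_apply_eq_div, ← ValuationSubring.valuation_le_one_iff, map_div₀]
  exact div_le_one_of_le₀ (he _) zero_le

end Matrix

namespace Determinantal

open MvPolynomial

variable {K : Type u} [Field K] {k n : ℕ} {κ : Type}

/-- The matrix part of a point. -/
def framePart {F : Type*} (z : Fin k × Fin n ⊕ κ → F) : Matrix (Fin k) (Fin n) F :=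
  Matrix.of fun i j => z (Sum.inl (i, j))

/-- The point obtained by normalizing the matrix part. -/
noncomputable def renormalize {F : Type*} [Field F] (e : Fin k → Fin n)
    (z : Fin k × Fin n ⊕ κ → F) : Fin k × Fin n ⊕ κ → F :=
  Sum.elim (fun p => (framePart z).normalizeCols e p.1 p.2) fun j => z (Sum.inr j)

theorem exists_clear_renormalize (e : Fin k → Fin n) (P : MvPolynomial (Fin k × Fin n ⊕ κ) K) :
    ∃ (N : ℕ) (h T : MvPolynomial (Fin k × Fin n ⊕ κ) K), ∀ {F : Type u} [Field F] [Algebra K F]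
      (z : Fin k × Fin n ⊕ κ → F), aeval z h = ((framePart z).submatrix id e).det ∧
        (((framePart z).submatrix id e).det ≠ 0 →
          aeval z T = ((framePart z).submatrix id e).det ^ N * aeval (renormalize e z) P) := by
  let A : Matrix (Fin k) (Fin n) (MvPolynomial (Fin k × Fin n ⊕ κ) K) := framePart X
  obtain ⟨N, T, hT⟩ := exists_clear_denominators (A.submatrix id e).det
    (Sum.elim (fun p => (A.submatrix id (Function.update e p.1 p.2)).det)
      fun j => X (Sum.inr j) * (A.submatrix id e).det) P
  refine ⟨N, (A.submatrix id e).det, T, fun {F} _ _ z => ?_⟩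
  have hdet : ∀ e, aeval z (A.submatrix id e).det = ((framePart z).submatrix id e).det := by
    intro e
    rw [AlgHom.map_det]
    congr 1
    ext i j
    simp [A, framePart]
  refine ⟨hdet e, fun h => ?_⟩
  rw [hT (aeval z) (by rwa [hdet]), hdet]
  congr 3
  ext (p | j)
  · simp only [Sum.elim_inl, hdet, renormalize, Matrix.normalizeCols_apply_eq_div]
  · simp only [Sum.elim_inr, map_mul, aeval_X, hdet, renormalize]
    exact mul_div_cancel_right₀ _ h

/-- Completeness of Grassmannians in coordinates: given closed sets `T e` in the products of the
charts of a Grassmannian with `K ^ κ` that correspond to each other under the changes of charts,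
every point in the closure of the projection of one of them to `K ^ κ` is in the projection of
one of them. -/
theorem exists_mem_of_renormalize_mem [IsAlgClosed K] [Finite κ]
    {T : (Fin k → Fin n) → Set (Fin k × Fin n ⊕ κ → K)}
    (hT : ∀ e x, x ∉ T e → ∃ P : MvPolynomial (Fin k × Fin n ⊕ κ) K,
      eval x P ≠ 0 ∧ ∀ y ∈ T e, eval y P = 0)
    (hone : ∀ e, ∀ x ∈ T e, (framePart x).submatrix id e = 1)
    (htrans : ∀ e e', ∀ x ∈ T e, ((framePart x).submatrix id e').det ≠ 0 → renormalize e' x ∈ T e')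
    {e : Fin k → Fin n} {d : κ → K} (hd : ∀ r : MvPolynomial κ K, eval d r ≠ 0 →
      ∃ x ∈ T e, eval (fun j => x (Sum.inr j)) r ≠ 0) :
    ∃ e', ∃ x ∈ T e', ∀ j, x (Sum.inr j) = d j := by
  let I : Ideal (MvPolynomial (Fin k × Fin n ⊕ κ) K) := vanishingIdeal K (T e)
  have hI : ∀ P, P ∈ I ↔ ∀ x ∈ T e, eval x P = 0 := fun P => by
    simp only [I, mem_vanishingIdeal_iff, aeval_eq_eval]
  let ρ : MvPolynomial κ K →ₐ[K] MvPolynomial (Fin k × Fin n ⊕ κ) K := rename Sum.inr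
  have hρ : ∀ x : Fin k × Fin n ⊕ κ → K, ∀ r, eval x (ρ r) = eval (fun j => x (Sum.inr j)) r :=
    fun x r => eval_rename _ _ _
  let M : Submonoid (MvPolynomial κ K) := (nonZeroDivisors K).comap (eval d)
  have hM : ∀ r, r ∈ M ↔ eval d r ≠ 0 := fun r => mem_nonZeroDivisors_iff_ne_zero
  -- By `hd`, no polynomial in the base variables that is nonzero at `d` vanishes on `T e`. So some
  -- prime containing I meets the base polynomials only in polynomials vanishing at `d`.
  obtain ⟨p, hp, hIp, hpM⟩ := I.exists_le_prime_disjoint (M.map ρ) (by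
    rw [Set.disjoint_left]
    rintro _ hP ⟨r, hr, rfl⟩
    obtain ⟨x, hx, hne⟩ := hd r ((hM r).mp hr)
    exact hne ((hρ x r).symm.trans ((hI _).mp hP x hx)))
  let L := FractionRing (MvPolynomial (Fin k × Fin n ⊕ κ) K ⧸ p)
  let π : MvPolynomial (Fin k × Fin n ⊕ κ) K →ₐ[K] L :=
    (IsScalarTower.toAlgHom K (MvPolynomial (Fin k × Fin n ⊕ κ) K ⧸ p) L).comp (Ideal.Quotient.mkₐ K p)
  have hπ : ∀ P, π P = 0 ↔ P ∈ p := fun P => by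
    rw [← Ideal.Quotient.eq_zero_iff_mem]
    exact (IsFractionRing.injective (MvPolynomial (Fin k × Fin n ⊕ κ) K ⧸ p) L).eq_iff'
      (map_zero _)
  -- The generic point of the subvariety cut out by p.
  let z : Fin k × Fin n ⊕ κ → L := fun i => π (X i)
  have hz : π = aeval z := by
    ext i
    simp [z]
  have hzone : (framePart z).submatrix id e = 1 := by
    ext i j
    have h1 : X (Sum.inl (i, e j)) - C ((1 : Matrix (Fin k) (Fin k) K) i j) ∈ I := by
      refine (hI _).mpr fun x hx => ?_
      have := congrFun (congrFun (hone e x hx) i) j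
      rw [map_sub, eval_X, eval_C, sub_eq_zero]
      exact this
    have h2 := (hπ _).mpr (hIp h1)
    rw [map_sub, sub_eq_zero, hz, aeval_X, aeval_C] at h2
    refine Eq.trans h2 ?_
    by_cases h : i = j
    · subst h; simp
    · simp [Matrix.one_apply_ne h]
  -- The renormalized generic point lies on `T e'`: cleared of denominators, an equation of `T e'`
  -- vanishes on `T e`. The extra factor `h` covers the points whose minor is zero, to which
  -- `htrans` does not apply.
  have hvan : ∀ e', ((framePart z).submatrix id e').det ≠ 0 → ∀ P : MvPolynomial _ K,
      (∀ x ∈ T e', eval x P = 0) → aeval (renormalize e' z) P = 0 := by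
    intro e' hdet P hP
    obtain ⟨N, h, Q, hQ⟩ := exists_clear_renormalize e' P
    have h1 : h * Q ∈ I := by
      refine (hI _).mpr fun x hx => ?_
      obtain ⟨h2, h3⟩ := hQ x
      rw [map_mul, ← aeval_eq_eval]
      by_cases h0 : ((framePart x).submatrix id e').det = 0
      · exact mul_eq_zero_of_left (h2.trans h0) _
      · refine mul_eq_zero_of_right _ ((h3 h0).trans ?_)
        rw [aeval_eq_eval]
        exact mul_eq_zero_of_right _ (hP _ (htrans e e' x hx h0))
    have h2 := (hπ _).mpr (hIp h1)
    rw [map_mul, hz, (hQ z).1, (hQ z).2 hdet] at h2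
    simpa [hdet] using h2
  let R : Subring L := (π.comp ρ).toRingHom.range
  let J : Ideal R := (RingHom.ker (eval d)).map (π.comp ρ).toRingHom.rangeRestrict
  -- If 1 were the image of some r with r(d) = 0, then 1 - r would map into p although it is nonzero
  -- at `d`.
  have hJ : J ≠ ⊤ := by
    intro h
    obtain ⟨r, hr, hr1⟩ := (Ideal.mem_map_iff_of_surjective _
      (π.comp ρ).toRingHom.rangeRestrict_surjective).mp ((Ideal.eq_top_iff_one _).mp h)
    have h1 : π (ρ (1 - r)) = 0 := by
      have h2 : π (ρ r) = 1 := congrArg Subtype.val hr1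
      rw [map_sub, map_sub, h2, map_one, map_one, sub_self]
    refine Set.disjoint_left.mp hpM ((hπ _).mp h1) ⟨1 - r, (hM _).mpr ?_, rfl⟩
    rw [map_sub, RingHom.mem_ker.mp hr, map_one, sub_zero]
    exact one_ne_zero
  -- A valuation ring of L containing the base coordinates in which the elements of J are nonunits,
  -- so the base coordinates specialize to `d`.
  obtain ⟨V, hRV, hJV⟩ := Ideal.image_subset_nonunits_valuationSubring J hJ
  obtain ⟨e', hdet, hV⟩ := Matrix.exists_normalizeCols_mem V (A := framePart z) ⟨e, by
    rw [hzone, Matrix.det_one]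
    exact one_ne_zero⟩
  have hmem : ∀ P : MvPolynomial (Fin k × Fin n ⊕ κ) K, aeval (renormalize e' z) P ∈ V := by
    intro P
    induction P using MvPolynomial.induction_on with
    | C a => exact hRV ⟨C a, by simp⟩
    | add P Q hP hQ => rw [map_add]; exact V.add_mem _ _ hP hQ
    | mul_X P i hP =>
      rw [map_mul, aeval_X]
      refine V.mul_mem _ _ hP ?_
      rcases i with p | j
      · exact hV p.1 p.2
      · exact hRV ⟨X j, by simp [ρ, z, renormalize]⟩
  let θ : MvPolynomial (Fin k × Fin n ⊕ κ) K →+* V :=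
    (aeval (renormalize e' z)).toRingHom.codRestrict V hmem
  let Q : Ideal (MvPolynomial (Fin k × Fin n ⊕ κ) K) := (IsLocalRing.maximalIdeal V).comap θ
  have hQ : ∀ P, aeval (renormalize e' z) P ∈ V.nonunits → P ∈ Q := by
    intro P hP
    refine Ideal.mem_comap.mpr ?_
    exact (V.valuation_lt_one_iff (θ P)).mpr (V.mem_nonunits_iff.mp hP)
  -- The residue field of V may be larger than K, so a K-point is taken on the ideal of polynomials
  -- specializing to zero.
  obtain ⟨x, hx⟩ := exists_forall_eval_eq_zero (Ideal.comap_ne_top θ (IsLocalRing.maximalIdeal.isMaximal V).ne_top)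
  -- The equations of `T e'` are zero at the generic point, and the differences between the base
  -- variables and `d` are nonunits; both therefore vanish at x.
  refine ⟨e', x, by_contra fun hxT => ?_, fun j => ?_⟩
  · obtain ⟨P, hP, hPT⟩ := hT e' x hxT
    refine hP (hx P (hQ P ?_))
    rw [hvan e' hdet P hPT]
    exact V.nonunits.zero_mem
  · have h1 : X (Sum.inr j) - C (d j) ∈ Q := by
      refine hQ _ (hJV ⟨_, Ideal.mem_map_of_mem _ (x := X j - C (d j)) ?_, ?_⟩)
      · simp [RingHom.mem_ker]
      · show π (ρ (X j - C (d j))) = _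
        simp [ρ, z, renormalize, algHom_C]
    have := hx _ h1
    rwa [map_sub, eval_X, eval_C, sub_eq_zero] at this

end Determinantal

namespace Determinantal

open SpaceWithFunctions MvPolynomial

variable {K : Type u} [Field K] {W X Y : SpaceWithFunctions K} {m n k : ℕ}

/-! ### Properness -/

/-- Applies the coordinate form of completeness to the traces of `C` on the products of Grassmannian
charts with one chart around `y`. -/
theorem mem_image_snd_of_mem_closure [IsAlgClosed K] {κ : Type} [Finite κ] (D : AffineChart Y κ)
    {C : Set ((grassmannian K k n).prod Y).carrier} (hC : IsClosed C) {y : Y} (hy : y ∈ D.source)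
    (hyC : y ∈ closure ((fun w : (grassmannian K k n).carrier × Y.carrier => w.2) '' C)) :
    y ∈ (fun w : (grassmannian K k n).carrier × Y.carrier => w.2) '' C := by
  let E := fun e : Fin k → Fin n => (grassChart K e).prod D
  -- There are finitely many Grassmannian charts, so the closure of the union of projections is the
  -- union of their closures.
  obtain ⟨e, he⟩ : ∃ e, y ∈ closure ((fun w : (grassmannian K k n).carrier × Y.carrier => w.2) ''
      {w | w ∈ C ∧ w.1 ∈ (grassChart K e).source}) := by
    have h1 : (fun w : (grassmannian K k n).carrier × Y.carrier => w.2) '' C ⊆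
        ⋃ e, (fun w : (grassmannian K k n).carrier × Y.carrier => w.2) ''
          {w | w ∈ C ∧ w.1 ∈ (grassChart K e).source} := by
      rintro _ ⟨w, hw, rfl⟩
      obtain ⟨e, he⟩ := exists_mem_grassChart w.1
      exact Set.mem_iUnion.mpr ⟨e, w, ⟨hw, he⟩, rfl⟩
    have h2 := closure_mono h1 hyC
    rw [closure_iUnion_of_finite] at h2
    exact Set.mem_iUnion.mp h2
  have hcoord : ∀ e' (w : ((grassmannian K k n).prod Y).carrier), w ∈ C → w ∈ (E e').source →
      (E e').coord w ∈ ((E e').restrict hC).target := fun e' w hw hwe =>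
    ((E e').restrict hC).coord_mem ⟨w, hw⟩ hwe
  obtain ⟨e', x, hx, hxd⟩ := exists_mem_of_renormalize_mem
    (T := fun e => ((E e).restrict hC).target) (e := e) (d := D.coord y)
    (fun e x hx => exists_eval_of_notMem_isClosed ((E e).restrict hC).isClosed_target hx)
    (fun e x hx => by
      obtain ⟨h, -⟩ := hx
      ext i j
      exact h.1 i j)
    (fun e e' x hx hdet => by
      obtain ⟨h, hxC⟩ := hx
      have h1 : (E e).point ⟨x, h⟩ ∈ (E e').source :=
        ⟨(det_frameOf_spanOfFrame_ne_zero_iff e' _).mpr hdet, (D.point_mem _)⟩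
      have h2 := hcoord e' _ hxC h1
      refine Eq.mp (congrArg (· ∈ ((E e').restrict hC).target) ?_) h2
      ext (p | j)
      · exact congrFun (congrFun (normalizeCols_frameOf_spanOfFrame e' _) p.1) p.2
      · exact congrFun (D.coord_point ⟨_, h.2⟩) j)
    (fun r hr => by
      obtain ⟨_, h1, w, ⟨hwC, hwe⟩, rfl⟩ := mem_closure_iff.mp he _ (D.isOpen_eval_ne r) ⟨hy, hr⟩
      exact ⟨(E e).coord w, hcoord e w hwC ⟨hwe, h1.1⟩, h1.2⟩)
  obtain ⟨h, hxC⟩ := hx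
  refine ⟨_, hxC, D.coord_injOn (D.point_mem _) hy ((D.coord_point ⟨_, h.2⟩).trans (funext hxd))⟩

/-- Every point is in an affine chart. -/
def HasCharts (X : SpaceWithFunctions K) : Prop :=
  ∀ x : X, ∃ (κ : Type) (_ : Finite κ) (D : AffineChart X κ), x ∈ D.source

theorem HasCharts.prod (hX : HasCharts X) (hY : HasCharts Y) : HasCharts (X.prod Y) := fun w => by
  obtain ⟨ι, _, C, hC⟩ := hX w.1
  obtain ⟨κ, _, D, hD⟩ := hY w.2
  exact ⟨ι ⊕ κ, inferInstance, C.prod D, hC, hD⟩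

theorem hasCharts_of_isVariety (hX : IsVariety X) : HasCharts X := fun x => by
  obtain ⟨r, U, hU, h⟩ := hX.cover
  obtain ⟨i, hi⟩ := hU x
  obtain ⟨N, C, hC⟩ := (h i).exists_chart
  exact ⟨Fin N, inferInstance, C, hC ▸ hi⟩

theorem hasCharts_tau : HasCharts (tau K m n k) := fun φ => by
  obtain ⟨a, ha⟩ := exists_mem_projChart φ.1
  exact ⟨_, inferInstance, tauChart K k a, ha⟩

/-- Closed subvarieties of the product of a Grassmannian and a variety have closed projections. -/
theorem isClosedMap_of_isClosed [IsAlgClosed K] (hY : HasCharts Y)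
    {S : Set ((grassmannian K k n).prod Y).carrier} (hS : IsClosed S) {p : W → Y}
    {r : S → W}
    (hr : IsMorphism (X := ((grassmannian K k n).prod Y).restrict S) r)
    (hp : ∀ s : S, p (r s) = s.1.2)
    (hW : ∀ w, ∃ s, r s = w) : IsClosedMap p := by
  intro C hC
  have h1 := hS.isClosedEmbedding_subtypeVal.isClosedMap _ (hC.preimage hr.continuous)
  have h2 : (fun w : (grassmannian K k n).carrier × Y.carrier => w.2) ''
      (Subtype.val '' (r ⁻¹' C)) = p '' C := by
    ext y
    constructor
    · rintro ⟨_, ⟨s, hs, rfl⟩, rfl⟩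
      exact ⟨r s, hs, hp s⟩
    · rintro ⟨w, hw, rfl⟩
      obtain ⟨s, rfl⟩ := hW w
      exact ⟨s.1, ⟨s, hw, rfl⟩, (hp s).symm⟩
  rw [← h2]
  refine isClosed_of_closure_subset fun y hy => ?_
  obtain ⟨κ, _, D, hD⟩ := hY y
  exact mem_image_snd_of_mem_closure D h1 hD hy

theorem isClosedMap_nu [IsAlgClosed K] : IsClosedMap (nu K m n k) := by
  have hg : IsMorphism (X := (grassmannian K k n).prod (tau K m n k)) (Y := grassProj K m n k)
      (fun w => (w.1, w.2.1)) :=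
    isMorphism_fst.prodMk ((isMorphism_val (X := projMatrix K m n) _).comp isMorphism_snd)
  exact isClosedMap_of_isClosed hasCharts_tau (isClosed_tauHatSet.preimage hg.continuous)
    (p := nu K m n k)
    (r := fun s => ⟨(s.1.1, s.1.2.1), s.2⟩)
    (IsMorphism.codRestrict (X := grassProj K m n k) (hg.comp (isMorphism_val _)) fun s => s.2)
    (fun s => rfl) fun w => ⟨⟨(w.1.1, nu K m n k w), w.2⟩, rfl⟩

/-- The product of the incidence variety with Z is a closed subset of the Grassmannian times (τ ×
Z), and the map is the projection that forgets Λ. -/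
theorem isProper_nu [IsAlgClosed K] : IsProper (nu K m n k) := by
  intro Z hZ
  have hg : IsMorphism (X := (grassmannian K k n).prod ((tau K m n k).prod Z))
      (Y := grassProj K m n k) (fun w => (w.1, w.2.1.1)) :=
    isMorphism_fst.prodMk ((isMorphism_val (X := projMatrix K m n) _).comp
      (isMorphism_fst.comp isMorphism_snd))
  exact isClosedMap_of_isClosed (hasCharts_tau.prod (hasCharts_of_isVariety hZ))
    (isClosed_tauHatSet.preimage hg.continuous)
    (W := (tauHat K m n k).prod Z)
    (p := Prod.map (nu K m n k) id)
    (r := fun s => (⟨(s.1.1, s.1.2.1.1), s.2⟩, s.1.2.2))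
    ((IsMorphism.codRestrict (X := grassProj K m n k) (hg.comp (isMorphism_val _))
      fun s => s.2).prodMk (isMorphism_snd.comp (isMorphism_snd.comp (isMorphism_val _))))
    (fun s => rfl) fun w => ⟨⟨(w.1.1.1, (nu K m n k w.1, w.2)), w.1.2⟩, rfl⟩

end Determinantal

namespace Determinantal

open SpaceWithFunctions
open scoped Matrix

variable {K : Type u} [Field K] {m n k l : ℕ}

/-! ### Birationality -/

/-- The matrix `B` such that the rows of `freeFrame σ B` are killed by the rows `f` of `M`. -/
noncomputable def kernelBlock (σ : Fin k ⊕ Fin l ≃ Fin n) (f : Fin l → Fin m)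
    (M : Matrix (Fin m) (Fin n) K) : Matrix (Fin k) (Fin l) K :=
  (-((M.submatrix f fun j => σ (Sum.inr j))⁻¹ * M.submatrix f fun i => σ (Sum.inl i)))ᵀ

/-- The rows `f` of M give l equations with invertible right block, hence the right part of F is its
left part times the kernel block. Thus F = F₀ (1 | B), and F₀ is invertible because F has
independent rows. -/
theorem span_freeFrame_kernelBlock {σ : Fin k ⊕ Fin l ≃ Fin n} {f : Fin l → Fin m}
    {M : Matrix (Fin m) (Fin n) K} (hM : (M.submatrix f fun j => σ (Sum.inr j)).det ≠ 0)
    {F : Matrix (Fin k) (Fin n) K} (hF : LinearIndependent K F.row) (h : M * Fᵀ = 0) :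
    Submodule.span K (Set.range (freeFrame σ (kernelBlock σ f M)).row) =
      Submodule.span K (Set.range F.row) := by
  have h1 : M.submatrix f (fun i => σ (Sum.inl i)) * (F.submatrix id fun i => σ (Sum.inl i))ᵀ +
      M.submatrix f (fun j => σ (Sum.inr j)) * (F.submatrix id fun j => σ (Sum.inr j))ᵀ = 0 := by
    ext r i
    have := congrFun (congrFun h (f r)) i
    rw [Matrix.mul_apply, ← σ.sum_comp, Fintype.sum_sum_type] at this
    simpa [Matrix.mul_apply] using this
  have h2 : (F.submatrix id fun j => σ (Sum.inr j)) =
      (F.submatrix id fun i => σ (Sum.inl i)) * kernelBlock σ f M := by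
    refine Matrix.transpose_injective ?_
    have h3 := congrArg (fun N => (M.submatrix f fun j => σ (Sum.inr j))⁻¹ * N)
      (eq_neg_of_add_eq_zero_right h1)
    simp only [← Matrix.mul_assoc, Matrix.nonsing_inv_mul _ hM.isUnit, Matrix.one_mul] at h3
    rw [h3, kernelBlock, Matrix.transpose_mul, Matrix.transpose_transpose, Matrix.neg_mul,
      Matrix.mul_neg, Matrix.mul_assoc]
  have h3 : F = (F.submatrix id fun i => σ (Sum.inl i)) * freeFrame σ (kernelBlock σ f M) := by
    ext i j
    obtain ⟨s, rfl⟩ := σ.surjective j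
    rcases s with i' | j
    · simp [Matrix.mul_apply, Matrix.one_apply]
    · have := congrFun (congrFun h2 i) j
      simpa [Matrix.mul_apply] using this
  have h4 : LinearIndependent K (F.submatrix id fun i => σ (Sum.inl i)).row := by
    refine LinearIndependent.of_comp (Matrix.vecMulLinear (freeFrame σ (kernelBlock σ f M))) ?_
    convert! hF using 1
    conv_rhs => rw [h3]
    ext i j
    rfl
  have h5 := (Matrix.isUnit_iff_isUnit_det _).mp (Matrix.linearIndependent_rows_iff_isUnit.mp h4)
  conv_rhs => rw [h3]
  exact (Matrix.span_row_mul h5 _).symm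

variable (σ : Fin k ⊕ Fin l ≃ Fin n) (f : Fin l → Fin m) (j₀ : Fin l)

/-- The index of an entry of a block. -/
abbrev blockEntry : Fin m × Fin n := (f j₀, σ (Sum.inr j₀))

theorem tau_normalizedRep_mem_reg (a : Fin m × Fin n) (i : Fin m) (j : Fin n) :
    (fun φ : (tau K m n k).carrier => normalizedRep a φ.1 i j) ∈
      (tau K m n k).reg (tauChart K k a).source :=
  (tauChart K k a).coord_mem_reg (i, j)

/-- The open subset of `τ_{m,n,k}` on which a minor of size `n - k` does not vanish. -/
noncomputable def minorOpen (K : Type u) [Field K] {m n k l : ℕ} (σ : Fin k ⊕ Fin l ≃ Fin n)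
    (f : Fin l → Fin m) (j₀ : Fin l) : Opens (tau K m n k) :=
  ⟨_, (tau K m n k).isOpen_ne (tauChart K k (blockEntry σ f j₀)).source
    (fun φ => ((normalizedRep (blockEntry σ f j₀) φ.1).submatrix f fun j => σ (Sum.inr j)).det)
    (det_mem fun i j => tau_normalizedRep_mem_reg _ (f i) (σ (Sum.inr j)))⟩

/-- The inverse image of `minorOpen` in the incidence variety. -/
noncomputable def minorOpenHat (K : Type u) [Field K] {m n k l : ℕ} (σ : Fin k ⊕ Fin l ≃ Fin n)
    (f : Fin l → Fin m) (j₀ : Fin l) : Opens (tauHat K m n k) :=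
  ⟨_, (minorOpen K σ f j₀).isOpen.preimage isMorphism_nu.continuous⟩

variable {σ f j₀}

theorem eq_span_of_mem_minorOpen {w : (tauHat K m n k).carrier}
    (hw : nu K m n k w ∈ minorOpen K σ f j₀) : w.1.1 = spanOfFrame K k n
      ⟨_, freeFrame_linearIndependent σ (kernelBlock σ f (normalizedRep (blockEntry σ f j₀) w.1.2))⟩ := by
  refine Subtype.ext (Eq.symm ?_)
  refine Eq.trans ?_ (span_frameOf w.1.1)
  refine span_freeFrame_kernelBlock hw.2 (linearIndependent_frameOf _)
    ((Matrix.span_row_le_ker_iff _ _).mp ?_)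
  rw [ker_normalizedRep hw.1]
  exact (span_frameOf w.1.1).trans_le w.2.2

theorem minorOpenHat_le_freeChart_source :
    (minorOpenHat K σ f j₀ : Opens (tauHat K m n k)) ≤ (freeChart K σ (f j₀, j₀)).source :=
  fun _ hw => ⟨det_frameOf_ne_zero_of_eq_span (eq_span_of_mem_minorOpen hw)
    (freeFrame_submatrix σ _), hw.1⟩

theorem nonempty_minorOpenHat (hf : Function.Injective f) :
    ((minorOpenHat K σ f j₀ : Opens (tauHat K m n k)) : Set (tauHat K m n k).carrier).Nonempty := by
  -- The simplest matrix of rank l: an identity block in the rows `f`, with B = 0.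
  let Φ : Matrix (Fin m) (Fin l) K := Matrix.of fun r j => if r = f j then 1 else 0
  have h1 : (freeMatrix σ 0 Φ).submatrix f (fun j => σ (Sum.inr j)) = 1 := by
    ext i j
    simp [Φ, Matrix.one_apply, hf.eq_iff]
  have h2 : freeMatrix σ 0 Φ (f j₀) (σ (Sum.inr j₀)) = 1 := by simp [Φ]
  have h3 : freeMatrix σ 0 Φ ≠ 0 := fun h => one_ne_zero (h2.symm.trans (by rw [h]; rfl))
  have h4 : (spanOfFrame K k n ⟨_, freeFrame_linearIndependent σ 0⟩).1 ≤
      ker (Projectivization.mk K _ h3) := by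
    rw [ker_mk]
    exact (Matrix.span_row_le_ker_iff _ _).mpr (freeMatrix_mul σ 0 Φ)
  refine ⟨⟨(_, _), mem_tauSet_of_le h4, h4⟩, (rep_apply_ne_zero_iff (blockEntry σ f j₀) _ h3).mpr
    (ne_of_eq_of_ne h2 one_ne_zero), ?_⟩
  have h5 : normalizedRep (blockEntry σ f j₀) (Projectivization.mk K _ h3) = freeMatrix σ 0 Φ :=
    normalizedRep_of_eq_mk rfl h2
  refine ne_of_eq_of_ne ?_ one_ne_zero
  exact (congrArg (fun M : Matrix (Fin m) (Fin n) K =>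
    (M.submatrix f fun j => σ (Sum.inr j)).det) h5).trans ((congrArg _ h1).trans Matrix.det_one)

theorem mapsTo_minorOpen : Set.MapsTo (nu K m n k)
    (minorOpenHat K σ f j₀ : Set (tauHat K m n k).carrier) (minorOpen K σ f j₀) := fun _ h => h

theorem kernelBlock_mem_reg (i : Fin k) (j : Fin l) :
    (fun φ : (tau K m n k).carrier =>
      kernelBlock σ f (normalizedRep (blockEntry σ f j₀) φ.1) i j) ∈
        (tau K m n k).reg (minorOpen K σ f j₀) := by
  have h : ∀ i j, (fun φ : (tau K m n k).carrier =>
      normalizedRep (blockEntry σ f j₀) φ.1 i j) ∈ (tau K m n k).reg (minorOpen K σ f j₀) :=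
    fun i j => (tau K m n k).reg_mono (U := (tauChart K k (blockEntry σ f j₀)).source)
      (fun _ (hφ : _ ∧ _) => hφ.1) (tau_normalizedRep_mem_reg _ i j)
  exact neg_mem (matrix_mul_mem
    (M := fun φ : (tau K m n k).carrier =>
      ((normalizedRep (blockEntry σ f j₀) φ.1).submatrix f fun j => σ (Sum.inr j))⁻¹)
    (N := fun φ : (tau K m n k).carrier =>
      (normalizedRep (blockEntry σ f j₀) φ.1).submatrix f fun i => σ (Sum.inl i))
    (matrix_inv_mem (fun i j => h (f i) (σ (Sum.inr j))) fun _ hφ => hφ.2)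
    (fun i j => h (f i) (σ (Sum.inl j))) j i)

/-- The inverse sends φ to the row space of (1 | B), where the kernel block B is regular in φ by
Cramer's rule. -/
theorem isIso_nu_restrict : IsIso
    (X := (tauHat K m n k).restrict (minorOpenHat K σ f j₀ : Set (tauHat K m n k).carrier))
    (Y := (tau K m n k).restrict (minorOpen K σ f j₀ : Set (tau K m n k).carrier))
    (mapsTo_minorOpen.restrict (nu K m n k) _ _) := by
  let B : ↥(minorOpen K σ f j₀ : Set (tau K m n k).carrier) → Matrix (Fin k) (Fin n) K := fun φ =>
    freeFrame σ (kernelBlock σ f (normalizedRep (blockEntry σ f j₀) φ.1.1))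
  have hB : ∀ i j, (fun φ => B φ i j) ∈
      ((tau K m n k).restrict (minorOpen K σ f j₀ : Set (tau K m n k).carrier)).reg ⊤ := by
    intro i j
    obtain ⟨s, rfl⟩ := σ.surjective j
    rcases s with i' | j
    · simp only [B, freeFrame_inl]
      exact const_mem_reg (X := (tau K m n k).restrict
        (minorOpen K σ f j₀ : Set (tau K m n k).carrier)) ⊤ _
    · simp only [B, freeFrame_inr]
      exact (isMorphism_val (X := tau K m n k) _).reg (kernelBlock_mem_reg i j) fun φ _ => φ.2
  have h1 := (isMorphism_grassmannian (fun φ => freeFrame_linearIndependent σ _) hB).prodMk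
    ((isMorphism_val (X := projMatrix K m n) (tauSet K m n k)).comp
      (isMorphism_val (X := tau K m n k) (minorOpen K σ f j₀ : Set (tau K m n k).carrier)))
  -- Any preimage of φ under ν has this subspace as its first component, so incidence comes for free
  -- from surjectivity.
  have h2 : ∀ φ : (minorOpen K σ f j₀ : Set (tau K m n k).carrier),
      (spanOfFrame K k n ⟨B φ, freeFrame_linearIndependent σ _⟩, φ.1.1) ∈ tauHatSet K m n k := by
    intro φ
    obtain ⟨w, hw⟩ := nu_surjective φ.1
    have hφ : φ.1.1 = w.1.2 := congrArg Subtype.val hw.symm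
    have h3 := eq_span_of_mem_minorOpen (w := w) (hw ▸ φ.2)
    have h4 : spanOfFrame K k n ⟨B φ, freeFrame_linearIndependent σ _⟩ = w.1.1 := by
      rw [h3]
      simp only [B, hφ]
      rfl
    rw [h4, hφ]
    exact w.2
  have h3 := (h1.codRestrict h2).codRestrict (X := tauHat K m n k)
    (S := (minorOpenHat K σ f j₀ : Set (tauHat K m n k).carrier)) fun φ => φ.2
  refine ⟨isMorphism_nu.restrict mapsTo_minorOpen, _, h3, fun w => Subtype.ext (Subtype.ext
    (Prod.ext ?_ rfl)), fun φ => rfl⟩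
  exact (eq_span_of_mem_minorOpen w.2).symm

theorem isBirational_nu (hkl : k + l = n) (hl : 0 < l) (hlm : l ≤ m) :
    IsBirational (nu K m n k) := by
  have h := nonempty_minorOpenHat (K := K) (σ := finSumFinEquiv.trans (finCongr hkl))
    (j₀ := ⟨0, hl⟩) (Fin.castLE_injective hlm)
  refine ⟨_, minorOpen _ _ _ _, h, ?_, mapsTo_minorOpen, isIso_nu_restrict⟩
  obtain ⟨w, hw⟩ := h
  exact ⟨_, hw⟩

end Determinantal

/-! ### Krull dimension of topological spaces -/

section KrullDimension

variable {X Y : Type*} [TopologicalSpace X] [TopologicalSpace Y]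

open Order in
-- Take a point of the smallest member of a chain and an open set U around it: every member meets U,
-- and the traces on U form a chain of the same length.
theorem topologicalKrullDim_le_of_cover {d : WithBot ℕ∞}
    (h : ∀ x : X, ∃ U : Set X, IsOpen U ∧ x ∈ U ∧ topologicalKrullDim U ≤ d) :
    topologicalKrullDim X ≤ d := by
  refine iSup_le fun p => ?_
  obtain ⟨x, hx⟩ := p.head.isIrreducible.nonempty
  obtain ⟨U, hU, hxU, hd⟩ := h x
  refine le_trans ?_ hd
  have hmem : ∀ i, (((↑) : U → X) ⁻¹' (p i : Set X)).Nonempty := fun i =>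
    ⟨⟨x, hxU⟩, (p.monotone (Fin.zero_le i) : p.head ≤ p i) hx⟩
  let q : LTSeries {V : IrreducibleCloseds X | (((↑) : U → X) ⁻¹' (V : Set X)).Nonempty} :=
    LTSeries.mk p.length (fun i => ⟨p i, hmem i⟩) fun i j hij => p.strictMono hij
  let e := IrreducibleCloseds.orderIsoOfIsOpenEmbedding ((↑) : U → X) hU.isOpenEmbedding_subtypeVal
  exact LTSeries.length_le_krullDim (q.map e.symm e.symm.strictMono)

/-- The finitely many irreducible components of S have closed images covering Z; since Z is
irreducible, one of them is all of Z. -/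
theorem IsClosedMap.exists_irreducibleCloseds_image_eq [NoetherianSpace X] {f : X → Y}
    (hc : IsClosedMap f) {S : Set X} (hS : IsClosed S) {Z : Set Y}
    (hZ : IsIrreducible Z) (h : f '' S = Z) :
    ∃ W : IrreducibleCloseds X, (W : Set X) ⊆ S ∧ f '' W = Z := by
  classical
  obtain ⟨C, hCf, hCc, hCi, rfl⟩ := NoetherianSpace.exists_finite_set_isClosed_irreducible hS
  obtain ⟨z, hz, hZz⟩ := isIrreducible_iff_sUnion_isClosed.mp hZ (hCf.toFinset.image (f '' ·))
    (by simpa using fun t ht => hc t (hCc t ht))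
    (by
      rw [← h]
      rintro _ ⟨x, ⟨t, ht, hx⟩, rfl⟩
      exact ⟨f '' t, by simpa using ⟨t, ht, rfl⟩, x, hx, rfl⟩)
  obtain ⟨t, ht, rfl⟩ := Finset.mem_image.mp hz
  have ht' := hCf.mem_toFinset.mp ht
  refine ⟨⟨t, hCi t ht', hCc t ht'⟩, Set.subset_sUnion_of_mem ht', Set.Subset.antisymm ?_ hZz⟩
  rw [← h]
  exact Set.image_mono (Set.subset_sUnion_of_mem ht')

open Order in
-- Chains lift downwards: if W maps onto Z and Z' is smaller than Z, some irreducible closed subset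
-- of W lying over Z' maps onto it, and it is strictly smaller than W. Heights are compared by
-- Noetherian induction on W.
theorem IsClosedMap.topologicalKrullDim_le [NoetherianSpace X] {f : X → Y} (hf : Continuous f)
    (hc : IsClosedMap f) (hs : Function.Surjective f) :
    topologicalKrullDim Y ≤ topologicalKrullDim X := by
  have hwf : WellFounded fun V W : IrreducibleCloseds X => V < W :=
    Subrelation.wf (fun {V W} h => h) (InvImage.wf
      (fun W : IrreducibleCloseds X => (⟨W, W.isClosed⟩ : Closeds X)) wellFounded_lt)
  have key : ∀ (W : IrreducibleCloseds X) (Z : IrreducibleCloseds Y), f '' W = Z →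
      height Z ≤ height W := by
    intro W
    induction W using hwf.induction with
    | _ W ih =>
      intro Z hWZ
      rw [height_eq_iSup_lt_height]
      refine iSup₂_le fun Z' hZ' => ?_
      obtain ⟨W', hW', h⟩ := hc.exists_irreducibleCloseds_image_eq
        (W.isClosed.inter (Z'.isClosed.preimage hf)) Z'.isIrreducible (by
          rw [Set.image_inter_preimage, hWZ, Set.inter_eq_right]
          exact hZ'.le)
      have hlt : W' < W := by
        refine lt_of_le_of_ne (fun x hx => (hW' hx).1) ?_
        rintro rfl
        exact hZ'.ne (SetLike.coe_injective (h.symm.trans hWZ))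
      exact (add_le_add_left (ih W' hlt Z' h) 1).trans (height_add_one_le hlt)
  refine (krullDim_eq_iSup_height (α := IrreducibleCloseds Y)).trans_le (iSup_le fun Z => ?_)
  obtain ⟨W, -, hW⟩ := hc.exists_irreducibleCloseds_image_eq (Z.isClosed.preimage hf)
    Z.isIrreducible (Set.image_preimage_eq _ hs)
  refine le_trans (WithBot.coe_le_coe.mpr (key W Z hW)) ?_
  exact (le_iSup (fun W : IrreducibleCloseds X => ((height W : ℕ∞) : WithBot ℕ∞)) W).trans_eq
    krullDim_eq_iSup_height.symm

end KrullDimension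

/-! ### Dimensions of affine spaces and of charts. -/

namespace SpaceWithFunctions

variable {K : Type u} [Field K] {X Y : SpaceWithFunctions K} {ι : Type}

/-- The closed set of points of affine space with the same coordinates as `v` from `i` on. -/
def flagSet {N : ℕ} (e : ι ≃ Fin N) (v : ι → K) (i : ℕ) : Set (ι → K) :=
  {z | ∀ j, i ≤ e j → z j = v j}

theorem isClosed_flagSet {N : ℕ} (e : ι ≃ Fin N) (v : ι → K) (i : ℕ) :
    IsClosed (X := (affineSpace K ι).carrier) (flagSet e v i) := by
  have := isClosed_setOf_eq (X := affineSpace K ι) (J := {j // i ≤ e j})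
    (f := fun j z => z j.1) (g := fun j _ => v j.1) (fun j => coord_mem_reg j.1 ⊤)
    fun j => const_mem_reg _ _
  refine Eq.mp (congrArg (IsClosed (X := (affineSpace K ι).carrier)) ?_) this
  ext z
  exact ⟨fun h j hj => h ⟨j, hj⟩, fun h j => h j.1 j.2⟩

theorem isIrreducible_flagSet [Infinite K] [Finite ι] {N : ℕ} (e : ι ≃ Fin N) (v : ι → K) (i : ℕ) :
    IsIrreducible (X := (affineSpace K ι).carrier) (flagSet e v i) := by
  classical
  have h1 : IsMorphism (X := affineSpace K ι) (Y := affineSpace K ι)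
      (fun (z : ι → K) j => if i ≤ e j then v j else z j) := isMorphism_affineSpace fun j => by
    by_cases h : i ≤ e j
    · simp only [if_pos h]
      exact const_mem_reg (X := affineSpace K ι) ⊤ _
    · simp only [if_neg h]
      exact coord_mem_reg j ⊤
  have := irreducibleSpace_affineSpace (K := K) (ι := ι)
  have h2 := (irreducibleSpace_def (affineSpace K ι).carrier |>.mp this).image _
    h1.continuous.continuousOn
  refine Eq.mp (congrArg (IsIrreducible (X := (affineSpace K ι).carrier)) ?_) h2
  ext z
  constructor
  · rintro ⟨z, -, rfl⟩ j hj
    exact if_pos hj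
  · intro hz
    refine ⟨z, trivial, funext fun j => ?_⟩
    by_cases h : i ≤ e j
    · exact (if_pos h).trans (hz j h).symm
    · exact if_neg h

theorem flagSet_ssubset {N : ℕ} (e : ι ≃ Fin N) (v : ι → K) {i i' : ℕ} (h : i < i') (hi : i < N) :
    flagSet e v i ⊂ flagSet e v i' := by
  classical
  refine ⟨fun z hz j hj => hz j (h.le.trans hj), fun hsub => ?_⟩
  -- Moving the coordinate numbered `i` by 1 leaves the smaller member of the flag but stays in the
  -- larger.
  have h1 : Function.update v (e.symm ⟨i, hi⟩) (v (e.symm ⟨i, hi⟩) + 1) ∈ flagSet e v i' := by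
    intro j hj
    refine Function.update_of_ne ?_ _ _
    rintro rfl
    rw [e.apply_symm_apply] at hj
    exact absurd hj (not_le.mpr h)
  have h2 := hsub h1 (e.symm ⟨i, hi⟩) (by rw [e.apply_symm_apply])
  rw [Function.update_self] at h2
  exact one_ne_zero (left_eq_add.mp h2.symm)

/-- The flag of coordinate subspaces through a point of O consists of irreducible closed sets that
all meet O, so its trace on O is a chain of full length. -/
theorem le_topologicalKrullDim_of_isOpen [Infinite K] [Finite ι]
    {O : Set (affineSpace K ι).carrier} (hO : IsOpen O) (hne : O.Nonempty) :
    (Nat.card ι : WithBot ℕ∞) ≤ topologicalKrullDim O := by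
  obtain ⟨v, hv⟩ := hne
  have e := Finite.equivFin ι
  let e' := IrreducibleCloseds.orderIsoOfIsOpenEmbedding ((↑) : O → (affineSpace K ι).carrier)
    hO.isOpenEmbedding_subtypeVal
  let q : LTSeries {V : IrreducibleCloseds (affineSpace K ι).carrier |
      (((↑) : O → (affineSpace K ι).carrier) ⁻¹' (V : Set (affineSpace K ι).carrier)).Nonempty} :=
    LTSeries.mk (Nat.card ι)
      (fun i => ⟨⟨flagSet e v i, isIrreducible_flagSet e v i, isClosed_flagSet e v i⟩,
        ⟨⟨v, hv⟩, fun j _ => rfl⟩⟩)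
      fun i j hij => flagSet_ssubset e v hij (by omega)
  exact Order.LTSeries.length_le_krullDim (q.map e'.symm e'.symm.strictMono)

theorem IsIso.isInducing {p : X → Y} (hp : IsIso p) : Topology.IsInducing p := by
  obtain ⟨hp, q, hq, h, -⟩ := hp
  exact .of_comp hp.continuous hq.continuous (h.comp_eq_id ▸ .id)

namespace AffineChart

theorem topologicalKrullDim_source_le [Finite ι] (C : AffineChart X ι) :
    topologicalKrullDim (C.source : Set X) ≤ Nat.card ι :=
  (C.isInducing_coord (T := (C.source : Set X)) .subtypeVal fun t => t.2).topologicalKrullDim_le.trans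
    topologicalKrullDim_affineSpace_le

theorem noetherianSpace_source [Finite ι] (C : AffineChart X ι) :
    NoetherianSpace (C.source : Set X) :=
  have := noetherianSpace_affineSpace (K := K) (ι := ι)
  (C.isInducing_coord (T := (C.source : Set X)) .subtypeVal fun t => t.2).noetherianSpace

/-- A nonempty open subset of a chart with target the affine space has the dimension of that
space. -/
theorem le_topologicalKrullDim [Infinite K] [Finite ι] (C : AffineChart X ι)
    (hC : C.target = Set.univ) {V : Opens X} (hV : V ≤ C.source) (hne : (V : Set X).Nonempty) :
    (Nat.card ι : WithBot ℕ∞) ≤ topologicalKrullDim (V : Set X) := by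
  have hs : IsMorphism (X := affineSpace K ι) (Y := X)
      (fun z => C.point ⟨z, hC ▸ Set.mem_univ z⟩) :=
    C.isMorphism_point.comp (isMorphism_id.codRestrict fun z => hC ▸ Set.mem_univ z)
  obtain ⟨x, hx⟩ := hne
  let O : Set (affineSpace K ι).carrier :=
    (fun z : (affineSpace K ι).carrier => C.point ⟨z, hC ▸ Set.mem_univ z⟩) ⁻¹' (V : Set X)
  have hO : IsOpen O := V.isOpen.preimage hs.continuous
  refine (le_topologicalKrullDim_of_isOpen hO
    ⟨C.coord x, (Set.mem_of_eq_of_mem (C.point_coord x (hV hx)) hx : C.point _ ∈ (V : Set X))⟩).trans ?_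
  have h1 : Continuous (fun z : O => (⟨_, z.2⟩ : (V : Set X))) :=
    (hs.continuous.comp continuous_subtype_val).subtype_mk _
  have h2 := (C.isInducing_coord (T := (V : Set X)) .subtypeVal fun t => hV t.2).continuous
  refine (Topology.IsInducing.of_comp h1 h2 ?_).topologicalKrullDim_le
  refine Eq.mp (congrArg Topology.IsInducing (funext fun z => ?_))
    (Topology.IsInducing.subtypeVal (t := O))
  exact (C.coord_point ⟨z.1, hC ▸ Set.mem_univ z.1⟩).symm

end AffineChart

end SpaceWithFunctions

/-! ### Subspaces as graphs over some of their coordinates. -/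

namespace Matrix

variable {K : Type*} [Field K] {k n : ℕ}

/-- A subspace of dimension `d` is a graph over `d` of the coordinates. -/
theorem exists_coordinates (W : Submodule K (Fin n → K)) {d : ℕ} (hd : Module.finrank K W = d) :
    ∃ (e : Fin d → Fin n) (N : Matrix (Fin d) (Fin n) K), ∀ v ∈ W, ∀ j, v j = ∑ s, v (e s) * N s j := by
  let Λ : {L : Submodule K (Fin n → K) // Module.finrank K L = d} := ⟨W, hd⟩
  obtain ⟨e, he⟩ := Determinantal.exists_mem_grassChart Λ
  refine ⟨e, Determinantal.normalizedFrame e Λ, fun v hv => ?_⟩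
  have hv' : v ∈ Submodule.span K (Set.range (Determinantal.normalizedFrame e Λ).row) := by
    rw [Determinantal.span_normalizedFrame he]
    exact hv
  obtain ⟨c, rfl⟩ := (Submodule.mem_span_range_iff_exists_fun K).mp hv'
  have h1 : ∀ s t, Determinantal.normalizedFrame e Λ s (e t) = (1 : Matrix (Fin d) (Fin d) K) s t :=
    fun s t => congrFun (congrFun (normalizeCols_submatrix he) s) t
  have h2 : ∀ s, (∑ i, c i • (Determinantal.normalizedFrame e Λ).row i) (e s) = c s := by
    intro s
    simp [Finset.sum_apply, Matrix.row, h1, Matrix.one_apply]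
  intro j
  simp only [h2]
  simp [Finset.sum_apply, Matrix.row]

/-- The coordinates `e` map L onto K^k, since the rows of A go to the standard basis; then rank and
nullity. -/
theorem finrank_inf_ker_funLeft_add (L : Submodule K (Fin n → K)) {e : Fin k → Fin n}
    {A : Matrix (Fin k) (Fin n) K} (hA : A.submatrix id e = 1) (hL : ∀ i, A i ∈ L) :
    Module.finrank K (L ⊓ LinearMap.ker (LinearMap.funLeft K K e) : Submodule K (Fin n → K)) + k =
      Module.finrank K L := by
  let r : L →ₗ[K] (Fin k → K) := (LinearMap.funLeft K K e).domRestrict L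
  have h1 : LinearMap.range r = ⊤ := by
    refine LinearMap.range_eq_top.mpr fun c => ⟨⟨∑ i, c i • A i, L.sum_mem fun i _ =>
      L.smul_mem _ (hL i)⟩, ?_⟩
    ext j
    have h2 : ∀ i, A i (e j) = (1 : Matrix (Fin k) (Fin k) K) i j := fun i =>
      congrFun (congrFun hA i) j
    simp [r, LinearMap.funLeft_apply, Finset.sum_apply, h2, Matrix.one_apply]
  have h2 := LinearMap.finrank_range_add_finrank_ker r
  rw [h1, finrank_top, Module.finrank_fin_fun, add_comm] at h2
  rw [← h2]
  congr 1
  have h3 : LinearMap.ker r = (LinearMap.ker (LinearMap.funLeft K K e)).comap L.subtype := by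
    ext v
    rfl
  rw [h3, ← Submodule.map_comap_subtype]
  exact Submodule.finrank_map_subtype_eq L _

end Matrix

namespace Determinantal

open SpaceWithFunctions
open scoped Matrix

variable {K : Type u} [Field K] {m n k l : ℕ}

/-! ### Dimensions -/

theorem finrank_ker_lt (φ : Projectivization K (Matrix (Fin m) (Fin n) K)) :
    Module.finrank K (ker φ) < n := by
  have h1 := φ.rep.rank_add_finrank_ker
  have h2 : Matrix.rank φ.rep ≠ 0 := fun h => by
    rw [Matrix.rank, Submodule.finrank_eq_zero, LinearMap.range_eq_bot] at h
    exact φ.rep_nonzero (Matrix.toLin'.map_eq_zero_iff.mp h)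
  rw [Fintype.card_fin] at h1
  rw [ker]
  omega

theorem noetherianSpace_tauHat (hkl : k + l = n) : NoetherianSpace (tauHat K m n k).carrier := by
  have h : (⋃ p : (Fin k ⊕ Fin l ≃ Fin n) × (Fin m × Fin l), ((freeChart K p.1 p.2).source :
      Set (tauHat K m n k).carrier)) = Set.univ := by
    refine Set.eq_univ_of_forall fun w => ?_
    obtain ⟨σ, a, h⟩ := exists_mem_freeChart hkl w
    exact Set.mem_iUnion.mpr ⟨(σ, a), h⟩
  have := fun p : (Fin k ⊕ Fin l ≃ Fin n) × (Fin m × Fin l) =>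
    (freeChart K (m := m) p.1 p.2).noetherianSpace_source
  have := NoetherianSpace.iUnion fun p : (Fin k ⊕ Fin l ≃ Fin n) × (Fin m × Fin l) =>
    ((freeChart K p.1 p.2).source : Set (tauHat K m n k).carrier)
  rw [h] at this
  exact noetherian_univ_iff.mp this

theorem topologicalKrullDim_tauHat_le (hkl : k + l = n) :
    topologicalKrullDim (tauHat K m n k).carrier ≤ (((k + m) * l - 1 : ℕ) : WithBot ℕ∞) :=
  topologicalKrullDim_le_of_cover fun w => by
    obtain ⟨σ, a, h⟩ := exists_mem_freeChart hkl w
    refine ⟨_, (freeChart K σ a).source.isOpen, h, ?_⟩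
    rw [← card_freeIndex a]
    exact (freeChart K σ a).topologicalKrullDim_source_le

/-- The bound for the incidence variety descends along the closed surjection ν. It is used later
with larger kernel dimensions in place of k. -/
theorem topologicalKrullDim_tau_le [IsAlgClosed K] (hkl : k + l = n) :
    topologicalKrullDim (tau K m n k).carrier ≤ (((k + m) * l - 1 : ℕ) : WithBot ℕ∞) :=
  have := noetherianSpace_tauHat (K := K) (m := m) hkl
  (isClosedMap_nu.topologicalKrullDim_le isMorphism_nu.continuous nu_surjective).trans
    (topologicalKrullDim_tauHat_le hkl)

/-- A nonempty open subset of a free chart lies in the locus where ν is an isomorphism, so it embeds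
in τ. -/
theorem le_topologicalKrullDim_tau [Infinite K] (hkl : k + l = n) (hl : 0 < l) (hlm : l ≤ m) :
    (((k + m) * l - 1 : ℕ) : WithBot ℕ∞) ≤ topologicalKrullDim (tau K m n k).carrier := by
  have h := nonempty_minorOpenHat (K := K) (σ := finSumFinEquiv.trans (finCongr hkl))
    (j₀ := ⟨0, hl⟩) (Fin.castLE_injective hlm)
  rw [← card_freeIndex (Fin.castLE hlm ⟨0, hl⟩, ⟨0, hl⟩)]
  refine (AffineChart.le_topologicalKrullDim _ rfl minorOpenHat_le_freeChart_source h).trans ?_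
  refine Topology.IsInducing.topologicalKrullDim_le ?_ (f := fun w => nu K m n k w.1)
  exact Topology.IsInducing.subtypeVal.comp isIso_nu_restrict.isInducing

theorem topologicalKrullDim_tau [IsAlgClosed K] (hkl : k + l = n) (hl : 0 < l) (hlm : l ≤ m) :
    topologicalKrullDim (tau K m n k).carrier = (((k + m) * l - 1 : ℕ) : WithBot ℕ∞) :=
  have : Infinite K := IsAlgClosed.instInfinite
  (topologicalKrullDim_tau_le hkl).antisymm (le_topologicalKrullDim_tau hkl hl hlm)

/-! ### Fibres -/

/-- The difference of two normalized frames with rows in ker φ has rows in the d-dimensional space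
of kernel vectors vanishing in the coordinates `e`. Each of the k rows is thus determined by d
coordinates. -/
theorem topologicalKrullDim_fibre_chart_le (φ : (tau K m n k).carrier) (e : Fin k → Fin n)
    (a : Fin m × Fin n) {d : ℕ} (hd : Module.finrank K (ker φ.1) = k + d) :
    topologicalKrullDim {w : nu K m n k ⁻¹' {φ} | w.1 ∈ (tauHatChart K e a).source} ≤
      ((k * d : ℕ) : WithBot ℕ∞) := by
  let T : Set (nu K m n k ⁻¹' {φ}) := {w | w.1 ∈ (tauHatChart K e a).source}
  rcases isEmpty_or_nonempty T with hT | ⟨⟨w₀, hw₀⟩⟩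
  · exact topologicalKrullDim_le_of_cover (X := T) fun w => isEmptyElim w
  have hw : ∀ w : nu K m n k ⁻¹' {φ}, w.1.1.2 = φ.1 := fun w => congrArg Subtype.val w.2
  let A : nu K m n k ⁻¹' {φ} → Matrix (Fin k) (Fin n) K := fun w => normalizedFrame e w.1.1.1
  have hA : ∀ w ∈ T, (A w).submatrix id e = 1 ∧ ∀ i, A w i ∈ ker φ.1 := fun w hwT => by
    refine ⟨Matrix.normalizeCols_submatrix hwT.1, fun i => ?_⟩
    have h1 := w.1.2.2
    rw [hw, ← span_normalizedFrame hwT.1] at h1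
    exact h1 (Submodule.subset_span ⟨i, rfl⟩)
  obtain ⟨f, N, hN⟩ := Matrix.exists_coordinates
    (ker φ.1 ⊓ LinearMap.ker (LinearMap.funLeft K K e)) (d := d) (by
      have := Matrix.finrank_inf_ker_funLeft_add (ker φ.1) (hA w₀ hw₀).1 (hA w₀ hw₀).2
      omega)
  have hAN : ∀ w ∈ T, ∀ i j, A w i j =
      A w₀ i j + ∑ s, (A w i (f s) - A w₀ i (f s)) * N s j := by
    intro w hwT i j
    refine eq_add_of_sub_eq' (hN (A w i - A w₀ i) ⟨sub_mem ((hA w hwT).2 i) ((hA w₀ hw₀).2 i), ?_⟩ j)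
    refine LinearMap.mem_ker.mpr (funext fun i' => ?_)
    exact sub_eq_zero.mpr (congrFun (congrFun ((hA w hwT).1.trans (hA w₀ hw₀).1.symm) i) i')
  have hC := (tauHatChart K e a).isInducing_coord (T := T) (f := fun w => w.1.1)
    (Topology.IsInducing.subtypeVal.comp Topology.IsInducing.subtypeVal) fun w => w.2
  have hp : IsMorphism (X := affineSpace K (Fin k × Fin n ⊕ Fin m × Fin n))
      (Y := affineSpace K (Fin k × Fin d)) (fun z p => z (Sum.inl (p.1, f p.2))) :=
    isMorphism_affineSpace fun p => coord_mem_reg (Sum.inl (p.1, f p.2)) ⊤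
  have hq : IsMorphism (X := affineSpace K (Fin k × Fin d))
      (Y := affineSpace K (Fin k × Fin n ⊕ Fin m × Fin n))
      (fun y => Sum.elim (fun p => A w₀ p.1 p.2 + ∑ s, (y (p.1, s) - A w₀ p.1 (f s)) * N s p.2)
        fun p => normalizedRep a φ.1 p.1 p.2) := by
    refine isMorphism_affineSpace ?_
    rintro (p | p)
    · refine add_mem (const_mem_reg (X := affineSpace K (Fin k × Fin d)) ⊤ _)
        (sum_mem_subalgebra fun s _ => mul_mem (sub_mem (coord_mem_reg (p.1, s) ⊤) ?_) ?_)
      · exact const_mem_reg (X := affineSpace K (Fin k × Fin d)) ⊤ _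
      · exact const_mem_reg (X := affineSpace K (Fin k × Fin d)) ⊤ _
    · exact const_mem_reg (X := affineSpace K (Fin k × Fin d)) ⊤ _
  -- Projecting to the kd chosen coordinates and reconstructing by the affine map gives back all
  -- chart coordinates, so the projection already induces the topology of the fibre.
  have hg := Topology.IsInducing.of_comp (hp.continuous.comp hC.continuous) hq.continuous
    (Eq.mp (congrArg Topology.IsInducing (funext fun w => ?_)) hC)
  · refine hg.topologicalKrullDim_le.trans (topologicalKrullDim_affineSpace_le.trans_eq ?_)
    simp
  · refine funext (α := Fin k × Fin n ⊕ Fin m × Fin n) ?_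
    rintro (p | p)
    · exact hAN w.1 w.2 p.1 p.2
    · exact congrArg (fun φ => normalizedRep a φ p.1 p.2) (hw w.1)

theorem topologicalKrullDim_fibre_le (φ : (tau K m n k).carrier) {d : ℕ}
    (hd : Module.finrank K (ker φ.1) = k + d) :
    topologicalKrullDim (nu K m n k ⁻¹' {φ}) ≤ ((k * d : ℕ) : WithBot ℕ∞) :=
  topologicalKrullDim_le_of_cover fun w => by
    obtain ⟨e, he⟩ := exists_mem_grassChart w.1.1.1
    obtain ⟨a, ha⟩ := exists_mem_projChart w.1.1.2
    exact ⟨_, (tauHatChart K e a).source.isOpen.preimage continuous_subtype_val, ⟨he, ha⟩,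
      topologicalKrullDim_fibre_chart_le φ e a hd⟩

/-- Such a locus embeds in the determinantal variety for j, whose dimension is bounded by the same
formula. -/
theorem topologicalKrullDim_le_of_finrank_ker [IsAlgClosed K] {j l' : ℕ} (hj : j + l' = n)
    {Z : Set (tau K m n k).carrier} (hZ : ∀ φ ∈ Z, j ≤ Module.finrank K (ker φ.1)) :
    topologicalKrullDim Z ≤ (((j + m) * l' - 1 : ℕ) : WithBot ℕ∞) := by
  refine le_trans ?_ (topologicalKrullDim_tau_le (K := K) (m := m) hj)
  have h1 : Continuous (fun φ : Z => (φ.1.1 : (projMatrix K m n).carrier)) :=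
    continuous_subtype_val.comp continuous_subtype_val
  have h2 : Continuous (Y := (tau K m n j).carrier)
      (fun φ : Z => (⟨φ.1.1, hZ φ.1 φ.2⟩ : tauSet K m n j)) := h1.subtype_mk _
  have h3 : Topology.IsInducing (fun φ : Z => (φ.1.1 : (projMatrix K m n).carrier)) :=
    Topology.IsInducing.subtypeVal.comp Topology.IsInducing.subtypeVal
  exact (Topology.IsInducing.of_comp h2 (continuous_subtype_val
    (X := (projMatrix K m n).carrier)) h3).topologicalKrullDim_le

/-- With s least such that i ≤ ks, the locus lies in the determinantal variety for k + s, and the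
difference of dimensions is s(2k + s + m - n) ≥ 2i + s² > 2i. -/
theorem two_mul_lt_codim [IsAlgClosed K] (hmn : n ≤ m) (hk : k < n) {i : ℕ} (hi : 0 < i) :
    ((2 * i : ℕ) : ℕ∞) < (tau K m n k).codim
      {x | (i : WithBot ℕ∞) ≤ topologicalKrullDim (nu K m n k ⁻¹' {x})} := by
  rw [codim]
  split_ifs with h
  · exact ENat.natCast_lt_top _
  -- In this proof l is n - k - 1, one less than in the dimension formulas.
  obtain ⟨l, rfl⟩ := Nat.exists_eq_add_of_lt hk
  have hfib : ∀ φ : (tau K m (k + l + 1) k).carrier,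
      (i : WithBot ℕ∞) ≤ topologicalKrullDim (nu K m (k + l + 1) k ⁻¹' {φ}) →
      ∃ d, Module.finrank K (ker φ.1) = k + d ∧ i ≤ k * d := by
    intro φ hφ
    obtain ⟨d, hd⟩ := Nat.exists_eq_add_of_le (show k ≤ Module.finrank K (ker φ.1) from φ.2)
    refine ⟨d, hd, ?_⟩
    have := hφ.trans (topologicalKrullDim_fibre_le φ hd)
    exact_mod_cast this
  obtain ⟨φ, hφ⟩ := Set.nonempty_iff_ne_empty.mpr h
  obtain ⟨d₀, hd₀, hi₀⟩ := hfib φ hφ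
  have hex : ∃ s, i ≤ k * s := ⟨d₀, hi₀⟩
  classical
  let s := Nat.find hex
  have hs : i ≤ k * s := Nat.find_spec hex
  have hmin : ∀ d, i ≤ k * d → s ≤ d := fun d hd => Nat.find_min' hex hd
  have hlt := finrank_ker_lt φ.1
  have hsl := hmin d₀ hi₀
  -- A nonzero matrix has kernel dimension below n, so s ≤ d₀ ≤ l; this makes the locus for k + s
  -- meaningful.
  obtain ⟨t, rfl⟩ : ∃ t, l = s + t := Nat.exists_eq_add_of_le (by omega)
  have h1 := topologicalKrullDim_tau (K := K) (m := m) (n := k + (s + t) + 1) (k := k)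
    (l := s + t + 1) (by omega) (by omega) (by omega)
  have h2 := topologicalKrullDim_le_of_finrank_ker (m := m) (n := k + (s + t) + 1) (k := k)
    (j := k + s) (l' := t + 1) (by omega)
    (Z := {x | (i : WithBot ℕ∞) ≤ topologicalKrullDim (nu K m (k + (s + t) + 1) k ⁻¹' {x})})
    fun ψ hψ => by
      obtain ⟨d, hd, hid⟩ := hfib ψ hψ
      have := hmin d hid
      omega
  have h3 : (topologicalKrullDim {x | (i : WithBot ℕ∞) ≤
      topologicalKrullDim (nu K m (k + (s + t) + 1) k ⁻¹' {x})}).unbotD 0 ≤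
        (((k + s + m) * (t + 1) - 1 : ℕ) : ℕ∞) := by
    rw [WithBot.unbotD_le_iff (fun _ => zero_le)]
    exact h2
  rw [h1]
  refine lt_of_lt_of_le ?_ (tsub_le_tsub_left h3 _)
  have h4 : (((((k + m) * (s + t + 1) - 1 : ℕ) : ℕ∞) : WithBot ℕ∞)).unbotD 0 =
    (((k + m) * (s + t + 1) - 1 : ℕ) : ℕ∞) := rfl
  refine lt_of_lt_of_eq ?_ (congrArg (· - _) h4.symm)
  rw [← ENat.natCast_sub, Nat.cast_lt]
  have hs0 : 0 < s := Nat.pos_of_ne_zero fun h0 => by rw [h0] at hs; omega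
  obtain ⟨c, rfl⟩ := Nat.exists_eq_add_of_le hmn
  have h5 : (k + (k + (s + t) + 1 + c)) * (s + t + 1) =
      (k + s + (k + (s + t) + 1 + c)) * (t + 1) + s * (2 * k + s + c) := by ring
  -- Both dimension formulas end in a natural subtraction of 1; positivity of the products ensures
  -- that the two ones cancel.
  have h6 : 1 ≤ (k + s + (k + (s + t) + 1 + c)) * (t + 1) := Nat.mul_pos (by omega) (by omega)
  have h7 : s * (2 * k + s + c) = 2 * (k * s) + s * (s + c) := by ring
  have h8 : 0 < s * (s + c) := Nat.mul_pos hs0 (by omega)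
  omega

end Determinantal

theorem mainTheorem8 {K : Type u} [Field K] [IsAlgClosed K] [CharZero K]
    (m n k : ℕ) (hmn : n ≤ m) (hk : k < n) :
    SpaceWithFunctions.IsSmallResolution (Determinantal.nu K m n k) := by
  have : Infinite K := IsAlgClosed.instInfinite
  obtain ⟨l, rfl⟩ := Nat.exists_eq_add_of_le hk.le
  exact ⟨⟨Determinantal.isVariety_tau rfl (by omega) (by omega),
    Determinantal.isVariety_tauHat rfl (by omega) (by omega), Determinantal.isSmooth_tauHat rfl,
    Determinantal.isMorphism_nu, Determinantal.isProper_nu,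
    Determinantal.isBirational_nu rfl (by omega) (by omega)⟩,
    fun _ hi => Determinantal.two_mul_lt_codim hmn hk hi⟩
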